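/- **Theorem 1.2 (tangency principles for $\gamma$-translators).** *Setting.* Let $\Gamma\subset\mathbb R^n$ be an open cone, invariant under permutations of coordinates, with $\Gamma_+:=\{\lambda\in\mathbb R^n:\lambda_i>0\ \forall i\}\subset\Gamma$ (for instance $\Gamma=\Gamma_+$). Let $\gamma:\Gamma\to(0,\infty)$ satisfy: a) $\gamma$ is smooth and symmetric; b) $\gamma$ is $\alpha$-homogeneous for some $\alpha>0$, that is, $\gamma(c\lambda)=c^\alpha\gamma(\lambda)$ for $c>0$; c) $\partial\gamma/\partial\lambda_i>0$ on $\Gamma$ for every $i$; d) $\gamma$ extends continuously to $\overline\Gamma$ with value $0$ on $\partial\Gamma$; the extension is again denoted $\gamma$. A *$\gamma$-translator* is a smooth embedded hypersurface $\Sigma\subset\mathbb R^{n+1}$, possibly with boundary, with a continuous unit normal field $\nu$ such that $\gamma(\lambda)=\langle\nu,e_{n+1}\rangle$ at every point of $\Sigma$. Here $\lambda=(\lambda_1,\dots,\lambda_n)\in\overline\Gamma$ are the principal curvatures, that is, the eigenvalues of $-d\nu$ on $T\Sigma$. Write $\partial\Sigma$ and $\operatorname{int}\Sigma=\Sigma\setminus\partial\Sigma$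 for the boundary and interior of $\Sigma$ as a manifold with boundary. Let $\Sigma_1,\Sigma_2\subset\mathbb R^{n+1}$ be connected $\gamma$-translators, $\Sigma_1$ strictly convex ($\lambda\in\Gamma_+$ everywhere on $\Sigma_1$) and $\Sigma_2$ convex ($\lambda\in\overline{\Gamma_+}$ everywhere on $\Sigma_2$). Suppose that $\Sigma_1$ lies at one side of $\Sigma_2$: near each common point $q$ there is a smooth embedded hypersurface that contains $\Sigma_2$ near $q$ and has $\Sigma_1$ in one of its two closed sides near $q$. 1. (*Interior tangency principle*) If $p\in\operatorname{int}\Sigma_1\cap\operatorname{int}\Sigma_2$ and $T_p\Sigma_1=T_p\Sigma_2$, then $\Sigma_1$ and $\Sigma_2$ coincide, in the sense made precise below. 2. (*Boundary tangency principle*) Let $\Pi$ be a hyperplane with $\partial\Sigma_1\cup\partial\Sigma_2\subset\Pi$ that both $\Sigma_1$ and $\Sigma_2$ meet transversally, and let $p\in\partial\Sigma_1\cap\partial\Sigma_2$ be such that near $p$ both hypersurfaces lie in the same closed half-space bounded by $\Pi$. If $T_p\Sigma_1=T_p\Sigma_2$ and $T_p\partial\Sigma_1=T_p\partial\Sigma_2$,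 then $\Sigma_1$ and $\Sigma_2$ coincide, in the sense made precise below. In both cases "coincide" means: $\Sigma_1\cap U=\Sigma_2\cap U$ for some neighbourhood $U$ of $p$; and if moreover $\Sigma_1$ and $\Sigma_2$ are complete (every curve $[0,1)\to\Sigma_i$ that is Lipschitz as a map into $\mathbb R^{n+1}$ converges, as the parameter tends to $1$, to a point of $\Sigma_i$) and no boundary point of one is an interior point of the other, then $\Sigma_1=\Sigma_2$. -/

import Mathlib

open scoped ContDiff Topology

/-- The Euclidean space `ℝ^(n+1)`; its last coordinate is the direction of translation. -/
abbrev Ambient (n : ℕ) : Type := EuclideanSpace ℝ (Fin (n + 1))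

/-- The open positive cone `Γ₊ ⊆ ℝⁿ`. -/
def positiveCone (n : ℕ) : Set (Fin n → ℝ) := {l | ∀ i, 0 < l i}

/-- The standing hypotheses a)-d) on the speed `γ`, which is a function on the open symmetric
cone `Γ ⊇ Γ₊`. The values of `γ` on `closure Γ` are those of its continuous extension, and the
values outside `closure Γ` play no role. -/
structure IsSpeedFunction {n : ℕ} (Γ : Set (Fin n → ℝ)) (γ : (Fin n → ℝ) → ℝ) (α : ℝ) : Prop where
  isOpen : IsOpen Γ
  cone_mem : ∀ l ∈ Γ, ∀ c : ℝ, 0 < c → c • l ∈ Γ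
  perm_mem : ∀ l ∈ Γ, ∀ σ : Equiv.Perm (Fin n), l ∘ σ ∈ Γ
  positiveCone_subset : positiveCone n ⊆ Γ
  smooth : ContDiffOn ℝ ∞ γ Γ
  pos : ∀ l ∈ Γ, 0 < γ l
  symmetric : ∀ l ∈ Γ, ∀ σ : Equiv.Perm (Fin n), γ (l ∘ σ) = γ l
  degree_pos : 0 < α
  homogeneous : ∀ l ∈ Γ, ∀ c : ℝ, 0 < c → γ (c • l) = c ^ α * γ l
  increasing : ∀ l ∈ Γ, ∀ i, 0 < fderiv ℝ γ l (Pi.single i 1)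
  continuousOn_closure : ContinuousOn γ (closure Γ)
  eq_zero_of_frontier : ∀ l ∈ frontier Γ, γ l = 0

/-- Near `q`, the set `M` is a smooth embedded hypersurface without boundary: a regular level
set. -/
def IsInteriorPoint {n : ℕ} (M : Set (Ambient n)) (q : Ambient n) : Prop :=
  ∃ (U : Set (Ambient n)) (f : Ambient n → ℝ), IsOpen U ∧ q ∈ U ∧ ContDiffOn ℝ ∞ f U ∧
    f q = 0 ∧ fderiv ℝ f q ≠ 0 ∧ M ∩ U = {x ∈ U | f x = 0}

/-- Near `q`, the set `M` is a smooth embedded hypersurface with boundary, and `q` lies on the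
boundary: `M` is one half `{f = 0, g ≥ 0}` of a regular level set, cut transversally. -/
def IsBoundaryPoint {n : ℕ} (M : Set (Ambient n)) (q : Ambient n) : Prop :=
  ∃ (U : Set (Ambient n)) (f g : Ambient n → ℝ), IsOpen U ∧ q ∈ U ∧
    ContDiffOn ℝ ∞ f U ∧ ContDiffOn ℝ ∞ g U ∧ f q = 0 ∧ g q = 0 ∧
    LinearIndependent ℝ ![fderiv ℝ f q, fderiv ℝ g q] ∧
    M ∩ U = {x ∈ U | f x = 0 ∧ 0 ≤ g x}

/-- The manifold interior of `M`. -/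
def hypInterior {n : ℕ} (M : Set (Ambient n)) : Set (Ambient n) := {q | IsInteriorPoint M q}

/-- The manifold boundary of `M`. -/
def hypBoundary {n : ℕ} (M : Set (Ambient n)) : Set (Ambient n) := {q | IsBoundaryPoint M q}

/-- A smooth embedded hypersurface of `ℝ^(n+1)`, with possibly empty boundary. -/
def IsEmbeddedHypersurface {n : ℕ} (M : Set (Ambient n)) : Prop :=
  ∀ q ∈ M, q ∈ hypInterior M ∨ q ∈ hypBoundary M

/-- The tangent space at `q`, as a linear subspace of `ℝ^(n+1)`. At a boundary point this is the
full tangent space and not only a half-space. -/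
noncomputable def tangentSpaceAt {n : ℕ} (M : Set (Ambient n)) (q : Ambient n) :
    Submodule ℝ (Ambient n) :=
  Submodule.span ℝ (tangentConeAt ℝ M q)

/-- `ν` is a continuous (hence smooth) unit normal field along `M`. -/
def IsUnitNormalField {n : ℕ} (M : Set (Ambient n)) (ν : Ambient n → Ambient n) : Prop :=
  ContinuousOn ν M ∧ ∀ q ∈ M, ‖ν q‖ = 1 ∧ ν q ∈ (tangentSpaceAt M q)ᗮ

/-- `l` lists, with multiplicity and in some order, the principal curvatures of `M` at `q` with
respect to the unit normal `ν`, that is, the eigenvalues of the Weingarten map `-dν` on the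
tangent space. With this sign a round sphere with its inward normal has positive curvatures. -/
def IsPrincipalCurvatures {n : ℕ} (M : Set (Ambient n)) (ν : Ambient n → Ambient n)
    (q : Ambient n) (l : Fin n → ℝ) : Prop :=
  ∃ (A : Ambient n →L[ℝ] Ambient n) (e : Fin n → Ambient n),
    HasFDerivWithinAt ν A M q ∧ Orthonormal ℝ e ∧ (∀ i, e i ∈ tangentSpaceAt M q) ∧
    ∀ i, A (e i) = -(l i • e i)

/-- `M`, with unit normal `ν`, is an embedded connected `γ`-translator:
`γ(λ) = ⟨ν, e_(n+1)⟩` at every point. -/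
structure IsTranslator {n : ℕ} (Γ : Set (Fin n → ℝ)) (γ : (Fin n → ℝ) → ℝ)
    (M : Set (Ambient n)) (ν : Ambient n → Ambient n) : Prop where
  hypersurface : IsEmbeddedHypersurface M
  connected : IsConnected M
  normal : IsUnitNormalField M ν
  equation : ∀ q ∈ M, ∃ l ∈ closure Γ, IsPrincipalCurvatures M ν q l ∧
    γ l = inner ℝ (ν q) (EuclideanSpace.single (Fin.last n) 1)

/-- All principal curvatures with respect to `ν` are positive. -/
def IsStrictlyConvexHyp {n : ℕ} (M : Set (Ambient n)) (ν : Ambient n → Ambient n) : Prop :=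
  ∀ q ∈ M, ∀ l, IsPrincipalCurvatures M ν q l → l ∈ positiveCone n

/-- All principal curvatures with respect to `ν` are nonnegative. -/
def IsConvexHyp {n : ℕ} (M : Set (Ambient n)) (ν : Ambient n → Ambient n) : Prop :=
  ∀ q ∈ M, ∀ l, IsPrincipalCurvatures M ν q l → l ∈ closure (positiveCone n)

/-- `M₁` lies at one side of `M₂`: near every common point `q` there is a smooth hypersurface
`{f = 0}` containing `M₂` (equal to `M₂` near `q` if `q` is interior to `M₂`) such that `M₁` lies
in one of its two closed sides. Replacing `f` by `-f` exchanges the sides. -/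
def LiesAtOneSide {n : ℕ} (M₁ M₂ : Set (Ambient n)) : Prop :=
  ∀ q ∈ M₁ ∩ M₂, ∃ (U : Set (Ambient n)) (f : Ambient n → ℝ), IsOpen U ∧ q ∈ U ∧
    ContDiffOn ℝ ∞ f U ∧ fderiv ℝ f q ≠ 0 ∧ (∀ x ∈ M₂ ∩ U, f x = 0) ∧ ∀ x ∈ M₁ ∩ U, 0 ≤ f x

/-- Completeness for the intrinsic distance: a curve of finite length in `M`, parametrized on
`[0, 1)` by a Lipschitz map, has an endpoint in `M`. Closed subsets have this property. -/
def IsCompleteHyp {n : ℕ} (M : Set (Ambient n)) : Prop :=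
  ∀ (c : ℝ → Ambient n) (K : NNReal), LipschitzOnWith K c (Set.Ico 0 1) →
    Set.MapsTo c (Set.Ico 0 1) M → ∃ q ∈ M, Filter.Tendsto c (𝓝[<] 1) (𝓝 q)

/-- No boundary point of one hypersurface is an interior point of the other. This holds when the
boundaries are empty, when they are equal, and when both hypersurfaces lie in a closed half-space,
meet its bounding hyperplane transversally, and have their boundaries in it. -/
def BoundariesCompatible {n : ℕ} (M₁ M₂ : Set (Ambient n)) : Prop :=
  Disjoint (hypBoundary M₁) (hypInterior M₂) ∧ Disjoint (hypBoundary M₂) (hypInterior M₁)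

/-- The hyperplane `{x | ⟨a, x⟩ = b}`, used with `a ≠ 0`. -/
def affineHyperplane {n : ℕ} (a : Ambient n) (b : ℝ) : Set (Ambient n) := {x | inner ℝ a x = b}

/-- `M` meets the hyperplane `{⟨a, x⟩ = b}` transversally. -/
def IsTransversalTo {n : ℕ} (M : Set (Ambient n)) (a : Ambient n) (b : ℝ) : Prop :=
  ∀ q ∈ M ∩ affineHyperplane a b, ∃ w ∈ tangentSpaceAt M q, inner ℝ a w ≠ 0

/-! Choose a unit vector `v` transversal to the common tangent space at `p` and write both
hypersurfaces as graphs of functions `u₁`, `u₂` over the orthogonal complement of `v`. At a boundary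
point `v` is taken parallel to the hyperplane Π, so that both graphs live over the same half-space.
The translator equation becomes `γ(λ) = φ(Du)`, where `λ` lists the eigenvalues of `D²u` relative to
a metric depending on `Du`, and `φ(Du)` is the vertical component of the normal. One-sidedness
becomes an ordering of the two functions, which agree to first order at the contact point. What is
needed is a strong maximum principle, with Hopf's lemma for a contact point on the boundary.

The delicate point is ellipticity. `Γ` need not be convex, and the derivatives of `γ` are not
controlled at its frontier. Strict convexity of the first hypersurface makes the common normal at
`p` point strictly upwards. Near `p` the speed of the second one is then also positive, so its
curvatures lie in `Γ` itself. A segment between such a nonnegative list and a positive list stays in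
`Γ` (`IsSpeedFunction.segment_subset`), and `γ` is increasing near it. Since eigenvalues need not be
differentiable functions of the Hessian, the equation is not linearized: sorted eigenvalues are
compared through Rayleigh quotients (`IsDiag.le_of_rayleigh_le`). In this way a small multiple of a
concentrated Gaussian, added to the lower solution, gives a strict subsolution
(`exists_strict_subsolution`). Hopf's lemma (`hopf_contact`) follows by the usual barrier argument,
and the strong maximum principle (`eqOn_of_touching`) by the usual choice of a touching ball.

For the global statement, consider the open set of points near which the two sets agree.
One-sidedness forces tangency at every common interior point, so all these points belong to it. The
interior part of a hypersurface is locally connected and dense up to the boundary, which lets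
agreement pass to boundary points when no boundary point of one is interior to the other.
Completeness prevents a short path in one hypersurface, starting in the set of agreement, from
leaving the other. Connectedness concludes. -/

/-! ### Relative eigenvalues of bilinear forms and their comparison. -/

section Diagonalization

variable {n : ℕ} {V : Type*} [NormedAddCommGroup V] [NormedSpace ℝ V]

/-- The family `e` is orthonormal for the bilinear form `N`. -/
def IsOrthonormalFor (N : V →L[ℝ] V →L[ℝ] ℝ) (e : Fin n → V) : Prop :=
  ∀ i j, N (e i) (e j) = if i = j then 1 else 0

/-- `l` lists the eigenvalues of the bilinear form `H` relative to the bilinear form `N`. -/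
def IsDiag (N H : V →L[ℝ] V →L[ℝ] ℝ) (l : Fin n → ℝ) : Prop :=
  ∃ e : Fin n → V, IsOrthonormalFor N e ∧ ∀ i j, H (e i) (e j) = if i = j then l i else 0

theorem IsOrthonormalFor.linearIndependent {N : V →L[ℝ] V →L[ℝ] ℝ} {e : Fin n → V}
    (he : IsOrthonormalFor N e) : LinearIndependent ℝ e := by
  rw [Fintype.linearIndependent_iff]
  intro g hg j
  have h := congrArg (fun y => N y (e j)) hg
  simpa [he _ j] using h

variable [FiniteDimensional ℝ V] in
theorem IsOrthonormalFor.sum_eq (hV : Module.finrank ℝ V = n) {N : V →L[ℝ] V →L[ℝ] ℝ}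
    {e : Fin n → V} (he : IsOrthonormalFor N e) (y : V) : ∑ i, N y (e i) • e i = y := by
  rcases isEmpty_or_nonempty (Fin n) with hn | hn
  · have : n = 0 := by
      by_contra h
      exact hn.false ⟨0, Nat.pos_of_ne_zero h⟩
    subst this
    have := Module.finrank_zero_iff.mp hV
    exact Subsingleton.elim _ _
  let b := basisOfLinearIndependentOfCardEqFinrank he.linearIndependent (by simp [hV])
  have hb : ∀ i, b i = e i := fun i => by simp [b]
  have hy : ∑ i, b.repr y i • e i = y := by
    conv_rhs => rw [← b.sum_repr y]
    simp [hb]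
  have hc : ∀ j, N y (e j) = b.repr y j := by
    intro j
    conv_lhs => rw [← hy]
    simp [he _ j]
  simpa [hc] using hy

theorem IsDiag.comp_perm {N H : V →L[ℝ] V →L[ℝ] ℝ} {l : Fin n → ℝ} (h : IsDiag N H l)
    (σ : Equiv.Perm (Fin n)) : IsDiag N H (l ∘ σ) := by
  obtain ⟨e, he, hl⟩ := h
  refine ⟨e ∘ σ, fun i j => ?_, fun i j => ?_⟩
  · simp [he _ _]
  · simp [hl]

/-- Simultaneous diagonalization of a symmetric form and a form with an orthonormal basis. -/
theorem IsOrthonormalFor.exists_isDiag {N H : V →L[ℝ] V →L[ℝ] ℝ} {e : Fin n → V}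
    (he : IsOrthonormalFor N e) (hH : ∀ x y, H x y = H y x) :
    ∃ l : Fin n → ℝ, Monotone l ∧ IsDiag N H l ∧ ∑ i, l i = ∑ i, H (e i) (e i) := by
  let A : Matrix (Fin n) (Fin n) ℝ := Matrix.of fun i j => H (e i) (e j)
  have hA : A.IsHermitian := by
    ext i j
    simp [A, hH (e i) (e j)]
  let b := hA.eigenvectorBasis
  let f : Fin n → V := fun i => ∑ j, b i j • e j
  have hf : IsOrthonormalFor N f := by
    intro i j
    have hb := orthonormal_iff_ite.mp b.orthonormal i j
    rw [← hb, PiLp.inner_apply]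
    simp only [f, map_sum, map_smul, sum_apply,
      smul_apply, smul_eq_mul, he _ _]
    simp
  have hd : ∀ i j, H (f i) (f j) = if i = j then hA.eigenvalues i else 0 := by
    intro i j
    have hb := orthonormal_iff_ite.mp b.orthonormal i j
    have hm := hA.mulVec_eigenvectorBasis j
    have hm' : ∀ k, ∑ m, H (e k) (e m) * b j m = hA.eigenvalues j * b j k := by
      intro k
      have := congrFun hm k
      simpa [Matrix.mulVec, dotProduct, A, b] using this
    have : H (f i) (f j) = ∑ k, b i k * (hA.eigenvalues j * b j k) := by
      simp only [f, map_sum, map_smul, sum_apply,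
        smul_apply, smul_eq_mul]
      simp_rw [Finset.mul_sum]
      rw [Finset.sum_comm]
      refine Finset.sum_congr rfl fun k _ => ?_
      rw [← hm' k, Finset.mul_sum]
      exact Finset.sum_congr rfl fun m _ => by ring
    rw [this]
    have h2 : ∑ k, b i k * (hA.eigenvalues j * b j k) = hA.eigenvalues j * inner ℝ (b i) (b j) := by
      rw [PiLp.inner_apply, Finset.mul_sum]
      exact Finset.sum_congr rfl fun m _ => by simp; ring
    rw [h2, hb]
    split_ifs with hij
    · simp [hij]
    · simp
  have hD : IsDiag N H hA.eigenvalues := ⟨f, hf, hd⟩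
  -- Sorting makes index-by-index comparison of different forms possible; it does not affect the
  -- trace.
  refine ⟨hA.eigenvalues ∘ Tuple.sort hA.eigenvalues, Tuple.monotone_sort _, hD.comp_perm _, ?_⟩
  have ht := hA.trace_eq_sum_eigenvalues
  have : ∑ i, (hA.eigenvalues ∘ Tuple.sort hA.eigenvalues) i = ∑ i, hA.eigenvalues i :=
    Equiv.sum_comp (Tuple.sort hA.eigenvalues) hA.eigenvalues
  rw [this]
  simpa [Matrix.trace, A] using ht.symm

variable [FiniteDimensional ℝ V]

theorem IsOrthonormalFor.apply_self (hV : Module.finrank ℝ V = n) {N : V →L[ℝ] V →L[ℝ] ℝ}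
    {e : Fin n → V} (he : IsOrthonormalFor N e) (y : V) : N y y = ∑ i, N y (e i) ^ 2 := by
  conv_lhs => enter [2]; rw [← he.sum_eq hV y]
  simp [sq]

theorem IsOrthonormalFor.diag_apply_self (hV : Module.finrank ℝ V = n)
    {N H : V →L[ℝ] V →L[ℝ] ℝ} {e : Fin n → V} (he : IsOrthonormalFor N e) {l : Fin n → ℝ}
    (hl : ∀ i j, H (e i) (e j) = if i = j then l i else 0) (y : V) :
    H y y = ∑ i, l i * N y (e i) ^ 2 := by
  have h : H y y = H (∑ i, N y (e i) • e i) (∑ i, N y (e i) • e i) := by rw [he.sum_eq hV y]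
  rw [h]
  simp only [map_sum, map_smul, sum_apply, smul_apply,
    smul_eq_mul, hl]
  refine Finset.sum_congr rfl fun i _ => ?_
  simp
  ring

/-- Comparison of sorted relative eigenvalues under an inequality of Rayleigh quotients. -/
theorem IsDiag.le_of_rayleigh_le (hV : Module.finrank ℝ V = n) {N N' H H' : V →L[ℝ] V →L[ℝ] ℝ}
    {l l' : Fin n → ℝ} (h : IsDiag N H l) (h' : IsDiag N' H' l') (hl : Monotone l)
    (hl' : Monotone l') {c : ℝ}
    (hle : ∀ y, H y y * N' y y ≤ (H' y y + c * N' y y) * N y y) (k : Fin n) :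
    l k ≤ l' k + c := by
  obtain ⟨e, he, hd⟩ := h
  obtain ⟨e', he', hd'⟩ := h'
  -- Courant-Fischer dimension count: a common nonzero vector of the span of the `e i` with `k ≤ i`
  -- and the span of the `e' i` with `i ≤ k`. It is cut out by `n - 1` conditions; the `k`-th
  -- component of `T` is zero, so `T` is not surjective.
  let T : V →ₗ[ℝ] (Fin n → ℝ) := LinearMap.pi fun i =>
    if i < k then (N.flip (e i) : V →ₗ[ℝ] ℝ) else
      if k < i then (N'.flip (e' i) : V →ₗ[ℝ] ℝ) else 0
  have hT : ¬ Function.Injective T := by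
    intro hinj
    have hs := (LinearMap.injective_iff_surjective_of_finrank_eq_finrank
      (by simp [hV])).mp hinj
    obtain ⟨y, hy⟩ := hs (Pi.single k 1)
    have := congrFun hy k
    simp [T] at this
  obtain ⟨y, hy, hy0⟩ : ∃ y, T y = 0 ∧ y ≠ 0 := by
    by_contra! hcon
    exact hT ((injective_iff_map_eq_zero T).mpr hcon)
  have h1 : ∀ i, i < k → N y (e i) = 0 := fun i hi => by
    have := congrFun hy i
    simpa [T, hi] using this
  have h2 : ∀ i, k < i → N' y (e' i) = 0 := fun i hi => by
    have := congrFun hy i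
    simpa [T, hi, not_lt_of_gt hi] using this
  have pos : ∀ {M : V →L[ℝ] V →L[ℝ] ℝ} {f : Fin n → V}, IsOrthonormalFor M f → 0 < M y y := by
    intro M f hf
    rw [hf.apply_self hV y]
    by_contra! hcon
    have hz : ∀ i, M y (f i) = 0 := by
      have h0 := le_antisymm hcon (Finset.sum_nonneg fun i _ => sq_nonneg (M y (f i)))
      rw [Finset.sum_eq_zero_iff_of_nonneg fun i _ => sq_nonneg _] at h0
      exact fun i => by simpa using h0 i (Finset.mem_univ i)
    apply hy0
    rw [← hf.sum_eq hV y]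
    simp [hz]
  have hA : l k * N y y ≤ H y y := by
    rw [he.apply_self hV, he.diag_apply_self hV hd, Finset.mul_sum]
    refine Finset.sum_le_sum fun i _ => ?_
    rcases lt_or_ge i k with hi | hi
    · simp [h1 i hi]
    · exact mul_le_mul_of_nonneg_right (hl hi) (sq_nonneg _)
  have hB : H' y y ≤ l' k * N' y y := by
    rw [he'.apply_self hV, he'.diag_apply_self hV hd', Finset.mul_sum]
    refine Finset.sum_le_sum fun i _ => ?_
    rcases le_or_gt i k with hi | hi
    · exact mul_le_mul_of_nonneg_right (hl' hi) (sq_nonneg _)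
    · simp [h2 i hi]
  have pN := pos he
  have pN' := pos he'
  have key : l k * (N y y * N' y y) ≤ (l' k + c) * (N y y * N' y y) := by
    have := hle y
    nlinarith [mul_le_mul_of_nonneg_right hA pN'.le, mul_le_mul_of_nonneg_right hB pN.le]
  exact le_of_mul_le_mul_right key (mul_pos pN pN')

end Diagonalization

/-! ### Monotonicity and gradient bounds for the speed. -/

section Speed

variable {n : ℕ} {Γ : Set (Fin n → ℝ)} {γ : (Fin n → ℝ) → ℝ} {α : ℝ}

theorem closure_positiveCone (n : ℕ) : closure (positiveCone n) = {l | ∀ i, 0 ≤ l i} := by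
  have h : positiveCone n = Set.pi Set.univ fun _ => Set.Ioi (0 : ℝ) := by
    ext l; simp [positiveCone]
  rw [h, closure_pi_set]
  ext l
  simp [Pi.le_def]

/-- The admissible lists of curvatures of a convex translator. -/
def convexCone (Γ : Set (Fin n → ℝ)) : Set (Fin n → ℝ) := Γ ∩ {l | ∀ i, 0 ≤ l i}

namespace IsSpeedFunction

theorem nonneg (hγ : IsSpeedFunction Γ γ α) {l : Fin n → ℝ} (hl : l ∈ closure Γ) : 0 ≤ γ l := by
  by_cases h : l ∈ Γ
  · exact (hγ.pos l h).le
  · exact (hγ.eq_zero_of_frontier l ⟨hl, fun h' => h (interior_subset h')⟩).ge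

theorem mem_of_pos (hγ : IsSpeedFunction Γ γ α) {l : Fin n → ℝ} (hl : l ∈ closure Γ)
    (hpos : 0 < γ l) : l ∈ Γ := by
  by_contra h
  exact hpos.ne' (hγ.eq_zero_of_frontier l ⟨hl, fun h' => h (interior_subset h')⟩)

theorem differentiableAt (hγ : IsSpeedFunction Γ γ α) {l : Fin n → ℝ} (hl : l ∈ Γ) :
    DifferentiableAt ℝ γ l :=
  ((hγ.smooth l hl).contDiffAt (hγ.isOpen.mem_nhds hl)).differentiableAt (by simp)

theorem mean_value (hγ : IsSpeedFunction Γ γ α) {x y : Fin n → ℝ} (h : segment ℝ x y ⊆ Γ) :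
    ∃ z ∈ segment ℝ x y, γ y - γ x = ∑ i, (y i - x i) * fderiv ℝ γ z (Pi.single i 1) := by
  obtain ⟨z, hz, he⟩ := domain_mvt (f := γ) (f' := fun z => fderiv ℝ γ z)
    (fun z hz => (hγ.differentiableAt (h hz)).hasFDerivAt.hasFDerivWithinAt)
    (convex_segment x y) (left_mem_segment ℝ x y) (right_mem_segment ℝ x y)
  refine ⟨z, hz, he.trans ?_⟩
  conv_lhs => rw [← Finset.univ_sum_single (y - x)]
  rw [map_sum]
  refine Finset.sum_congr rfl fun i _ => ?_
  have : (Pi.single i ((y - x) i) : Fin n → ℝ) = (y i - x i) • Pi.single i (1 : ℝ) := by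
    rw [← Pi.single_smul]; simp
  rw [this, map_smul, smul_eq_mul]

/-- A point strictly between a nonnegative and a positive list is positive, hence in `Γ`; only the
endpoints use membership in `Γ`. This replaces convexity of `Γ`. -/
theorem segment_subset (hγ : IsSpeedFunction Γ γ α) {b a : Fin n → ℝ} (hb : b ∈ convexCone Γ)
    (ha : a ∈ convexCone Γ) (h : b ∈ positiveCone n ∨ a ∈ positiveCone n) :
    segment ℝ b a ⊆ Γ := by
  rintro _ ⟨s, t, hs, ht, hst, rfl⟩
  rcases hs.eq_or_lt with rfl | hs'
  · have : t = 1 := by linarith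
    subst this
    simpa using ha.1
  rcases ht.eq_or_lt with rfl | ht'
  · have : s = 1 := by linarith
    subst this
    simpa using hb.1
  refine hγ.positiveCone_subset fun i => ?_
  have hbi := hb.2 i
  have hai := ha.2 i
  simp only [Pi.add_apply, Pi.smul_apply, smul_eq_mul]
  rcases h with h | h
  · have := h i; positivity
  · have := h i; positivity

theorem monotone_of_segment (hγ : IsSpeedFunction Γ γ α) {x y : Fin n → ℝ}
    (h : segment ℝ x y ⊆ Γ) (hxy : x ≤ y) : γ x ≤ γ y := by
  obtain ⟨z, hz, he⟩ := hγ.mean_value h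
  have : 0 ≤ ∑ i, (y i - x i) * fderiv ℝ γ z (Pi.single i 1) :=
    Finset.sum_nonneg fun i _ =>
      mul_nonneg (sub_nonneg.mpr (hxy i)) (hγ.increasing z (h hz) i).le
  linarith

/-- A compact segment in the open set `Γ` has a tube around it in `Γ`, and this tube contains the
segments between points near the two ends. -/
theorem exists_monotone_near (hγ : IsSpeedFunction Γ γ α) {b a : Fin n → ℝ}
    (h : segment ℝ b a ⊆ Γ) :
    ∃ δ > 0, ∀ x y : Fin n → ℝ, ‖x - b‖ < δ → ‖y - a‖ < δ → x ≤ y → γ x ≤ γ y := by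
  have hc : IsCompact (segment ℝ b a) := by
    rw [← Path.range_segment b a]
    exact isCompact_range (Path.segment b a).continuous
  obtain ⟨δ, hδ, hsub⟩ := hc.exists_thickening_subset_open hγ.isOpen h
  refine ⟨δ, hδ, fun x y hx hy hxy => hγ.monotone_of_segment ?_ hxy⟩
  rintro _ ⟨s, t, hs, ht, hst, rfl⟩
  apply hsub
  rw [Metric.mem_thickening_iff]
  refine ⟨s • b + t • a, ⟨s, t, hs, ht, hst, rfl⟩, ?_⟩
  rw [dist_eq_norm]
  have : s • x + t • y - (s • b + t • a) = s • (x - b) + t • (y - a) := by module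
  rw [this]
  have hm := max_lt hx hy
  calc ‖s • (x - b) + t • (y - a)‖ ≤ ‖s • (x - b)‖ + ‖t • (y - a)‖ := norm_add_le _ _
    _ = s * ‖x - b‖ + t * ‖y - a‖ := by
      rw [norm_smul, norm_smul, Real.norm_of_nonneg hs, Real.norm_of_nonneg ht]
    _ ≤ s * max ‖x - b‖ ‖y - a‖ + t * max ‖x - b‖ ‖y - a‖ := by
      gcongr
      · exact le_max_left _ _
      · exact le_max_right _ _
    _ = max ‖x - b‖ ‖y - a‖ := by rw [← add_mul, hst, one_mul]
    _ < δ := hm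

/-- Local ellipticity constants: the partial derivatives are positive and continuous at `b`, so they
stay between two positive constants on a convex neighbourhood. -/
theorem exists_gradient_bounds (hγ : IsSpeedFunction Γ γ α) {b : Fin n → ℝ} (hb : b ∈ Γ) :
    ∃ δ > 0, ∃ c > 0, ∃ C > 0, ∀ x y : Fin n → ℝ, ‖x - b‖ < δ → ‖y - b‖ < δ → x ≤ y →
      c * ∑ i, (y i - x i) ≤ γ y - γ x ∧ γ y - γ x ≤ C * ∑ i, (y i - x i) := by
  have hcont : ∀ i, ContinuousAt (fun z => fderiv ℝ γ z (Pi.single i 1)) b := fun i => by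
    have := ((hγ.smooth b hb).contDiffAt (hγ.isOpen.mem_nhds hb)).fderiv_right
      (m := 0) (by simp)
    exact this.continuousAt.clm_apply continuousAt_const
  obtain ⟨c, hc, hcl⟩ : ∃ c > 0, ∀ i, c < fderiv ℝ γ b (Pi.single i 1) := by
    rcases isEmpty_or_nonempty (Fin n) with h | h
    · exact ⟨1, one_pos, fun i => (IsEmpty.false i).elim⟩
    obtain ⟨j, hj⟩ := Finite.exists_min fun i => fderiv ℝ γ b (Pi.single i 1)
    have hp := hγ.increasing b hb j
    exact ⟨_, half_pos hp, fun i => (half_lt_self hp).trans_le (hj i)⟩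
  obtain ⟨C, hC, hCl⟩ : ∃ C > 0, ∀ i, fderiv ℝ γ b (Pi.single i 1) < C := by
    rcases isEmpty_or_nonempty (Fin n) with h | h
    · exact ⟨1, one_pos, fun i => (IsEmpty.false i).elim⟩
    obtain ⟨j, hj⟩ := Finite.exists_max fun i => fderiv ℝ γ b (Pi.single i 1)
    have hp := hγ.increasing b hb j
    exact ⟨_, add_pos hp one_pos, fun i => (hj i).trans_lt (lt_add_one _)⟩
  have hev : ∀ᶠ z in 𝓝 b, z ∈ Γ ∧ ∀ i, c < fderiv ℝ γ z (Pi.single i 1) ∧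
      fderiv ℝ γ z (Pi.single i 1) < C := by
    refine (hγ.isOpen.eventually_mem hb).and ?_
    rw [Filter.eventually_all]
    exact fun i => ((hcont i).eventually (lt_mem_nhds (hcl i))).and
      ((hcont i).eventually (gt_mem_nhds (hCl i)))
  obtain ⟨δ, hδ, hball⟩ := Metric.eventually_nhds_iff_ball.mp hev
  refine ⟨δ, hδ, c, hc, C, hC, fun x y hx hy hxy => ?_⟩
  have hseg : segment ℝ x y ⊆ Metric.ball b δ :=
    (convex_ball b δ).segment_subset (by simpa [dist_eq_norm] using hx)
      (by simpa [dist_eq_norm] using hy)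
  obtain ⟨z, hz, he⟩ := hγ.mean_value fun w hw => (hball w (hseg hw)).1
  rw [he, Finset.mul_sum, Finset.mul_sum]
  have hzb := (hball z (hseg hz)).2
  constructor
  · refine Finset.sum_le_sum fun i _ => ?_
    rw [mul_comm]
    exact mul_le_mul_of_nonneg_left (hzb i).1.le (sub_nonneg.mpr (hxy i))
  · refine Finset.sum_le_sum fun i _ => ?_
    rw [mul_comm C]
    exact mul_le_mul_of_nonneg_left (hzb i).2.le (sub_nonneg.mpr (hxy i))

end IsSpeedFunction

theorem convexCone_comp_perm (hγ : IsSpeedFunction Γ γ α) {l : Fin n → ℝ}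
    (hl : l ∈ convexCone Γ) (σ : Equiv.Perm (Fin n)) : l ∘ σ ∈ convexCone Γ :=
  ⟨hγ.perm_mem l hl.1 σ, fun i => hl.2 (σ i)⟩

end Speed

/-! ### The barrier produces a strict subsolution. -/

section Comparison

set_option maxSynthPendingDepth 3

variable {n : ℕ} {V : Type*} [NormedAddCommGroup V] [InnerProductSpace ℝ V]

/-- The inner product as a bounded real bilinear form. -/
noncomputable def realInner (V : Type*) [NormedAddCommGroup V] [InnerProductSpace ℝ V] :
    V →L[ℝ] V →L[ℝ] ℝ := innerSL ℝ

@[simp] theorem realInner_apply (x y : V) : realInner V x y = inner ℝ x y := rfl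

@[simp] theorem norm_realInner_apply (x : V) : ‖realInner V x‖ = ‖x‖ :=
  innerSL_apply_norm ℝ x

theorem norm_realInner_le : ‖realInner V‖ ≤ 1 :=
  ContinuousLinearMap.opNorm_le_bound _ zero_le_one fun x => by simp

/-- The Hessian, up to a positive factor, of the barrier function. -/
noncomputable def barrierForm (k : ℝ) (ξ : V) : V →L[ℝ] V →L[ℝ] ℝ :=
  (2 * k) • (realInner V ξ).smulRight (realInner V ξ) - realInner V

theorem barrierForm_apply (k : ℝ) (ξ x y : V) :
    barrierForm k ξ x y = 2 * k * (inner ℝ ξ x * inner ℝ ξ y) - inner ℝ x y := by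
  simp [barrierForm]

theorem norm_barrierForm_le {k : ℝ} (hk : 0 ≤ k) (ξ : V) :
    ‖barrierForm k ξ‖ ≤ 2 * k * ‖ξ‖ ^ 2 + 1 := by
  refine (norm_sub_le ((2 * k) • (realInner V ξ).smulRight (realInner V ξ)) (realInner V)).trans
    (add_le_add ?_ norm_realInner_le)
  rw [norm_smul, ContinuousLinearMap.norm_smulRight_apply, norm_realInner_apply,
    Real.norm_of_nonneg (by positivity), sq]

theorem abs_apply_self_le (H : V →L[ℝ] V →L[ℝ] ℝ) (y : V) : |H y y| ≤ ‖H‖ * ‖y‖ ^ 2 := by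
  have := H.le_opNorm₂ y y
  rw [Real.norm_eq_abs] at this
  nlinarith

variable [FiniteDimensional ℝ V]

/-- Quantitative continuity of the sorted relative eigenvalues. -/
theorem IsDiag.abs_sub_le (hV : Module.finrank ℝ V = n) {N N' H H' : V →L[ℝ] V →L[ℝ] ℝ}
    {l l' : Fin n → ℝ} (h : IsDiag N H l) (h' : IsDiag N' H' l') (hl : Monotone l)
    (hl' : Monotone l') (hN : ∀ y, ‖y‖ ^ 2 ≤ N y y) (hN' : ∀ y, ‖y‖ ^ 2 ≤ N' y y) (k : Fin n) :
    |l k - l' k| ≤ ‖H - H'‖ + ‖H'‖ * ‖N - N'‖ := by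
  have key : ∀ y, |H y y * N' y y - H' y y * N y y| ≤
      (‖H - H'‖ + ‖H'‖ * ‖N - N'‖) * (N y y * N' y y) := by
    intro y
    have e1 := abs_apply_self_le (H - H') y
    have e2 := abs_apply_self_le H' y
    have e3 := abs_apply_self_le (N - N') y
    simp only [sub_apply] at e1 e3
    have p := hN y
    have p' := hN' y
    have p0 : 0 ≤ ‖y‖ ^ 2 := by positivity
    have hs : H y y * N' y y - H' y y * N y y =
        (H y y - H' y y) * N' y y - H' y y * (N y y - N' y y) := by ring
    rw [hs]
    calc |(H y y - H' y y) * N' y y - H' y y * (N y y - N' y y)|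
        ≤ |H y y - H' y y| * N' y y + |H' y y| * |N y y - N' y y| := by
          refine (abs_sub _ _).trans ?_
          rw [abs_mul, abs_mul, abs_of_nonneg (p0.trans p')]
      _ ≤ (‖H - H'‖ * ‖y‖ ^ 2) * N' y y + (‖H'‖ * ‖y‖ ^ 2) * (‖N - N'‖ * ‖y‖ ^ 2) := by
          gcongr
          exact p0.trans p'
      _ ≤ (‖H - H'‖ * N y y) * N' y y + (‖H'‖ * N y y) * (‖N - N'‖ * N' y y) := by
          have := p0.trans p'
          have := p0.trans p
          gcongr
      _ = _ := by ring
  rw [abs_le]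
  constructor
  · have := h'.le_of_rayleigh_le hV h hl' hl (c := ‖H - H'‖ + ‖H'‖ * ‖N - N'‖)
      (fun y => by have := (abs_le.mp (key y)).1; nlinarith) k
    linarith
  · have := h.le_of_rayleigh_le hV h' hl hl' (c := ‖H - H'‖ + ‖H'‖ * ‖N - N'‖)
      (fun y => by have := (abs_le.mp (key y)).2; nlinarith) k
    linarith

/-- Expand `‖ξ‖ ^ 2` as the sum of `N ξ (e i) * ⟨ξ, e i⟩` and apply Cauchy-Schwarz; the squares `N ξ
(e i) ^ 2` add up to `N ξ ξ ≤ C * ‖ξ‖ ^ 2`. The result bounds from below the trace, relative to `N`,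
of the rank-one part of the barrier's Hessian. -/
theorem IsOrthonormalFor.norm_sq_le_sum_inner (hV : Module.finrank ℝ V = n)
    {N : V →L[ℝ] V →L[ℝ] ℝ} {e : Fin n → V} (he : IsOrthonormalFor N e) {C : ℝ}
    (hC : ‖N‖ ≤ C) (ξ : V) : ‖ξ‖ ^ 2 ≤ C * ∑ i, inner ℝ ξ (e i) ^ 2 := by
  rcases eq_or_ne ξ 0 with rfl | hξ
  · simp
  have h1 : ‖ξ‖ ^ 2 = ∑ i, N ξ (e i) * inner ℝ ξ (e i) := by
    rw [← real_inner_self_eq_norm_sq]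
    conv_lhs => enter [3]; rw [← he.sum_eq hV ξ]
    rw [inner_sum]
    exact Finset.sum_congr rfl fun i _ => inner_smul_right _ _ _
  have h2 := Finset.sum_mul_sq_le_sq_mul_sq Finset.univ (fun i => N ξ (e i))
    (fun i => inner ℝ ξ (e i))
  rw [← h1, ← he.apply_self hV] at h2
  have h3 : N ξ ξ ≤ C * ‖ξ‖ ^ 2 := ((le_abs_self _).trans (abs_apply_self_le N ξ)).trans
    (mul_le_mul_of_nonneg_right hC (by positivity))
  have hp : 0 < ‖ξ‖ ^ 2 := by positivity
  have hs : 0 ≤ ∑ i, inner ℝ ξ (e i) ^ 2 := Finset.sum_nonneg fun i _ => sq_nonneg _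
  have h4 : ‖ξ‖ ^ 2 * ‖ξ‖ ^ 2 ≤ (C * ∑ i, inner ℝ ξ (e i) ^ 2) * ‖ξ‖ ^ 2 := by nlinarith
  exact le_of_mul_le_mul_right h4 hp

/-- A perturbation of a solution by a sufficiently concentrated barrier is a strict
subsolution, so that it cannot touch another solution from below. -/
theorem exists_strict_subsolution {Γ : Set (Fin n → ℝ)} {γ : (Fin n → ℝ) → ℝ} {α : ℝ}
    (hγ : IsSpeedFunction Γ γ α) (hV : Module.finrank ℝ V = n)
    {N : (V →L[ℝ] ℝ) → V →L[ℝ] V →L[ℝ] ℝ} {φ : (V →L[ℝ] ℝ) → ℝ} {q₀ : V →L[ℝ] ℝ}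
    (hNc : ContDiffAt ℝ 1 N q₀) (hφ : ContDiffAt ℝ 1 φ q₀) (hN : ∀ q y, ‖y‖ ^ 2 ≤ N q y y)
    {H₀ H₀' : V →L[ℝ] V →L[ℝ] ℝ} {b₀ a₀ : Fin n → ℝ} (hb₀ : IsDiag (N q₀) H₀ b₀)
    (ha₀ : IsDiag (N q₀) H₀' a₀) (hbm : Monotone b₀) (ham : Monotone a₀)
    (hseg : segment ℝ b₀ a₀ ⊆ Γ) {r : ℝ} (hr : 0 < r) (R : ℝ) :
    ∃ k > 0, ∃ δ > 0, ∀ (q q' : V →L[ℝ] ℝ) (H H' : V →L[ℝ] V →L[ℝ] ℝ) (ξ : V) (κ : ℝ),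
      ‖q - q₀‖ < δ → ‖H - H₀‖ < δ → ‖q' - q₀‖ < δ → ‖H' - H₀'‖ < δ → 0 < κ → κ < δ →
      r ≤ ‖ξ‖ → ‖ξ‖ ≤ R → ‖q' - q‖ ≤ κ * ‖ξ‖ → (∀ x y, H x y = H y x) →
      (∀ y, H y y + κ * barrierForm k ξ y y ≤ H' y y) →
      ∀ b a : Fin n → ℝ, Monotone b → Monotone a → IsDiag (N q) H b → IsDiag (N q') H' a →
      γ b = φ q → γ a = φ q' → False := by
  obtain ⟨L₁, s₁, hs₁, hL₁⟩ := hNc.exists_lipschitzOnWith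
  obtain ⟨L₂, s₂, hs₂, hL₂⟩ := hφ.exists_lipschitzOnWith
  obtain ⟨δ₁, hδ₁, hball⟩ := Metric.mem_nhds_iff.mp (Filter.inter_mem hs₁ hs₂)
  obtain ⟨δ₂, hδ₂, c, hc, C, hC, hgrad⟩ := hγ.exists_gradient_bounds
    (hseg (left_mem_segment ℝ b₀ a₀))
  obtain ⟨δ₃, hδ₃, hmono⟩ := hγ.exists_monotone_near hseg
  -- `M` bounds the metrics near `q₀`, and `κ * B` bounds the error in the eigenvalues caused by
  -- replacing `N q` with `N q'`. Neither depends on `k`, so `k` can be chosen afterwards to let the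
  -- barrier outweigh every error.
  set M := ‖N q₀‖ + L₁ * δ₁ + 1 with hM
  have hMpos : 0 < M := by positivity
  set B := (‖H₀‖ + 1) * (L₁ * R) with hB
  obtain ⟨k, hk, hkbig⟩ : ∃ k > 0, C * (n * (B + 1)) + L₂ * R < c * (2 * k * (r ^ 2 / M)) := by
    obtain ⟨k, hk⟩ := exists_nat_gt
      (max 0 ((C * (n * (B + 1)) + L₂ * R) / (c * (2 * (r ^ 2 / M)))))
    have hd : 0 < c * (2 * (r ^ 2 / M)) := by positivity
    refine ⟨k, (le_max_left _ _).trans_lt hk, ?_⟩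
    have := (le_max_right _ _).trans_lt hk
    rw [div_lt_iff₀ hd] at this
    linarith
  -- `δ * D` dominates the displacements of all lists below from `b₀` or `a₀`, including the shift
  -- by `κ * (B + 1)`.
  set D := 1 + (2 * k * R ^ 2 + 1) + (‖H₀‖ + ‖H₀'‖) * L₁ + |B| + 1 with hD
  have hDpos : 0 < D := by positivity
  set δ := min (min δ₁ 1) (min δ₂ δ₃ / D) with hδ
  have hδpos : 0 < δ := by positivity
  have hδD : δ * D ≤ min δ₂ δ₃ := by
    have : δ ≤ min δ₂ δ₃ / D := min_le_right _ _
    rwa [le_div_iff₀ hDpos] at this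
  refine ⟨k, hk, δ, hδpos, ?_⟩
  intro q q' H H' ξ κ hq hH hq' hH' hκ hκδ hrξ hξR hqq hsymm hle b a hb ha hdb hda hγb hγa
  have hmem : ∀ p, ‖p - q₀‖ < δ → p ∈ s₁ ∩ s₂ := fun p hp =>
    hball (by
      rw [Metric.mem_ball, dist_eq_norm]
      exact hp.trans_le ((min_le_left _ _).trans (min_le_left _ _)))
  have hq₀ : q₀ ∈ s₁ ∩ s₂ := hmem q₀ (by simpa using hδpos)
  have hLN : ∀ p p', p ∈ s₁ → p' ∈ s₁ → ‖N p - N p'‖ ≤ L₁ * ‖p - p'‖ := fun p p' hp hp' => by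
    simpa [dist_eq_norm] using hL₁.dist_le_mul p hp p' hp'
  have hκR : κ * ‖ξ‖ ≤ κ * R := by gcongr
  have hN1 : ‖N q - N q'‖ ≤ L₁ * (κ * R) :=
    (hLN q q' (hmem q hq).1 (hmem q' hq').1).trans (by
      rw [norm_sub_rev]; gcongr; exact hqq.trans hκR)
  have hφ1 : φ q' - φ q ≤ L₂ * (κ * R) := by
    have := hL₂.dist_le_mul q' (hmem q' hq').2 q (hmem q hq).2
    rw [Real.dist_eq, dist_eq_norm] at this
    refine (le_abs_self _).trans (this.trans ?_)
    gcongr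
    exact hqq.trans hκR
  have hH1 : ‖H‖ ≤ ‖H₀‖ + 1 := by
    have : ‖H‖ ≤ ‖H - H₀‖ + ‖H₀‖ := norm_le_norm_sub_add H H₀
    have : δ ≤ 1 := (min_le_left _ _).trans (min_le_right _ _)
    linarith
  have hNM : ‖N q'‖ ≤ M := by
    have h1 : ‖N q'‖ ≤ ‖N q' - N q₀‖ + ‖N q₀‖ := norm_le_norm_sub_add (N q') (N q₀)
    have h2 := hLN q' q₀ (hmem q' hq').1 hq₀.1
    have h3 : (L₁ : ℝ) * ‖q' - q₀‖ ≤ L₁ * δ₁ := by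
      gcongr
      exact hq'.le.trans ((min_le_left _ _).trans (min_le_left _ _))
    linarith
  -- The passage from `b` to `a` has two intermediate lists, both relative to `N q'`: `β` for `H`
  -- and `μ` for `H` plus the barrier. The change of metric costs `κ * B` per eigenvalue, the
  -- barrier lowers none by more than `κ` and raises their sum by a multiple of `k`, and the Hessian
  -- inequality gives `μ ≤ a`.
  obtain ⟨e, he, -⟩ := id hda
  obtain ⟨β, hβm, hβ, hβs⟩ := he.exists_isDiag hsymm
  set S := H + κ • barrierForm k ξ with hS
  have hSsymm : ∀ x y, S x y = S y x := fun x y => by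
    simp only [hS, add_apply, smul_apply, barrierForm_apply, hsymm x y, real_inner_comm x y,
      mul_comm (inner ℝ ξ x)]
  obtain ⟨μ, hμm, hμ, hμs⟩ := he.exists_isDiag hSsymm
  have hRpos : 0 < R := hr.trans_le (hrξ.trans hξR)
  have hB0 : 0 ≤ B := by positivity
  have hbβ : ∀ i, |b i - β i| ≤ κ * B := fun i => by
    refine (hdb.abs_sub_le hV hβ hb hβm (hN q) (hN q') i).trans ?_
    rw [sub_self H, norm_zero, zero_add]
    calc ‖H‖ * ‖N q - N q'‖ ≤ (‖H₀‖ + 1) * (L₁ * (κ * R)) := by gcongr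
      _ = κ * B := by rw [hB]; ring
  have hSy : ∀ y, S y y = H y y + κ * (2 * k * inner ℝ ξ y ^ 2 - ‖y‖ ^ 2) := fun y => by
    simp [hS, barrierForm_apply, sq]
  have hβμ : ∀ i, β i ≤ μ i + κ := fun i => by
    refine hβ.le_of_rayleigh_le hV hμ hβm hμm (fun y => ?_) i
    have hNy := hN q' y
    refine mul_le_mul_of_nonneg_right ?_ ((by positivity : (0 : ℝ) ≤ ‖y‖ ^ 2).trans hNy)
    rw [hSy]
    have : 0 ≤ κ * (2 * k * inner ℝ ξ y ^ 2) := by positivity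
    have := mul_le_mul_of_nonneg_left hNy hκ.le
    linarith
  have hμa : μ ≤ a := fun i => by
    have := hμ.le_of_rayleigh_le hV hda hμm ha (c := 0) (fun y => by
      rw [zero_mul, add_zero]
      refine mul_le_mul_of_nonneg_right ?_ ((by positivity : (0 : ℝ) ≤ ‖y‖ ^ 2).trans (hN q' y))
      simpa [hS] using hle y) i
    simpa using this
  have hsum : ∑ i, β i + κ * (2 * k * (r ^ 2 / M) - n) ≤ ∑ i, μ i := by
    rw [hβs, hμs]
    have h1 : ∑ i, S (e i) (e i) = ∑ i, H (e i) (e i) +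
        κ * (2 * k * ∑ i, inner ℝ ξ (e i) ^ 2 - ∑ i, ‖e i‖ ^ 2) := by
      simp_rw [hSy, Finset.sum_add_distrib, ← Finset.mul_sum, Finset.sum_sub_distrib,
        ← Finset.mul_sum]
    have h2 : ∑ i, ‖e i‖ ^ 2 ≤ n := by
      have : ∀ i ∈ Finset.univ, ‖e i‖ ^ 2 ≤ 1 := fun i _ => by
        simpa [he i i] using hN q' (e i)
      simpa using Finset.sum_le_sum this
    have h3 : r ^ 2 / M ≤ ∑ i, inner ℝ ξ (e i) ^ 2 := by
      rw [div_le_iff₀ hMpos, mul_comm]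
      exact (pow_le_pow_left₀ hr.le hrξ 2).trans (he.norm_sq_le_sum_inner hV hNM ξ)
    rw [h1]
    gcongr
  have bound : ∀ {p : V →L[ℝ] ℝ} {G G₀ : V →L[ℝ] V →L[ℝ] ℝ} {l l₀ : Fin n → ℝ},
      ‖p - q₀‖ < δ → IsDiag (N p) G l → IsDiag (N q₀) G₀ l₀ →
      Monotone l → Monotone l₀ → ∀ i, |l i - l₀ i| ≤ ‖G - G₀‖ + ‖G₀‖ * (L₁ * δ) := by
    intro p G G₀ l l₀ hp h h₀ hl hl₀ i
    refine (h.abs_sub_le hV h₀ hl hl₀ (hN p) (hN q₀) i).trans ?_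
    gcongr
    exact (hLN p q₀ (hmem p hp).1 hq₀.1).trans (by gcongr)
  have hSH : ‖S - H₀‖ < δ + δ * (2 * k * R ^ 2 + 1) := by
    have h1 : S - H₀ = (H - H₀) + κ • barrierForm k ξ := by rw [hS]; abel
    rw [h1]
    refine (norm_add_le _ _).trans_lt (add_lt_add_of_lt_of_le hH ?_)
    rw [norm_smul, Real.norm_of_nonneg hκ.le]
    gcongr
    exact (norm_barrierForm_le hk.le ξ).trans (by gcongr)
  have hnear : ∀ {l l₀ : Fin n → ℝ} {ρ : ℝ}, 0 < ρ → (∀ i, |l i - l₀ i| < ρ) → ‖l - l₀‖ < ρ := by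
    intro l l₀ ρ hρ h
    rw [pi_norm_lt_iff hρ]
    exact fun i => by simpa using h i
  have hρ : 0 < min δ₂ δ₃ := by positivity
  have hL0 : (0 : ℝ) ≤ L₁ := L₁.2
  have hfac : δ + δ * (2 * k * R ^ 2 + 1) + ‖H₀‖ * (L₁ * δ) + ‖H₀'‖ * (L₁ * δ) + δ * (B + 1)
      = δ * D := by
    rw [hD, abs_of_nonneg hB0]; ring
  have t1 : 0 ≤ δ * (2 * k * R ^ 2 + 1) := by positivity
  have t2 : 0 ≤ ‖H₀‖ * (L₁ * δ) := by positivity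
  have t3 : 0 ≤ ‖H₀'‖ * (L₁ * δ) := by positivity
  have t4 : 0 ≤ δ * (B + 1) := by positivity
  have t5 : κ * (B + 1) < δ * (B + 1) := by gcongr
  have nμ : ‖μ - b₀‖ < min δ₂ δ₃ := hnear hρ fun i => by
    have := bound hq' hμ hb₀ hμm hbm i
    linarith
  have na : ‖a - a₀‖ < min δ₂ δ₃ := hnear hρ fun i => by
    have := bound hq' hda ha₀ ha ham i
    linarith
  have nb : ∀ i, |b i - b₀ i| < min δ₂ δ₃ - δ * (B + 1) := fun i => by
    have := bound hq hdb hb₀ hb hbm i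
    linarith
  -- A common lower bound for `b` and `μ`, which need not be comparable with each other. The shift
  -- absorbs the metric error `κ * B` and the loss `κ` due to the barrier.
  set b' : Fin n → ℝ := fun i => b i - κ * (B + 1) with hb'
  have nb1 : ‖b - b₀‖ < δ₂ := hnear hδ₂ fun i => by
    have := nb i; have := min_le_left δ₂ δ₃; linarith
  have nb' : ‖b' - b₀‖ < δ₂ := hnear hδ₂ fun i => by
    have h1 := abs_lt.mp (nb i)
    have := min_le_left δ₂ δ₃
    have : 0 < κ * (B + 1) := by positivity
    rw [hb', abs_lt]
    constructor <;> linarith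
  have hbb' : b' ≤ b := fun i => by
    have : 0 < κ * (B + 1) := by positivity
    simp only [hb']; linarith
  have hb'μ : b' ≤ μ := fun i => by
    have h1 := abs_le.mp (hbβ i)
    have h2 := hβμ i
    simp only [hb']; linarith
  -- The two-sided gradient bounds are available only near `b₀`, where `b'`, `b` and `μ` lie. The
  -- list `a` is near `a₀`, possibly far away, so from `μ` to `a` only monotonicity is used.
  have g1 := (hgrad b' b nb' nb1 hbb').2
  have g2 := (hgrad b' μ nb' (nμ.trans_le (min_le_left _ _)) hb'μ).1
  have g3 := hmono μ a (nμ.trans_le (min_le_right _ _)) (na.trans_le (min_le_right _ _)) hμa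
  have s1 : ∑ i, (b i - b' i) = n * (κ * (B + 1)) := by
    simp [hb']
  have s2 : κ * (2 * k * (r ^ 2 / M)) ≤ ∑ i, (μ i - b' i) := by
    have h1 : ∑ i, (b i - β i) ≤ n * (κ * B) := by
      have : ∀ i ∈ Finset.univ, b i - β i ≤ κ * B := fun i _ => (abs_le.mp (hbβ i)).2
      simpa using Finset.sum_le_sum this
    have h2 : ∑ i, (μ i - b' i) = ∑ i, μ i - ∑ i, b i + n * (κ * (B + 1)) := by
      simp [hb', Finset.sum_sub_distrib]
      ring
    rw [Finset.sum_sub_distrib] at h1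
    rw [h2]
    linarith
  rw [s1] at g1
  have g4 := mul_le_mul_of_nonneg_left s2 hc.le
  have g5 := mul_lt_mul_of_pos_left hkbig hκ
  have : κ * (C * (n * (B + 1)) + L₂ * R) = C * (n * (κ * (B + 1))) + L₂ * (κ * R) := by ring
  have : κ * (c * (2 * k * (r ^ 2 / M))) = c * (κ * (2 * k * (r ^ 2 / M))) := by ring
  linarith

end Comparison

/-! ### The Gaussian barrier and Hopf's lemma. -/

section HopfLemma

set_option maxSynthPendingDepth 3

/-- Restrict to a line. A negative second derivative would make the minimum a local maximum as well,
so the restriction would be locally constant and its second derivative zero. -/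
theorem IsLocalMin.fderiv_fderiv_nonneg {E : Type*} [NormedAddCommGroup E] [NormedSpace ℝ E]
    {w : E → ℝ} {z : E} (h : IsLocalMin w z) (hw : ContDiffAt ℝ 2 w z) (y : E) :
    0 ≤ fderiv ℝ (fderiv ℝ w) z y y := by
  by_contra! hneg
  let c : ℝ → E := fun t => z + t • y
  have hc : ∀ t, HasDerivAt c y t := fun t => by
    simpa [c] using ((hasDerivAt_id t).smul_const y).const_add z
  have hc0 : c 0 = z := by simp [c]
  have hct : Filter.Tendsto c (𝓝 0) (𝓝 z) := by
    simpa [hc0] using (hc 0).continuousAt.tendsto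
  have hd : ∀ᶠ t in 𝓝 (0 : ℝ), deriv (w ∘ c) t = fderiv ℝ w (c t) y := by
    filter_upwards [hct.eventually (hw.eventually (by simp))] with t ht
    exact ((ht.differentiableAt (by simp)).hasFDerivAt.comp_hasDerivAt t (hc t)).deriv
  have hdd : deriv (deriv (w ∘ c)) 0 = fderiv ℝ (fderiv ℝ w) z y y := by
    rw [Filter.EventuallyEq.deriv_eq hd]
    have h1 : HasFDerivAt (fderiv ℝ w) (fderiv ℝ (fderiv ℝ w) z) (c 0) := by
      rw [hc0]
      exact ((hw.fderiv_right (m := 1) (by norm_num)).differentiableAt (by simp)).hasFDerivAt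
    have h2 := h1.comp_hasDerivAt (0 : ℝ) (hc 0)
    have h3 := h2.clm_apply (hasDerivAt_const (0 : ℝ) y)
    simpa using h3.deriv
  have hmin : IsLocalMin (w ∘ c) 0 := by
    have h' : ∀ᶠ x in 𝓝 z, w z ≤ w x := h
    filter_upwards [hct.eventually h'] with t ht
    simpa [hc0] using ht
  have hcont : ContinuousAt (w ∘ c) 0 := by
    refine ContinuousAt.comp ?_ (hc 0).continuousAt
    rw [hc0]
    exact hw.continuousAt
  have hmax := isLocalMax_of_deriv_deriv_neg (f := w ∘ c) (x₀ := 0) (by rw [hdd]; exact hneg)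
    hmin.deriv_eq_zero hcont
  have hconst : (w ∘ c) =ᶠ[𝓝 0] fun _ => (w ∘ c) 0 := by
    filter_upwards [hmin, hmax] with t h1 h2
    exact le_antisymm h2 h1
  have hz : deriv (deriv (w ∘ c)) 0 = 0 := by
    rw [Filter.EventuallyEq.deriv_eq hconst.deriv]
    simp
  rw [hdd] at hz
  exact hneg.ne hz

variable {n : ℕ} {V : Type*} [NormedAddCommGroup V] [InnerProductSpace ℝ V]

/-- `u` satisfies the curvature equation at `y`, with admissible curvatures `l`. -/
structure SolvesAt (Γ : Set (Fin n → ℝ)) (γ : (Fin n → ℝ) → ℝ)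
    (N : (V →L[ℝ] ℝ) → V →L[ℝ] V →L[ℝ] ℝ) (φ : (V →L[ℝ] ℝ) → ℝ) (u : V → ℝ) (y : V)
    (l : Fin n → ℝ) : Prop where
  mem : l ∈ convexCone Γ
  isDiag : IsDiag (N (fderiv ℝ u y)) (fderiv ℝ (fderiv ℝ u) y) l
  equation : γ l = φ (fderiv ℝ u y)

/-- `u` and `U` satisfy the curvature equation at `y`, one of them with positive curvatures. -/
def SolvePairAt (Γ : Set (Fin n → ℝ)) (γ : (Fin n → ℝ) → ℝ)
    (N : (V →L[ℝ] ℝ) → V →L[ℝ] V →L[ℝ] ℝ) (φ : (V →L[ℝ] ℝ) → ℝ) (u U : V → ℝ) (y : V) : Prop :=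
  ∃ b a : Fin n → ℝ, SolvesAt Γ γ N φ u y b ∧ SolvesAt Γ γ N φ U y a ∧
    (b ∈ positiveCone n ∨ a ∈ positiveCone n)

/-- The cone, the speed and the diagonalization are all invariant under permutations, so the lists
may be sorted, as the eigenvalue comparison requires. -/
theorem SolvePairAt.exists_monotone {Γ : Set (Fin n → ℝ)} {γ : (Fin n → ℝ) → ℝ} {α : ℝ}
    (hγ : IsSpeedFunction Γ γ α) {N : (V →L[ℝ] ℝ) → V →L[ℝ] V →L[ℝ] ℝ} {φ : (V →L[ℝ] ℝ) → ℝ}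
    {u U : V → ℝ} {y : V} (h : SolvePairAt Γ γ N φ u U y) :
    ∃ b a : Fin n → ℝ, Monotone b ∧ Monotone a ∧ SolvesAt Γ γ N φ u y b ∧
      SolvesAt Γ γ N φ U y a ∧ (b ∈ positiveCone n ∨ a ∈ positiveCone n) := by
  obtain ⟨b, a, hb, ha, hpos⟩ := h
  have aux : ∀ {u : V → ℝ} {l : Fin n → ℝ}, SolvesAt Γ γ N φ u y l → ∀ σ : Equiv.Perm (Fin n),
      SolvesAt Γ γ N φ u y (l ∘ σ) := fun h σ =>
    ⟨convexCone_comp_perm hγ h.mem σ, h.isDiag.comp_perm σ,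
      (hγ.symmetric _ h.mem.1 σ).trans h.equation⟩
  exact ⟨b ∘ Tuple.sort b, a ∘ Tuple.sort a, Tuple.monotone_sort b, Tuple.monotone_sort a,
    aux hb _, aux ha _, hpos.imp (fun h i => h _) fun h i => h _⟩

/-- The Gaussian barrier centred at `y₀`. -/
noncomputable def barrier (k : ℝ) (y₀ z : V) : ℝ := Real.exp (-(k * ‖z - y₀‖ ^ 2))

theorem hasFDerivAt_barrier (k : ℝ) (y₀ z : V) :
    HasFDerivAt (barrier k y₀) (-(2 * k * barrier k y₀ z) • realInner V (z - y₀)) z := by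
  have h1 : HasFDerivAt (fun z : V => ‖z - y₀‖ ^ 2) (2 • realInner V (z - y₀)) z := by
    have := (hasStrictFDerivAt_norm_sq (z - y₀)).hasFDerivAt.comp z
      ((hasFDerivAt_id z).sub_const y₀)
    exact this
  have h2 := ((h1.const_mul k).neg).exp
  refine h2.congr_fderiv (ContinuousLinearMap.ext fun y => ?_)
  simp only [barrier, smul_apply, neg_apply, smul_eq_mul, nsmul_eq_mul, Pi.neg_apply, smul_neg,
    neg_mul, Nat.cast_ofNat]
  ring

theorem fderiv_barrier (k : ℝ) (y₀ : V) :
    fderiv ℝ (barrier k y₀) = fun z => -(2 * k * barrier k y₀ z) • realInner V (z - y₀) :=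
  funext fun z => (hasFDerivAt_barrier k y₀ z).fderiv

theorem contDiff_barrier (k : ℝ) (y₀ : V) : ContDiff ℝ 2 (barrier k y₀) := by
  have h : ContDiff ℝ 2 fun z : V => ‖z - y₀‖ ^ 2 := (contDiff_id.sub contDiff_const).norm_sq ℝ
  exact Real.contDiff_exp.comp (contDiff_const.mul h).neg

theorem fderiv_fderiv_barrier (k : ℝ) (y₀ z : V) :
    fderiv ℝ (fderiv ℝ (barrier k y₀)) z =
      (2 * k * barrier k y₀ z) • barrierForm k (z - y₀) := by
  rw [fderiv_barrier]
  have h1 : HasFDerivAt (fun z => -(2 * k * barrier k y₀ z))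
      (-((2 * k) • (-(2 * k * barrier k y₀ z) • realInner V (z - y₀)))) z :=
    ((hasFDerivAt_barrier k y₀ z).const_mul (2 * k)).neg
  have h2 : HasFDerivAt (fun z => realInner V (z - y₀)) (realInner V) z := by
    exact (realInner V).hasFDerivAt.comp z ((hasFDerivAt_id z).sub_const y₀)
  refine (h1.smul h2).fderiv.trans ?_
  refine ContinuousLinearMap.ext fun x => ContinuousLinearMap.ext fun y => ?_
  simp only [add_apply, smul_apply, neg_apply, ContinuousLinearMap.smulRight_apply,
    realInner_apply, smul_eq_mul, barrierForm_apply]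
  ring

variable [FiniteDimensional ℝ V]

/-- Hopf boundary point lemma at a point of first order contact. -/
theorem hopf_contact {Γ : Set (Fin n → ℝ)} {γ : (Fin n → ℝ) → ℝ} {α : ℝ}
    (hγ : IsSpeedFunction Γ γ α) (hV : Module.finrank ℝ V = n)
    {N : (V →L[ℝ] ℝ) → V →L[ℝ] V →L[ℝ] ℝ} {φ : (V →L[ℝ] ℝ) → ℝ} {u U : V → ℝ} {x₀ y₀ : V}
    (hNc : ContDiffAt ℝ 1 N (fderiv ℝ u x₀)) (hφ : ContDiffAt ℝ 1 φ (fderiv ℝ u x₀))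
    (hN : ∀ q y, ‖y‖ ^ 2 ≤ N q y y) (hu : ContDiffAt ℝ 2 u x₀) (hU : ContDiffAt ℝ 2 U x₀)
    (heq : u x₀ = U x₀) (hD : fderiv ℝ u x₀ = fderiv ℝ U x₀)
    (hpair : SolvePairAt Γ γ N φ u U x₀) (hne : x₀ ≠ y₀)
    (hin : ∀ᶠ z in 𝓝 x₀, z ∈ Metric.ball y₀ ‖x₀ - y₀‖ → SolvePairAt Γ γ N φ u U z)
    (hlt : ∀ᶠ z in 𝓝 x₀, z ∈ Metric.closedBall y₀ ‖x₀ - y₀‖ → z ≠ x₀ → u z < U z) : False := by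
  set R := ‖x₀ - y₀‖ with hR
  have hRpos : 0 < R := norm_pos_iff.mpr (sub_ne_zero.mpr hne)
  obtain ⟨b₀, a₀, hb₀m, ha₀m, hb₀, ha₀, hpos⟩ := hpair.exists_monotone hγ
  -- The centre `y₀` must be kept away, since the gradient of the barrier vanishes there: close to
  -- `x₀`, points of the ball have distance between `R / 2` and `R` from `y₀`.
  obtain ⟨k, hk, δ, hδ, hstrict⟩ := exists_strict_subsolution hγ hV hNc hφ hN hb₀.isDiag
    (by rw [hD]; exact ha₀.isDiag) hb₀m ha₀m (hγ.segment_subset hb₀.mem ha₀.mem hpos)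
    (half_pos hRpos) R
  have c1 : ∀ {v : V → ℝ}, ContDiffAt ℝ 2 v x₀ → ∀ᶠ z in 𝓝 x₀, ContDiffAt ℝ 2 v z ∧
      ‖fderiv ℝ v z - fderiv ℝ v x₀‖ < δ ∧
      ‖fderiv ℝ (fderiv ℝ v) z - fderiv ℝ (fderiv ℝ v) x₀‖ < δ := by
    intro v hv
    have h1 := hv.fderiv_right (m := 1) (by norm_num)
    have h2 := h1.fderiv_right (m := 0) (by norm_num)
    refine (hv.eventually (by simp)).and (Filter.Eventually.and ?_ ?_)
    · have := Metric.tendsto_nhds.mp h1.continuousAt.tendsto δ hδ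
      simpa [dist_eq_norm] using this
    · have := Metric.tendsto_nhds.mp h2.continuousAt.tendsto δ hδ
      simpa [dist_eq_norm] using this
  have c2 : ∀ᶠ z in 𝓝 x₀, R / 2 < ‖z - y₀‖ := by
    have : ContinuousAt (fun z => ‖z - y₀‖) x₀ := by fun_prop
    exact this.eventually (lt_mem_nhds (half_lt_self hRpos))
  obtain ⟨ρ, hρ, hball⟩ := Metric.nhds_basis_closedBall.eventually_iff.mp
    ((c1 hu).and ((c1 hU).and (c2.and (hin.and hlt))))
  have hle : ∀ z ∈ Metric.closedBall x₀ ρ, z ∈ Metric.closedBall y₀ R → u z ≤ U z := by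
    intro z hz hzR
    rcases eq_or_ne z x₀ with rfl | hzx
    · exact heq.le
    · exact ((hball hz).2.2.2.2 hzR hzx).le
  obtain ⟨m, hm, hmle⟩ : ∃ m > 0, ∀ z ∈ Metric.sphere x₀ ρ ∩ Metric.closedBall y₀ R,
      m ≤ U z - u z := by
    rcases (Metric.sphere x₀ ρ ∩ Metric.closedBall y₀ R).eq_empty_or_nonempty with he | hne'
    · exact ⟨1, one_pos, fun z hz => by simp [he] at hz⟩
    · have hcomp : IsCompact (Metric.sphere x₀ ρ ∩ Metric.closedBall y₀ R) :=
        (isCompact_sphere x₀ ρ).inter_right Metric.isClosed_closedBall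
      have hcont : ContinuousOn (fun z => U z - u z)
          (Metric.sphere x₀ ρ ∩ Metric.closedBall y₀ R) := fun z hz =>
        ((hball (Metric.sphere_subset_closedBall hz.1)).2.1.1.continuousAt.sub
          (hball (Metric.sphere_subset_closedBall hz.1)).1.1.continuousAt).continuousWithinAt
      obtain ⟨z, hz, hzmin⟩ := hcomp.exists_isMinOn hne' hcont
      have hzx : z ≠ x₀ := by
        rintro rfl
        have := hz.1
        simp at this
        exact hρ.ne this
      exact ⟨U z - u z, sub_pos.mpr ((hball (Metric.sphere_subset_closedBall hz.1)).2.2.2.2 hz.2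
        hzx), fun w hw => hzmin hw⟩
  -- The bound by `m` keeps the barrier below `U - u` on the part of the lens boundary away from
  -- `x₀`; the other bound makes the factor `κ` of the barrier's Hessian smaller than `δ`.
  obtain ⟨ε, hε, hεm, hεδ⟩ : ∃ ε > 0, ε ≤ m ∧ 2 * k * ε < δ := by
    refine ⟨min m (δ / (4 * k)), by positivity, min_le_left _ _, ?_⟩
    have h1 : 2 * k * min m (δ / (4 * k)) ≤ 2 * k * (δ / (4 * k)) := by
      gcongr; exact min_le_right _ _
    have h2 : 2 * k * (δ / (4 * k)) = δ / 2 := by field_simp; norm_num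
    linarith
  set g : V → ℝ := fun z => ε * barrier k y₀ z with hg
  set w : V → ℝ := fun z => U z - u z - g z with hw
  have hgC : ContDiff ℝ 2 g := contDiff_const.mul (contDiff_barrier k y₀)
  set e₀ := Real.exp (-(k * R ^ 2)) with he₀
  have hwC : ∀ z ∈ Metric.closedBall x₀ ρ, ContDiffAt ℝ 2 w z := fun z hz =>
    ((hball hz).2.1.1.sub (hball hz).1.1).sub hgC.contDiffAt
  have hx₀ρ : x₀ ∈ Metric.closedBall x₀ ρ := Metric.mem_closedBall_self hρ.le
  have hwD : ∀ z ∈ Metric.closedBall x₀ ρ, HasFDerivAt w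
      (fderiv ℝ U z - fderiv ℝ u z + (2 * k * ε * barrier k y₀ z) • realInner V (z - y₀)) z := by
    intro z hz
    have h1 := ((hball hz).2.1.1.differentiableAt (by simp)).hasFDerivAt
    have h2 := ((hball hz).1.1.differentiableAt (by simp)).hasFDerivAt
    have h3 := (h1.sub h2).sub ((hasFDerivAt_barrier k y₀ z).const_mul ε)
    refine h3.congr_fderiv (ContinuousLinearMap.ext fun y => ?_)
    simp only [add_apply, sub_apply, smul_apply, smul_eq_mul]
    ring
  have hbarrier_le : ∀ z, barrier k y₀ z ≤ 1 := fun z => by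
    rw [barrier, Real.exp_le_one_iff]
    have : 0 ≤ k * ‖z - y₀‖ ^ 2 := by positivity
    linarith
  have hbarrier_pos : ∀ z, 0 < barrier k y₀ z := fun z => Real.exp_pos _
  have hAcomp : IsCompact (Metric.closedBall x₀ ρ ∩ Metric.closedBall y₀ R) :=
    (isCompact_closedBall x₀ ρ).inter_right Metric.isClosed_closedBall
  have hx₀R : x₀ ∈ Metric.closedBall y₀ R := by simp [hR, dist_eq_norm]
  obtain ⟨z, ⟨hzρ, hzR⟩, hzmin⟩ := hAcomp.exists_isMinOn ⟨x₀, hx₀ρ, hx₀R⟩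
    fun z hz => (hwC z hz.1).continuousAt.continuousWithinAt
  -- On the cap where `‖z - x₀‖ = ρ` one has `w ≥ m - ε ≥ 0`, and on the sphere about `y₀` the
  -- barrier equals `e₀` while `u ≤ U`. A smaller minimum would thus be interior, where the first
  -- and second order conditions contradict `hstrict`.
  have hge : -(ε * e₀) ≤ w z := by
    by_contra! hneg
    have hz1 : z ∈ Metric.ball x₀ ρ := by
      by_contra hzn
      have hs : z ∈ Metric.sphere x₀ ρ :=
        le_antisymm hzρ (by simpa [Metric.mem_ball] using hzn)
      have h1 := hmle z ⟨hs, hzR⟩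
      have h2 : ε * barrier k y₀ z ≤ ε := by
        simpa using mul_le_mul_of_nonneg_left (hbarrier_le z) hε.le
      have h3 : 0 < ε * e₀ := mul_pos hε (Real.exp_pos _)
      simp only [hw, hg] at hneg
      linarith
    have hz2 : z ∈ Metric.ball y₀ R := by
      by_contra hzn
      have hs : ‖z - y₀‖ = R := by
        rw [← dist_eq_norm]
        exact le_antisymm hzR (by simpa [Metric.mem_ball] using hzn)
      have h1 := hle z hzρ hzR
      simp only [hw, hg, barrier, hs] at hneg
      linarith
    have hloc : IsLocalMin w z := by
      filter_upwards [(Metric.isOpen_ball.inter Metric.isOpen_ball).mem_nhds ⟨hz1, hz2⟩] with x hx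
      exact hzmin ⟨Metric.ball_subset_closedBall hx.1, Metric.ball_subset_closedBall hx.2⟩
    obtain ⟨⟨hzu, hzu1, hzu2⟩, ⟨hzU, hzU1, hzU2⟩, hzr, hzin, -⟩ := hball hzρ
    obtain ⟨b, a, hbm, ham, hb, ha, -⟩ := (hzin hz2).exists_monotone hγ
    set κ := 2 * k * ε * barrier k y₀ z with hκ
    have hκpos : 0 < κ := mul_pos (by positivity) (hbarrier_pos z)
    have hfirst : fderiv ℝ U z - fderiv ℝ u z = -(κ • realInner V (z - y₀)) := by
      have := hloc.hasFDerivAt_eq_zero (hwD z hzρ)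
      exact eq_neg_of_add_eq_zero_left this
    have hsecond : ∀ y, fderiv ℝ (fderiv ℝ u) z y y + κ * barrierForm k (z - y₀) y y ≤
        fderiv ℝ (fderiv ℝ U) z y y := by
      intro y
      have h1 := hloc.fderiv_fderiv_nonneg (hwC z hzρ) y
      have h2 : fderiv ℝ w =ᶠ[𝓝 z] fun x => fderiv ℝ U x - fderiv ℝ u x -
          ε • fderiv ℝ (barrier k y₀) x := by
        filter_upwards [Metric.isOpen_ball.mem_nhds hz1] with x hx
        rw [(hwD x (Metric.ball_subset_closedBall hx)).fderiv, fderiv_barrier]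
        refine ContinuousLinearMap.ext fun y => ?_
        simp only [add_apply, sub_apply, smul_apply, smul_eq_mul]
        ring
      have hd : ∀ {v : V → ℝ}, ContDiffAt ℝ 2 v z →
          HasFDerivAt (fderiv ℝ v) (fderiv ℝ (fderiv ℝ v) z) z := fun hv =>
        ((hv.fderiv_right (m := 1) (by norm_num)).differentiableAt (by simp)).hasFDerivAt
      have h3 := (((hd hzU).sub (hd hzu)).sub
        ((hd (contDiff_barrier k y₀).contDiffAt).const_smul ε)).fderiv
      rw [h2.fderiv_eq] at h1
      erw [h3] at h1
      rw [fderiv_fderiv_barrier] at h1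
      simp only [sub_apply, smul_apply, smul_eq_mul] at h1
      have h4 : κ * barrierForm k (z - y₀) y y =
        ε * (2 * k * barrier k y₀ z * barrierForm k (z - y₀) y y) := by rw [hκ]; ring
      linarith
    have hsym : ∀ x y, fderiv ℝ (fderiv ℝ u) z x y = fderiv ℝ (fderiv ℝ u) z y x :=
      hzu.isSymmSndFDerivAt (by simp)
    refine hstrict (fderiv ℝ u z) (fderiv ℝ U z) _ _ (z - y₀) κ hzu1 hzu2 ?_ hzU2 hκpos ?_ hzr.le
      ?_ ?_ hsym hsecond b a hbm ham hb.isDiag ha.isDiag hb.equation ha.equation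
    · rw [hD]; exact hzU1
    · refine lt_of_le_of_lt ?_ hεδ
      exact mul_le_of_le_one_right (by positivity) (hbarrier_le z)
    · simpa [dist_eq_norm] using hzR
    · rw [hfirst, norm_neg, norm_smul, Real.norm_of_nonneg hκpos.le, norm_realInner_apply]
  have hline : ∀ t : ℝ, HasDerivAt (fun t : ℝ => x₀ + t • (y₀ - x₀)) (y₀ - x₀) t := fun t => by
    simpa using ((hasDerivAt_id t).smul_const (y₀ - x₀)).const_add x₀
  -- At `x₀` the derivatives of `u` and `U` cancel and the barrier grows towards `y₀`, so `w`
  -- strictly decreases along this ray. But `w` has its minimum over the lens at `x₀`.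
  have hder : HasDerivAt (fun t : ℝ => w (x₀ + t • (y₀ - x₀))) (-(2 * k * ε * e₀ * R ^ 2)) 0 := by
    have h1 : HasFDerivAt w (fderiv ℝ U x₀ - fderiv ℝ u x₀ +
        (2 * k * ε * barrier k y₀ x₀) • realInner V (x₀ - y₀)) (x₀ + (0 : ℝ) • (y₀ - x₀)) := by
      simpa using hwD x₀ hx₀ρ
    have h2 := h1.comp_hasDerivAt (0 : ℝ) (hline 0)
    have h3 : inner ℝ (x₀ - y₀) (y₀ - x₀) = -R ^ 2 := by
      rw [← neg_sub x₀ y₀, inner_neg_right, real_inner_self_eq_norm_sq]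
    have h4 : barrier k y₀ x₀ = e₀ := by simp [barrier, he₀, hR]
    have h5 : (fderiv ℝ U x₀ - fderiv ℝ u x₀ + (2 * k * ε * barrier k y₀ x₀) •
        realInner V (x₀ - y₀)) (y₀ - x₀) = -(2 * k * ε * e₀ * R ^ 2) := by
      rw [hD, sub_self, zero_add, smul_apply, realInner_apply, h3, h4, smul_eq_mul]
      ring
    rw [h5] at h2
    exact h2
  have hw0 : w x₀ = -(ε * e₀) := by simp [hw, hg, heq, barrier, he₀, hR]
  have hev : ∀ᶠ t in 𝓝[>] (0 : ℝ), w x₀ ≤ w (x₀ + t • (y₀ - x₀)) := by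
    have hcl : ∀ᶠ t in 𝓝 (0 : ℝ), x₀ + t • (y₀ - x₀) ∈ Metric.closedBall x₀ ρ := by
      have := (hline 0).continuousAt.tendsto
      simp only [zero_smul, add_zero] at this
      exact this.eventually (Metric.closedBall_mem_nhds x₀ hρ)
    filter_upwards [nhdsWithin_le_nhds hcl, self_mem_nhdsWithin,
      nhdsWithin_le_nhds (gt_mem_nhds (zero_lt_one (α := ℝ)))] with t h1 h2 h3
    have h4 : x₀ + t • (y₀ - x₀) ∈ Metric.closedBall y₀ R := by
      rw [mem_closedBall_iff_norm]
      have : x₀ + t • (y₀ - x₀) - y₀ = (1 - t) • (x₀ - y₀) := by module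
      rw [this, norm_smul, Real.norm_of_nonneg (by linarith)]
      have h2' : 0 < t := h2
      exact mul_le_of_le_one_left hRpos.le (by linarith)
    rw [hw0]
    exact hge.trans (hzmin ⟨h1, h4⟩)
  have hnonneg : 0 ≤ -(2 * k * ε * e₀ * R ^ 2) := by
    have hslope := hder.hasDerivWithinAt (s := Set.Ioi 0)
    rw [hasDerivWithinAt_iff_tendsto_slope' (by simp)] at hslope
    refine ge_of_tendsto hslope ?_
    filter_upwards [hev, self_mem_nhdsWithin] with t ht ht0
    rw [slope_def_field]
    have ht0' : (0 : ℝ) < t := ht0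
    refine div_nonneg ?_ (by linarith)
    simpa using ht
  have : 0 < 2 * k * ε * e₀ * R ^ 2 := by
    have : 0 < e₀ := Real.exp_pos _
    positivity
  linarith

end HopfLemma

/-! ### Strong maximum principle, in the interior and up to a flat boundary. -/

section StrongMaximumPrinciple

set_option maxSynthPendingDepth 3

/-- By the parallelogram law, the ball with diameter from `y` to `x` touches the sphere about `y`
through `x` at `x` alone. Halving the ball in this way makes the contact point unique. -/
theorem eq_of_mem_closedBall_midpoint {V : Type*} [NormedAddCommGroup V] [InnerProductSpace ℝ V]
    {x y z : V} (h : ‖z - midpoint ℝ y x‖ ≤ ‖x - midpoint ℝ y x‖) (h' : ‖x - y‖ ≤ ‖z - y‖) :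
    z = x := by
  set m := midpoint ℝ y x with hm
  have h1 : x - m = m - y := by
    rw [hm, midpoint_eq_smul_add, invOf_eq_inv]; module
  have hp := parallelogram_law_with_norm ℝ (z - m) (x - m)
  have h2 : z - m + (x - m) = z - y := by rw [h1]; abel
  have h3 : x - y = (2 : ℝ) • (x - m) := by
    have : x - y = (x - m) + (m - y) := by abel
    rw [this, ← h1, two_smul]
  rw [h2, sub_sub_sub_cancel_right] at hp
  rw [h3, norm_smul, Real.norm_of_nonneg zero_le_two] at h'
  have h0 := norm_nonneg (z - m)
  have h4 := norm_nonneg (x - m)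
  have : ‖z - x‖ * ‖z - x‖ ≤ 0 := by nlinarith
  have : ‖z - x‖ = 0 := by nlinarith [norm_nonneg (z - x)]
  exact sub_eq_zero.mp (norm_eq_zero.mp this)

variable {n : ℕ} {V : Type*} [NormedAddCommGroup V] [InnerProductSpace ℝ V]
  [FiniteDimensional ℝ V]

/-- Strong maximum principle on a connected open set. -/
theorem eqOn_of_touching {Γ : Set (Fin n → ℝ)} {γ : (Fin n → ℝ) → ℝ} {α : ℝ}
    (hγ : IsSpeedFunction Γ γ α) (hV : Module.finrank ℝ V = n)
    {N : (V →L[ℝ] ℝ) → V →L[ℝ] V →L[ℝ] ℝ} {φ : (V →L[ℝ] ℝ) → ℝ} {u U : V → ℝ} {D : Set V}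
    (hNc : ContDiff ℝ 1 N) (hφ : ContDiff ℝ 1 φ) (hN : ∀ q y, ‖y‖ ^ 2 ≤ N q y y)
    (hD : IsOpen D) (hDc : IsPreconnected D) (hu : ∀ y ∈ D, ContDiffAt ℝ 2 u y)
    (hU : ∀ y ∈ D, ContDiffAt ℝ 2 U y) (hle : ∀ y ∈ D, u y ≤ U y)
    (hpair : ∀ y ∈ D, SolvePairAt Γ γ N φ u U y) {p : V} (hp : p ∈ D) (hpe : u p = U p) :
    ∀ y ∈ D, u y = U y := by
  by_contra! hcon
  obtain ⟨y₁, hy₁, hy₁ne⟩ := hcon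
  set O : Set V := {y | y ∈ D ∧ u y < U y} with hO
  have hOopen : IsOpen O := by
    rw [isOpen_iff_mem_nhds]
    rintro y ⟨hy, hlt⟩
    exact (hD.eventually_mem hy).and ((hu y hy).continuousAt.eventually_lt
      (hU y hy).continuousAt hlt)
  obtain ⟨x, hxD, hxe, hxO⟩ : ∃ x ∈ D, u x = U x ∧ x ∈ closure O := by
    by_contra! hno
    obtain ⟨z, -, hz1, hz2⟩ := hDc O (closure O)ᶜ hOopen isClosed_closure.isOpen_compl
      (fun z hz => by
        rcases (hle z hz).lt_or_eq with h | h
        · exact Or.inl ⟨hz, h⟩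
        · exact Or.inr (hno z hz h))
      ⟨y₁, hy₁, hy₁, lt_of_le_of_ne (hle y₁ hy₁) hy₁ne⟩ ⟨p, hp, hno p hp hpe⟩
    exact hz2 (subset_closure hz1)
  obtain ⟨s, hs, hball⟩ := Metric.isOpen_iff.mp hD x hxD
  obtain ⟨y, ⟨hyD, hylt⟩, hyx⟩ := Metric.mem_closure_iff.mp hxO (s / 2) (half_pos hs)
  have hsub : Metric.closedBall y (dist x y) ⊆ D := fun z hz => hball (by
    rw [Metric.mem_ball]
    have h1 := dist_triangle z y x
    rw [Metric.mem_closedBall] at hz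
    rw [dist_comm y x] at h1
    linarith)
  have hK : IsCompact (Metric.closedBall y (dist x y) ∩ {z | U z - u z ∈ ({0} : Set ℝ)}) := by
    refine (isCompact_closedBall y (dist x y)).of_isClosed_subset ?_ Set.inter_subset_left
    exact ContinuousOn.preimage_isClosed_of_isClosed
      (fun z hz => ((hU z (hsub hz)).continuousAt.sub
        (hu z (hsub hz)).continuousAt).continuousWithinAt)
      Metric.isClosed_closedBall isClosed_singleton
  -- A contact point nearest to `y`: the open ball about `y` through `x₁` contains no contact point.
  -- Compactness needs the closed ball to lie in `D`, which is why `y` was taken within `s / 2` of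
  -- `x`.
  obtain ⟨x₁, ⟨hx₁b, hx₁e⟩, hx₁min⟩ := hK.exists_isMinOn
    ⟨x, by simp, by simp [hxe]⟩ (f := fun z => ‖z - y‖) (by fun_prop)
  have hx₁D := hsub hx₁b
  have hx₁e' : u x₁ = U x₁ := by
    have : U x₁ - u x₁ = 0 := hx₁e
    linarith
  have hx₁y : x₁ ≠ y := by
    rintro rfl
    exact hylt.ne hx₁e'
  have hfar : ∀ z ∈ D, ‖z - y‖ < ‖x₁ - y‖ → u z < U z := by
    intro z hz hzlt
    refine lt_of_le_of_ne (hle z hz) fun he => ?_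
    have hzb : z ∈ Metric.closedBall y (dist x y) := by
      rw [Metric.mem_closedBall, dist_eq_norm]
      rw [Metric.mem_closedBall, dist_eq_norm] at hx₁b
      linarith
    have : ‖x₁ - y‖ ≤ ‖z - y‖ := hx₁min ⟨hzb, by simp [he]⟩
    linarith
  have hmin : IsLocalMin (fun z => U z - u z) x₁ := by
    filter_upwards [hD.mem_nhds hx₁D] with z hz
    have := hle z hz
    linarith
  have hder : fderiv ℝ u x₁ = fderiv ℝ U x₁ := by
    have h0 := hmin.hasFDerivAt_eq_zero
      (((hU x₁ hx₁D).differentiableAt (by simp)).hasFDerivAt.sub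
        ((hu x₁ hx₁D).differentiableAt (by simp)).hasFDerivAt)
    exact (sub_eq_zero.mp h0).symm
  refine hopf_contact hγ hV hNc.contDiffAt hφ.contDiffAt hN (hu x₁ hx₁D) (hU x₁ hx₁D) hx₁e' hder
    (hpair x₁ hx₁D) (y₀ := midpoint ℝ y x₁) ?_ ?_ ?_
  · intro h
    exact hx₁y (by simpa using h.symm : y = x₁).symm
  · filter_upwards [hD.mem_nhds hx₁D] with z hz _
    exact hpair z hz
  · filter_upwards [hD.mem_nhds hx₁D] with z hz hzb hzne
    refine hfar z hz ?_
    by_contra! hge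
    rw [mem_closedBall_iff_norm] at hzb
    exact hzne (eq_of_mem_closedBall_midpoint hzb hge)

/-- Two solutions on one side of each other, touching to first order at the origin, agree near
the origin; the origin may lie on the boundary of the domain if this is a half-space. -/
theorem eventually_eq_of_touching {Γ : Set (Fin n → ℝ)} {γ : (Fin n → ℝ) → ℝ} {α : ℝ}
    (hγ : IsSpeedFunction Γ γ α) (hV : Module.finrank ℝ V = n)
    {N : (V →L[ℝ] ℝ) → V →L[ℝ] V →L[ℝ] ℝ} {φ : (V →L[ℝ] ℝ) → ℝ} {u U : V → ℝ} {D : Set V}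
    (hNc : ContDiff ℝ 1 N) (hφ : ContDiff ℝ 1 φ) (hN : ∀ q y, ‖y‖ ^ 2 ≤ N q y y)
    (hD : D = Set.univ ∨ ∃ a : V, a ≠ 0 ∧ D = {y | 0 < inner ℝ a y})
    (hu : ContDiffAt ℝ 2 u 0) (hU : ContDiffAt ℝ 2 U 0) (heq : u 0 = U 0)
    (hder : fderiv ℝ u 0 = fderiv ℝ U 0) (h0 : (0 : V) ∈ closure D)
    (hle : ∀ᶠ y in 𝓝 0, y ∈ closure D → u y ≤ U y)
    (hpair : ∀ᶠ y in 𝓝 0, y ∈ closure D → SolvePairAt Γ γ N φ u U y) :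
    ∀ᶠ y in 𝓝 0, y ∈ closure D → u y = U y := by
  have hDopen : IsOpen D := by
    rcases hD with rfl | ⟨a, -, rfl⟩
    · exact isOpen_univ
    · exact isOpen_lt continuous_const (by fun_prop)
  have hDconv : Convex ℝ D := by
    rcases hD with rfl | ⟨a, -, rfl⟩
    · exact convex_univ
    · exact convex_halfSpace_gt (f := fun y => inner ℝ a y) (innerₗ V a).isLinear 0
  obtain ⟨ρ, hρ, hball⟩ := Metric.eventually_nhds_iff_ball.mp
    ((hu.eventually (by simp)).and ((hU.eventually (by simp)).and (hle.and hpair)))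
  set D' := D ∩ Metric.ball 0 ρ with hD'
  have hD'open : IsOpen D' := hDopen.inter Metric.isOpen_ball
  have hD'conv : Convex ℝ D' := hDconv.inter (convex_ball 0 ρ)
  obtain ⟨p, hp, hpe⟩ : ∃ p ∈ D', u p = U p := by
    rcases hD with rfl | ⟨a, ha, rfl⟩
    · exact ⟨0, ⟨trivial, Metric.mem_ball_self hρ⟩, heq⟩
    by_contra! hno
    -- If there is no contact inside the half-space near the origin, Hopf's lemma applies to the
    -- ball centred at the inner normal `a` through the origin, which meets the boundary of the
    -- half-space only there.
    have hsub : ∀ z ∈ Metric.closedBall a ‖(0 : V) - a‖, z ≠ 0 → 0 < inner ℝ a z := by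
      intro z hz hz0
      rw [mem_closedBall_iff_norm, zero_sub, norm_neg] at hz
      have h1 := norm_sub_sq_real z a
      have h2 : 0 < ‖z‖ ^ 2 := by positivity
      rw [real_inner_comm]
      nlinarith [norm_nonneg (z - a)]
    refine hopf_contact hγ hV hNc.contDiffAt hφ.contDiffAt hN hu hU heq hder
      (hpair.self_of_nhds h0) ha.symm ?_ ?_
    · filter_upwards [hpair] with z hz hzb
      refine hz (subset_closure (hsub z (Metric.ball_subset_closedBall hzb) ?_))
      rintro rfl
      simp [dist_eq_norm] at hzb
    · filter_upwards [Metric.ball_mem_nhds 0 hρ] with z hz hzb hz0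
      have hzD := hsub z hzb hz0
      exact lt_of_le_of_ne ((hball z hz).2.2.1 (subset_closure hzD)) (hno z ⟨hzD, hz⟩)
  have key := eqOn_of_touching hγ hV hNc hφ hN hD'open hD'conv.isPreconnected
    (fun y hy => (hball y hy.2).1) (fun y hy => (hball y hy.2).2.1)
    (fun y hy => (hball y hy.2).2.2.1 (subset_closure hy.1))
    (fun y hy => (hball y hy.2).2.2.2 (subset_closure hy.1)) hp hpe
  filter_upwards [Metric.ball_mem_nhds 0 hρ] with y hy hyD
  have hyD' : y ∈ closure D' := by
    rw [hD', Set.inter_comm]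
    exact Metric.isOpen_ball.inter_closure ⟨hy, hyD⟩
  have := mem_closure_iff_nhdsWithin_neBot.mp hyD'
  refine tendsto_nhds_unique_of_eventuallyEq
    ((hball y hy).1.continuousAt.continuousWithinAt (s := D'))
    ((hball y hy).2.1.continuousAt.continuousWithinAt (s := D')) ?_
  filter_upwards [self_mem_nhdsWithin] with z hz
  exact key z hz

end StrongMaximumPrinciple

/-! ### Graphs over a hyperplane and the implicit function theorem. -/

section GraphGeometry

set_option maxSynthPendingDepth 3

/-- The Riesz representative of a functional. -/
noncomputable def sharp (K : Type*) [NormedAddCommGroup K] [InnerProductSpace ℝ K]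
    [FiniteDimensional ℝ K] : (K →L[ℝ] ℝ) →L[ℝ] K :=
  ((InnerProductSpace.toDual ℝ K).symm :
    (K →L[ℝ] ℝ) ≃ₗᵢ[ℝ] K).toContinuousLinearEquiv.toContinuousLinearMap

theorem inner_sharp {K : Type*} [NormedAddCommGroup K] [InnerProductSpace ℝ K]
    [FiniteDimensional ℝ K] (q : K →L[ℝ] ℝ) (x : K) : inner ℝ (sharp K q) x = q x :=
  InnerProductSpace.toDual_symm_apply (𝕜 := ℝ) (x := x) (y := q)

variable {E : Type*} [NormedAddCommGroup E] [InnerProductSpace ℝ E]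

/-- The orthogonal complement of `v`, over which hypersurfaces are written as graphs. -/
noncomputable abbrev graphBase (v : E) : Submodule ℝ E := (ℝ ∙ v)ᗮ

/-- The projection along `v`. -/
noncomputable abbrev graphProj (v : E) : E →L[ℝ] graphBase v :=
  (graphBase v).orthogonalProjectionOnto

theorem inner_graphBase (v : E) (y : graphBase v) : inner ℝ v (y : E) = 0 :=
  Submodule.mem_orthogonal_singleton_iff_inner_right.mp y.2

theorem graphProj_coe {v : E} (y : graphBase v) : graphProj v (y : E) = y :=
  Submodule.orthogonalProjectionOnto_mem_subspace_eq_self y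

theorem graphProj_self (v : E) : graphProj v v = 0 :=
  Submodule.orthogonalProjectionOnto_orthogonalComplement_singleton_eq_zero v

theorem graphProj_add_smul {v : E} (hv : ‖v‖ = 1) (w : E) :
    (graphProj v w : E) + (inner ℝ v w : ℝ) • v = w := by
  have h : w - (inner ℝ v w : ℝ) • v ∈ graphBase v := by
    rw [Submodule.mem_orthogonal_singleton_iff_inner_right, inner_sub_right, inner_smul_right,
      real_inner_self_eq_norm_sq, hv]
    ring
  have h1 : graphProj v w = ⟨w - (inner ℝ v w : ℝ) • v, h⟩ := by
    conv_lhs => rw [← sub_add_cancel w ((inner ℝ v w : ℝ) • v)]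
    rw [map_add, map_smul, graphProj_self, smul_zero, add_zero]
    exact graphProj_coe (⟨_, h⟩ : graphBase v)
  rw [h1]
  simp

theorem inner_eq_graphProj {v : E} (hv : ‖v‖ = 1) (w w' : E) :
    inner ℝ w w' = inner ℝ (graphProj v w) (graphProj v w') + inner ℝ v w * inner ℝ v w' := by
  conv_lhs => rw [← graphProj_add_smul hv w, ← graphProj_add_smul hv w']
  rw [inner_add_left, inner_add_right, inner_add_right, inner_smul_left, inner_smul_left,
    inner_smul_right, inner_smul_right, real_inner_self_eq_norm_sq, hv, inner_graphBase,
    real_inner_comm v, inner_graphBase, Submodule.coe_inner]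
  simp

theorem finrank_graphBase {n : ℕ} (hE : Module.finrank ℝ E = n + 1) {v : E} (hv : v ≠ 0) :
    Module.finrank ℝ (graphBase v) = n := by
  have : Fact (Module.finrank ℝ E = n + 1) := ⟨hE⟩
  exact Submodule.finrank_orthogonal_span_singleton hv

variable [FiniteDimensional ℝ E]

/-- The gradient of `x ↦ ⟨v, x⟩ - u (π x)` when `u` has derivative `q`. -/
noncomputable def graphGrad (v : E) (q : graphBase v →L[ℝ] ℝ) : E :=
  v - (sharp (graphBase v) q : E)

theorem inner_graphGrad (v : E) (q : graphBase v →L[ℝ] ℝ) (w : E) :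
    inner ℝ (graphGrad v q) w = inner ℝ v w - q (graphProj v w) := by
  rw [graphGrad, inner_sub_left, ← inner_sharp q,
    ← Submodule.inner_orthogonalProjectionOnto_eq_of_mem_left]

theorem inner_graphGrad_self {v : E} (hv : ‖v‖ = 1) (q : graphBase v →L[ℝ] ℝ) :
    inner ℝ (graphGrad v q) v = 1 := by
  rw [inner_graphGrad, graphProj_self, map_zero, real_inner_self_eq_norm_sq, hv]
  norm_num

theorem one_le_norm_graphGrad {v : E} (hv : ‖v‖ = 1) (q : graphBase v →L[ℝ] ℝ) :
    1 ≤ ‖graphGrad v q‖ := by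
  have := real_inner_le_norm (graphGrad v q) v
  rwa [inner_graphGrad_self hv, hv, mul_one] at this

theorem graphGrad_ne_zero {v : E} (hv : ‖v‖ = 1) (q : graphBase v →L[ℝ] ℝ) : graphGrad v q ≠ 0 :=
  norm_pos_iff.mp (one_pos.trans_le (one_le_norm_graphGrad hv q))

theorem contDiff_graphGrad (v : E) : ContDiff ℝ 1 (graphGrad v) :=
  contDiff_const.sub ((graphBase v).subtypeL.contDiff.comp (sharp (graphBase v)).contDiff)

theorem hasFDerivAt_graphGrad (v : E) (q : graphBase v →L[ℝ] ℝ) :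
    HasFDerivAt (graphGrad v) (-((graphBase v).subtypeL.comp (sharp (graphBase v)))) q :=
  (((graphBase v).subtypeL.comp (sharp (graphBase v))).hasFDerivAt).const_sub v

theorem graphGrad_injective (v : E) : Function.Injective (graphGrad v) := by
  intro q q' h
  ext y
  have h1 := inner_graphGrad v q y
  have h2 := inner_graphGrad v q' y
  rw [h, h2, graphProj_coe] at h1
  linarith

/-- The first fundamental form of a graph with slope `q`, weighted by the area element. -/
noncomputable def graphMetric (v : E) (q : graphBase v →L[ℝ] ℝ) :
    graphBase v →L[ℝ] graphBase v →L[ℝ] ℝ :=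
  ‖graphGrad v q‖ • (realInner (graphBase v) + q.smulRight q)

theorem graphMetric_apply (v : E) (q : graphBase v →L[ℝ] ℝ) (x y : graphBase v) :
    graphMetric v q x y = ‖graphGrad v q‖ * (inner ℝ x y + q x * q y) := by
  simp only [graphMetric, smul_apply, add_apply, realInner_apply,
    ContinuousLinearMap.smulRight_apply, smul_eq_mul]

theorem contDiff_graphMetric {v : E} (hv : ‖v‖ = 1) : ContDiff ℝ 1 (graphMetric v) := by
  have h1 : ContDiff ℝ 1 fun q => ‖graphGrad v q‖ :=
    (contDiff_graphGrad v).norm ℝ (graphGrad_ne_zero hv)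
  have h2 : ContDiff ℝ 1 fun q : graphBase v →L[ℝ] ℝ => q.smulRight q :=
    (isBoundedBilinearMap_smulRight (𝕜 := ℝ) (E := graphBase v)
      (F := graphBase v →L[ℝ] ℝ)).contDiff.comp (contDiff_id.prodMk contDiff_id)
  exact h1.smul (contDiff_const.add h2)

theorem norm_sq_le_graphMetric {v : E} (hv : ‖v‖ = 1) (q : graphBase v →L[ℝ] ℝ)
    (y : graphBase v) : ‖y‖ ^ 2 ≤ graphMetric v q y y := by
  rw [graphMetric_apply, real_inner_self_eq_norm_sq]
  nlinarith [one_le_norm_graphGrad hv q, sq_nonneg ‖y‖, mul_self_nonneg (q y)]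

/-- The component along `e` of the upward unit normal of a graph with slope `q`. -/
noncomputable def graphTilt (v e : E) (q : graphBase v →L[ℝ] ℝ) : ℝ :=
  ‖graphGrad v q‖⁻¹ * inner ℝ (graphGrad v q) e

theorem contDiff_graphTilt {v : E} (hv : ‖v‖ = 1) (e : E) : ContDiff ℝ 1 (graphTilt v e) := by
  have h1 : ContDiff ℝ 1 fun q => ‖graphGrad v q‖⁻¹ :=
    ((contDiff_graphGrad v).norm ℝ (graphGrad_ne_zero hv)).inv fun q =>
      norm_ne_zero_iff.mpr (graphGrad_ne_zero hv q)
  exact h1.mul ((contDiff_graphGrad v).inner ℝ contDiff_const)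

/-- The implicit function theorem for a level set transversal to `v`. -/
theorem exists_graph_of_regular {f : E → ℝ} {p v : E} (hv : ‖v‖ = 1) (hf : ContDiffAt ℝ 2 f p)
    (hfp : f p = 0) (hfv : fderiv ℝ f p v ≠ 0) :
    ∃ u : graphBase v → ℝ, ContDiffAt ℝ 2 u 0 ∧ u 0 = 0 ∧
      ∀ᶠ x in 𝓝 p, f x = 0 ↔ inner ℝ v (x - p) = u (graphProj v (x - p)) := by
  let L : graphBase v × ℝ →L[ℝ] E :=
    (graphBase v).subtypeL.coprod (ContinuousLinearMap.toSpanSingleton ℝ v)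
  have hL : ∀ y t, L (y, t) = (y : E) + t • v := fun y t => by simp [L]
  let F : graphBase v × ℝ → ℝ := fun z => f (p + L z)
  have hF : ContDiffAt ℝ 2 F (0, 0) := by
    refine ContDiffAt.comp (0, 0) (g := f) (f := fun z => p + L z) ?_
      (contDiff_const.add L.contDiff).contDiffAt
    simpa [hL] using hf
  have hFd : HasFDerivAt F ((fderiv ℝ f p).comp L) (0, 0) := by
    have h1 : HasFDerivAt f (fderiv ℝ f p) (p + L (0, 0)) := by
      simpa [hL] using (hf.differentiableAt (by simp)).hasFDerivAt
    exact h1.comp (0, 0) (L.hasFDerivAt.const_add p)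
  have hinv : (fderiv ℝ F (0, 0) ∘L ContinuousLinearMap.inr ℝ (graphBase v) ℝ).IsInvertible := by
    rw [hFd.fderiv]
    refine ⟨ContinuousLinearEquiv.unitsEquivAut ℝ (Units.mk0 _ hfv), ?_⟩
    ext
    simp [hL]
  have h20 : (2 : ℕ∞ω) ≠ 0 := by simp
  refine ⟨hF.implicitFunction h20 hinv, hF.contDiffAt_implicitFunction h20 hinv,
    hF.implicitFunction_apply_self h20 hinv, ?_⟩
  have hev := hF.eventually_apply_eq_iff_implicitFunction h20 hinv
  have hc : Filter.Tendsto (fun x => (graphProj v (x - p), inner ℝ v (x - p))) (𝓝 p)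
      (𝓝 ((0, 0) : graphBase v × ℝ)) := by
    have : ContinuousAt (fun x => (graphProj v (x - p), inner ℝ v (x - p))) p := by fun_prop
    simpa [ContinuousAt] using this
  filter_upwards [hc.eventually hev] with x hx
  have h1 : F (graphProj v (x - p), inner ℝ v (x - p)) = f x := by
    simp only [F, hL, graphProj_add_smul hv (x - p), add_sub_cancel]
  have h2 : F (0, 0) = 0 := by simpa [F, hL] using hfp
  rw [h1, h2] at hx
  rw [hx]
  exact eq_comm

end GraphGeometry

/-! ### Tangent spaces, normals and principal curvatures of graphs. -/

section CurvatureOfGraphs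

set_option maxSynthPendingDepth 3

variable {n : ℕ}

/-- The direction of translation. -/
noncomputable abbrev upward (n : ℕ) : Ambient n := EuclideanSpace.single (Fin.last n) 1

/-- Along `M` the function `F` has both its own derivative and the zero derivative, and derivatives
within a set are unique on its tangent cone. -/
theorem inner_eq_zero_of_mem_tangentSpaceAt {M : Set (Ambient n)} {x g : Ambient n}
    {F : Ambient n → ℝ} (hF : HasFDerivAt F (innerSL ℝ g) x) (hx : x ∈ M)
    (hM : ∀ᶠ z in 𝓝 x, z ∈ M → F z = 0) {w : Ambient n} (hw : w ∈ tangentSpaceAt M x) :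
    inner ℝ g w = 0 := by
  have h0 : HasFDerivWithinAt F (0 : Ambient n →L[ℝ] ℝ) M x := by
    refine (hasFDerivWithinAt_const (0 : ℝ) x M).congr_of_eventuallyEq ?_ (hM.self_of_nhds hx)
    exact eventually_nhdsWithin_iff.mpr hM
  have heq := hF.hasFDerivWithinAt.unique_on h0
  have : tangentSpaceAt M x ≤ (ℝ ∙ g)ᗮ := by
    refine Submodule.span_le.mpr fun y hy => ?_
    rw [SetLike.mem_coe, Submodule.mem_orthogonal_singleton_iff_inner_right]
    exact heq hy
  exact Submodule.mem_orthogonal_singleton_iff_inner_right.mp (this hw)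

/-- One inclusion holds because `F` vanishes on `M`. Equality follows by dimension: the principal
directions are `n` independent tangent vectors. The argument is the same at boundary points. -/
theorem tangentSpaceAt_eq_orthogonal {M : Set (Ambient n)} {ν : Ambient n → Ambient n}
    {x g : Ambient n} {l : Fin n → ℝ} (hl : IsPrincipalCurvatures M ν x l) (hg : g ≠ 0)
    {F : Ambient n → ℝ} (hF : HasFDerivAt F (innerSL ℝ g) x) (hx : x ∈ M)
    (hM : ∀ᶠ z in 𝓝 x, z ∈ M → F z = 0) : tangentSpaceAt M x = (ℝ ∙ g)ᗮ := by
  obtain ⟨A, e, -, he, heT, -⟩ := hl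
  refine Submodule.eq_of_le_of_finrank_le (fun w hw =>
    Submodule.mem_orthogonal_singleton_iff_inner_right.mpr
      (inner_eq_zero_of_mem_tangentSpaceAt hF hx hM hw)) ?_
  have : Module.finrank ℝ (ℝ ∙ g)ᗮ = n := finrank_graphBase (by simp) hg
  rw [this]
  have h1 : LinearIndependent ℝ fun i => (⟨e i, heT i⟩ : tangentSpaceAt M x) :=
    LinearIndependent.of_comp (tangentSpaceAt M x).subtype he.linearIndependent
  simpa using h1.fintype_card_le_finrank

/-- Fixes the sign of the normal: a translator's normal never points downwards because its speed is
nonnegative, so it agrees with the upward graph normal. -/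
theorem eq_smul_of_mem_orthogonal {E : Type*} [NormedAddCommGroup E] [InnerProductSpace ℝ E]
    {g ν e : E} (hν : ‖ν‖ = 1) (hmem : ν ∈ (ℝ ∙ g)ᗮᗮ)
    (h1 : 0 ≤ inner ℝ ν e) (h2 : 0 < inner ℝ g e) : ν = ‖g‖⁻¹ • g := by
  rw [Submodule.orthogonal_orthogonal, Submodule.mem_span_singleton] at hmem
  obtain ⟨c, rfl⟩ := hmem
  have hc : 0 ≤ c := by
    rw [real_inner_smul_left] at h1
    exact nonneg_of_mul_nonneg_left h1 h2
  rw [norm_smul, Real.norm_of_nonneg hc] at hν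
  congr 1
  exact eq_inv_of_mul_eq_one_left hν

/-- The defining function of the graph of `u`, based at `p`, in the direction `v`. -/
noncomputable def graphFun {E : Type*} [NormedAddCommGroup E] [InnerProductSpace ℝ E]
    (p v : E) (u : graphBase v → ℝ) (x : E) : ℝ :=
  inner ℝ v (x - p) - u (graphProj v (x - p))

theorem hasFDerivAt_graphFun {E : Type*} [NormedAddCommGroup E] [InnerProductSpace ℝ E]
    [FiniteDimensional ℝ E] {p v x : E} {u : graphBase v → ℝ}
    (hu : DifferentiableAt ℝ u (graphProj v (x - p))) :
    HasFDerivAt (graphFun p v u)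
      (innerSL ℝ (graphGrad v (fderiv ℝ u (graphProj v (x - p))))) x := by
  have h0 : HasFDerivAt (fun x => x - p) (ContinuousLinearMap.id ℝ E) x :=
    (hasFDerivAt_id x).sub_const p
  have h1 : HasFDerivAt (fun x => inner ℝ v (x - p)) (realInner E v) x :=
    (realInner E v).hasFDerivAt.comp x h0
  have h2 : HasFDerivAt (fun x => u (graphProj v (x - p)))
      ((fderiv ℝ u (graphProj v (x - p))).comp (graphProj v)) x :=
    hu.hasFDerivAt.comp x ((graphProj v).hasFDerivAt.comp x h0)
  refine (h1.sub h2).congr_fderiv (ContinuousLinearMap.ext fun w => ?_)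
  exact (inner_graphGrad v _ w).symm

/-- The principal curvatures of a graph are the eigenvalues of the Hessian relative to the graph
metric. -/
theorem isDiag_of_isPrincipalCurvatures {M : Set (Ambient n)} {ν : Ambient n → Ambient n}
    {p v x : Ambient n} {l : Fin n → ℝ} {u : graphBase v → ℝ} (hv : ‖v‖ = 1)
    (hl : IsPrincipalCurvatures M ν x l) (hx : x ∈ M)
    (hu : ContDiffAt ℝ 2 u (graphProj v (x - p)))
    (hT : tangentSpaceAt M x = (ℝ ∙ graphGrad v (fderiv ℝ u (graphProj v (x - p))))ᗮ)
    (hν : ∀ᶠ z in 𝓝 x, z ∈ M → ν z = ‖graphGrad v (fderiv ℝ u (graphProj v (z - p)))‖⁻¹ •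
      graphGrad v (fderiv ℝ u (graphProj v (z - p)))) :
    IsDiag (graphMetric v (fderiv ℝ u (graphProj v (x - p))))
      (fderiv ℝ (fderiv ℝ u) (graphProj v (x - p))) l := by
  obtain ⟨A, e, hA, he, heT, hAe⟩ := hl
  set y := graphProj v (x - p) with hy
  set q := fderiv ℝ u y with hq
  set G : Ambient n → Ambient n := fun z => graphGrad v (fderiv ℝ u (graphProj v (z - p))) with hG
  have hGx : G x = graphGrad v q := rfl
  have h0 : HasFDerivAt (fun z => graphProj v (z - p)) (graphProj v) x :=
    (graphProj v).hasFDerivAt.comp x ((hasFDerivAt_id x).sub_const p)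
  have hD2 : HasFDerivAt (fderiv ℝ u) (fderiv ℝ (fderiv ℝ u) y) y :=
    ((hu.fderiv_right (m := 1) (by norm_num)).differentiableAt (by simp)).hasFDerivAt
  have hGd : HasFDerivAt G ((-((graphBase v).subtypeL.comp (sharp (graphBase v)))).comp
      ((fderiv ℝ (fderiv ℝ u) y).comp (graphProj v))) x :=
    HasFDerivAt.comp (g := graphGrad v) (f := fun z => fderiv ℝ u (graphProj v (z - p))) x
      (hasFDerivAt_graphGrad v q)
      (HasFDerivAt.comp (g := fderiv ℝ u) (f := fun z => graphProj v (z - p)) x hD2 h0)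
  have hG0 : G x ≠ 0 := graphGrad_ne_zero hv q
  have hinv : DifferentiableAt ℝ (fun z => ‖G z‖⁻¹) x :=
    (hGd.differentiableAt.norm ℝ hG0).inv (norm_ne_zero_iff.mpr hG0)
  have hB := (hinv.hasFDerivAt.smul hGd).hasFDerivWithinAt (s := M)
  have hB' := hB.congr_of_eventuallyEq (f₁ := ν) (eventually_nhdsWithin_iff.mpr hν)
    (hν.self_of_nhds hx)
  -- `A` and the derivative of the normalized gradient are two derivatives of `ν` within `M`. They
  -- agree on the tangent cone and hence on its span, but not necessarily elsewhere.
  have hAB : ∀ w ∈ tangentSpaceAt M x, A w =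
      (‖G x‖⁻¹ • ((-((graphBase v).subtypeL.comp (sharp (graphBase v)))).comp
      ((fderiv ℝ (fderiv ℝ u) y).comp (graphProj v))) +
      (fderiv ℝ (fun z => ‖G z‖⁻¹) x).smulRight (G x)) w := fun w hw =>
    LinearMap.eqOn_span (f := (A : Ambient n →ₗ[ℝ] Ambient n)) (hA.unique_on hB') hw
  have hperp : ∀ w ∈ tangentSpaceAt M x, inner ℝ (G x) w = 0 := fun w hw => by
    rw [hT] at hw
    exact Submodule.mem_orthogonal_singleton_iff_inner_right.mp hw
  -- The derivative of the normalizing factor multiplies the normal `G x` and drops out against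
  -- tangent vectors.
  have hform : ∀ w ∈ tangentSpaceAt M x, ∀ w' ∈ tangentSpaceAt M x, inner ℝ (A w) w' =
      -(‖G x‖⁻¹ * fderiv ℝ (fderiv ℝ u) y (graphProj v w) (graphProj v w')) := by
    intro w hw w' hw'
    rw [hAB w hw]
    simp only [add_apply, smul_apply, ContinuousLinearMap.smulRight_apply,
      ContinuousLinearMap.comp_apply, neg_apply, inner_add_left, inner_smul_left, inner_neg_left,
      hperp w' hw', Submodule.subtypeL_apply]
    rw [← Submodule.inner_orthogonalProjectionOnto_eq_of_mem_left, inner_sharp]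
    simp
  have hg : 0 < ‖G x‖ := norm_pos_iff.mpr hG0
  -- `graphMetric` carries the extra factor `‖G x‖`, which takes up the denominator of the second
  -- fundamental form `D²u / ‖G x‖`. The projected principal directions must be rescaled
  -- accordingly.
  set s := (Real.sqrt ‖G x‖)⁻¹ with hs
  have hss : s * s = ‖G x‖⁻¹ := by
    rw [hs, ← mul_inv, Real.mul_self_sqrt hg.le]
  have heo := orthonormal_iff_ite.mp he
  refine ⟨fun i => s • graphProj v (e i), fun i j => ?_, fun i j => ?_⟩
  · have h1 : ∀ i, q (graphProj v (e i)) = inner ℝ v (e i) := fun i => by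
      have := inner_graphGrad v q (e i)
      rw [← hGx, hperp _ (heT i)] at this
      linarith
    have h2 := inner_eq_graphProj hv (e i) (e j)
    rw [← heo i j, h2, map_smul, map_smul, smul_apply, graphMetric_apply, h1, h1, ← hGx]
    simp only [smul_eq_mul]
    rw [← mul_assoc, ← mul_assoc, hss, inv_mul_cancel₀ hg.ne', one_mul]
  · have h1 := hform _ (heT i) _ (heT j)
    rw [hAe i, inner_neg_left, real_inner_smul_left, heo i j] at h1
    rw [map_smul, map_smul, smul_apply]
    simp only [smul_eq_mul]
    rw [← mul_assoc, hss]
    have h3 := neg_injective h1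
    rw [← h3]
    split_ifs <;> simp

end CurvatureOfGraphs

/-! ### Coincidence of ordered tangent graphs. -/

section LocalCoincidence

set_option maxSynthPendingDepth 3

variable {n : ℕ}

/-- Near `p`, the set `M` is the graph of `u` in the direction `v` over the closure of `D`. -/
structure IsGraphNear (M : Set (Ambient n)) (p v : Ambient n) (u : graphBase v → ℝ)
    (D : Set (graphBase v)) : Prop where
  contDiffAt : ContDiffAt ℝ 2 u 0
  map_zero : u 0 = 0
  mem_iff : ∀ᶠ x in 𝓝 p, x ∈ M ↔ graphProj v (x - p) ∈ closure D ∧ graphFun p v u x = 0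

/-- The point of the graph of `u` over `y`. -/
noncomputable def graphPoint (p v : Ambient n) (u : graphBase v → ℝ) (y : graphBase v) :
    Ambient n := p + ((y : Ambient n) + u y • v)

theorem graphProj_graphPoint (p v : Ambient n) (u : graphBase v → ℝ) (y : graphBase v) :
    graphProj v (graphPoint p v u y - p) = y := by
  rw [graphPoint, add_sub_cancel_left, map_add, map_smul, graphProj_self, smul_zero, add_zero]
  exact graphProj_coe y

theorem graphFun_graphPoint {v : Ambient n} (hv : ‖v‖ = 1) (p : Ambient n)
    (u : graphBase v → ℝ) (y : graphBase v) : graphFun p v u (graphPoint p v u y) = 0 := by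
  rw [graphFun, graphProj_graphPoint, graphPoint, add_sub_cancel_left, inner_add_right,
    inner_graphBase, inner_smul_right, real_inner_self_eq_norm_sq, hv]
  simp

theorem graphPoint_of_graphFun_eq_zero {v x : Ambient n} (hv : ‖v‖ = 1) {p : Ambient n}
    {u : graphBase v → ℝ} (h : graphFun p v u x = 0) :
    graphPoint p v u (graphProj v (x - p)) = x := by
  rw [graphFun, sub_eq_zero] at h
  rw [graphPoint, ← h, graphProj_add_smul hv, add_sub_cancel]

theorem tendsto_graphPoint {p v : Ambient n} {u : graphBase v → ℝ} (hu : ContinuousAt u 0)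
    (h0 : u 0 = 0) : Filter.Tendsto (graphPoint p v u) (𝓝 0) (𝓝 p) := by
  have h : ContinuousAt (graphPoint p v u) 0 :=
    continuousAt_const.add (continuous_subtype_val.continuousAt.add
      (hu.smul continuousAt_const))
  simpa [ContinuousAt, graphPoint, h0] using h

theorem tendsto_graphProj (p v : Ambient n) :
    Filter.Tendsto (fun x => graphProj v (x - p)) (𝓝 p) (𝓝 0) := by
  have : ContinuousAt (fun x => graphProj v (x - p)) p := by fun_prop
  simpa only [ContinuousAt, sub_self, map_zero] using this

/-- Graphs that are translators solve the curvature equation. -/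
theorem IsGraphNear.eventually_solvesAt {Γ : Set (Fin n → ℝ)} {γ : (Fin n → ℝ) → ℝ} {α : ℝ}
    (hγ : IsSpeedFunction Γ γ α) {M : Set (Ambient n)} {ν : Ambient n → Ambient n}
    (hM : IsTranslator Γ γ M ν) {C : Set (Fin n → ℝ)} (hC : C ⊆ {l | ∀ i, 0 ≤ l i})
    (hconv : ∀ q ∈ M, ∀ l, IsPrincipalCurvatures M ν q l → l ∈ C)
    {p v : Ambient n} (hv : ‖v‖ = 1) {u : graphBase v → ℝ} {D : Set (graphBase v)}
    (hg : IsGraphNear M p v u D) (hup : 0 < inner ℝ (graphGrad v (fderiv ℝ u 0)) (upward n)) :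
    ∀ᶠ y in 𝓝 0, y ∈ closure D →
      ∃ l ∈ C, SolvesAt Γ γ (graphMetric v) (graphTilt v (upward n)) u y l := by
  have hup' : ∀ᶠ y in 𝓝 0, 0 < inner ℝ (graphGrad v (fderiv ℝ u y)) (upward n) := by
    have h1 : ContinuousAt (fderiv ℝ u) 0 :=
      (hg.contDiffAt.fderiv_right (m := 0) (by norm_num)).continuousAt
    have h2 : ContinuousAt (fun y => graphGrad v (fderiv ℝ u y)) 0 :=
      (contDiff_graphGrad v).continuous.continuousAt.comp h1
    exact (h2.inner continuousAt_const).eventually (lt_mem_nhds hup)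
  have h1 : ∀ᶠ x in 𝓝 p, (x ∈ M → graphFun p v u x = 0) ∧
      ContDiffAt ℝ 2 u (graphProj v (x - p)) ∧
      0 < inner ℝ (graphGrad v (fderiv ℝ u (graphProj v (x - p)))) (upward n) := by
    filter_upwards [hg.mem_iff, (tendsto_graphProj p v).eventually
      (hg.contDiffAt.eventually (by simp)), (tendsto_graphProj p v).eventually hup']
      with x hx1 hx2 hx3
    exact ⟨fun h => (hx1.mp h).2, hx2, hx3⟩
  have h2 : ∀ᶠ x in 𝓝 p, x ∈ M →
      tangentSpaceAt M x = (ℝ ∙ graphGrad v (fderiv ℝ u (graphProj v (x - p))))ᗮ ∧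
      ν x = ‖graphGrad v (fderiv ℝ u (graphProj v (x - p)))‖⁻¹ •
        graphGrad v (fderiv ℝ u (graphProj v (x - p))) := by
    -- The tangent space at `x` depends on `M` near `x`, so the graph description is needed on a
    -- neighbourhood of each such `x`.
    filter_upwards [h1.eventually_nhds] with x hx hxM
    obtain ⟨-, hu, hpos⟩ := hx.self_of_nhds
    obtain ⟨l, hlΓ, hl, hleq⟩ := hM.equation x hxM
    have hT := tangentSpaceAt_eq_orthogonal hl
      (graphGrad_ne_zero hv (fderiv ℝ u (graphProj v (x - p))))
      (hasFDerivAt_graphFun (hu.differentiableAt (by simp))) hxM (hx.mono fun z hz => hz.1)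
    obtain ⟨hν1, hν2⟩ := hM.normal.2 x hxM
    refine ⟨hT, eq_smul_of_mem_orthogonal hν1 (by rwa [hT] at hν2) ?_ hpos⟩
    rw [← hleq]
    exact hγ.nonneg hlΓ
  have h3 : ∀ᶠ x in 𝓝 p, x ∈ M →
      ∃ l ∈ C, SolvesAt Γ γ (graphMetric v) (graphTilt v (upward n)) u
        (graphProj v (x - p)) l := by
    filter_upwards [h1, h2.eventually_nhds] with x hx1 hx2 hxM
    obtain ⟨-, hu, hpos⟩ := hx1
    obtain ⟨l, hlΓ, hl, hleq⟩ := hM.equation x hxM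
    obtain ⟨hT, hν⟩ := hx2.self_of_nhds hxM
    have hd := isDiag_of_isPrincipalCurvatures hv hl hxM hu hT
      (hx2.mono fun z hz hzM => (hz hzM).2)
    have heq : γ l = graphTilt v (upward n) (fderiv ℝ u (graphProj v (x - p))) := by
      rw [hleq, hν, real_inner_smul_left, graphTilt]
    have hlC := hconv x hxM l hl
    -- The normal has positive vertical component, so the speed is positive and `l` is not on the
    -- frontier of `Γ`.
    refine ⟨l, hlC, ⟨hγ.mem_of_pos hlΓ ?_, hC hlC⟩, hd, heq⟩
    rw [heq, graphTilt]
    exact mul_pos (inv_pos.mpr (one_pos.trans_le (one_le_norm_graphGrad hv _))) hpos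
  filter_upwards [(tendsto_graphPoint hg.contDiffAt.continuousAt hg.map_zero).eventually
    (h3.and hg.mem_iff)] with y hy hyD
  have hyM : graphPoint p v u y ∈ M :=
    hy.2.mpr ⟨by rwa [graphProj_graphPoint], graphFun_graphPoint hv p u y⟩
  simpa only [graphProj_graphPoint] using hy.1 hyM

/-- Two translators that are ordered graphs over the same domain, tangent at `p`, coincide near
`p`. -/
theorem eventually_mem_iff_of_isGraphNear {Γ : Set (Fin n → ℝ)} {γ : (Fin n → ℝ) → ℝ} {α : ℝ}
    (hγ : IsSpeedFunction Γ γ α) {M₁ M₂ : Set (Ambient n)} {ν₁ ν₂ : Ambient n → Ambient n}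
    (h₁ : IsTranslator Γ γ M₁ ν₁) (h₂ : IsTranslator Γ γ M₂ ν₂)
    (hconv₁ : IsStrictlyConvexHyp M₁ ν₁) (hconv₂ : IsConvexHyp M₂ ν₂)
    {p v : Ambient n} (hv : ‖v‖ = 1) {u₁ u₂ : graphBase v → ℝ} {D : Set (graphBase v)}
    (hg₁ : IsGraphNear M₁ p v u₁ D) (hg₂ : IsGraphNear M₂ p v u₂ D)
    (hup : 0 < inner ℝ (graphGrad v (fderiv ℝ u₁ 0)) (upward n))
    (hder : fderiv ℝ u₁ 0 = fderiv ℝ u₂ 0)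
    (hD : D = Set.univ ∨ ∃ a : graphBase v, a ≠ 0 ∧ D = {y | 0 < inner ℝ a y})
    (h0 : (0 : graphBase v) ∈ closure D)
    (hle : (∀ᶠ y in 𝓝 0, y ∈ closure D → u₁ y ≤ u₂ y) ∨
      ∀ᶠ y in 𝓝 0, y ∈ closure D → u₂ y ≤ u₁ y) :
    ∀ᶠ x in 𝓝 p, x ∈ M₁ ↔ x ∈ M₂ := by
  have hV : Module.finrank ℝ (graphBase v) = n :=
    finrank_graphBase (by simp) (norm_ne_zero_iff.mp (by rw [hv]; exact one_ne_zero))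
  have s₁ := hg₁.eventually_solvesAt hγ h₁ (C := positiveCone n) (fun l hl i => (hl i).le)
    hconv₁ hv hup
  have s₂ := hg₂.eventually_solvesAt hγ h₂ (C := closure (positiveCone n))
    (by rw [closure_positiveCone]) hconv₂ hv (by rwa [← hder])
  have heq0 : u₁ 0 = u₂ 0 := hg₁.map_zero.trans hg₂.map_zero.symm
  have key : ∀ᶠ y in 𝓝 0, y ∈ closure D → u₁ y = u₂ y := by
    rcases hle with hle | hle
    · refine eventually_eq_of_touching hγ hV (contDiff_graphMetric hv)
        (contDiff_graphTilt hv (upward n)) (norm_sq_le_graphMetric hv) hD hg₁.contDiffAt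
        hg₂.contDiffAt heq0 hder h0 hle ?_
      filter_upwards [s₁, s₂] with y hy₁ hy₂ hyD
      obtain ⟨l₁, hl₁, hs₁⟩ := hy₁ hyD
      obtain ⟨l₂, -, hs₂⟩ := hy₂ hyD
      exact ⟨l₁, l₂, hs₁, hs₂, Or.inl hl₁⟩
    · refine (eventually_eq_of_touching hγ hV (contDiff_graphMetric hv)
        (contDiff_graphTilt hv (upward n)) (norm_sq_le_graphMetric hv) hD hg₂.contDiffAt
        hg₁.contDiffAt heq0.symm hder.symm h0 hle ?_).mono fun y hy hyD => (hy hyD).symm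
      filter_upwards [s₁, s₂] with y hy₁ hy₂ hyD
      obtain ⟨l₁, hl₁, hs₁⟩ := hy₁ hyD
      obtain ⟨l₂, -, hs₂⟩ := hy₂ hyD
      exact ⟨l₂, l₁, hs₂, hs₁, Or.inr hl₁⟩
  filter_upwards [hg₁.mem_iff, hg₂.mem_iff, (tendsto_graphProj p v).eventually key]
    with x hx₁ hx₂ hx
  rw [hx₁, hx₂]
  refine and_congr_right fun hxD => ?_
  rw [graphFun, graphFun, hx hxD]

/-- If one graph lies at one side of a regular level set containing the other, then the graphs
are ordered. -/
theorem IsGraphNear.ordered {M₁ M₂ : Set (Ambient n)} {p v : Ambient n} (hv : ‖v‖ = 1)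
    {u₁ u₂ : graphBase v → ℝ} {D : Set (graphBase v)}
    (hg₁ : IsGraphNear M₁ p v u₁ D) (hg₂ : IsGraphNear M₂ p v u₂ D) {f : Ambient n → ℝ}
    (hf : ContDiffAt ℝ 1 f p) (hfv : fderiv ℝ f p v ≠ 0) (hf₂ : ∀ᶠ x in 𝓝 p, x ∈ M₂ → f x = 0)
    (hf₁ : ∀ᶠ x in 𝓝 p, x ∈ M₁ → 0 ≤ f x) :
    (∀ᶠ y in 𝓝 0, y ∈ closure D → u₁ y ≤ u₂ y) ∨
      ∀ᶠ y in 𝓝 0, y ∈ closure D → u₂ y ≤ u₁ y := by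
  have hcont : ContinuousAt (fun x => fderiv ℝ f x v) p :=
    (hf.fderiv_right (m := 0) (by norm_num)).continuousAt.clm_apply continuousAt_const
  -- Here `s` is the sign of the derivative of `f` along `v`. The points of the two graphs over `y`
  -- differ by a multiple of `v`; since `f` is nonnegative at the first and zero at the second, the
  -- mean value theorem determines the sign of `u₂ y - u₁ y`.
  have main : ∀ s : ℝ, 0 < s * fderiv ℝ f p v →
      ∀ᶠ y in 𝓝 0, y ∈ closure D → s * (u₂ y - u₁ y) ≤ 0 := by
    intro s hs
    have hev : ∀ᶠ x in 𝓝 p, DifferentiableAt ℝ f x ∧ 0 < s * fderiv ℝ f x v :=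
      ((hf.eventually (by simp)).mono fun x hx => hx.differentiableAt (by simp)).and
        ((hcont.const_mul s).eventually (lt_mem_nhds hs))
    obtain ⟨ρ, hρ, hball⟩ := Metric.eventually_nhds_iff_ball.mp hev
    have hb := Metric.ball_mem_nhds p hρ
    filter_upwards [(tendsto_graphPoint hg₁.contDiffAt.continuousAt hg₁.map_zero).eventually
        (hg₁.mem_iff.and (hf₁.and hb)),
      (tendsto_graphPoint hg₂.contDiffAt.continuousAt hg₂.map_zero).eventually
        (hg₂.mem_iff.and (hf₂.and hb))] with y ⟨a1, a2, a3⟩ ⟨b1, b2, b3⟩ hyD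
    have e1 := a2 (a1.mpr ⟨by rwa [graphProj_graphPoint], graphFun_graphPoint hv p u₁ y⟩)
    have e2 := b2 (b1.mpr ⟨by rwa [graphProj_graphPoint], graphFun_graphPoint hv p u₂ y⟩)
    obtain ⟨z, hz, hz'⟩ := domain_mvt (f := f) (f' := fun z => fderiv ℝ f z)
      (fun z hz => (hball z hz).1.hasFDerivAt.hasFDerivWithinAt) (convex_ball p ρ) a3 b3
    have hzb := (hball z ((convex_ball p ρ).segment_subset a3 b3 hz)).2
    have hsub : graphPoint p v u₂ y - graphPoint p v u₁ y = (u₂ y - u₁ y) • v := by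
      simp only [graphPoint]; module
    rw [hsub, map_smul, smul_eq_mul, e2] at hz'
    by_contra! hcon
    have := mul_pos hcon hzb
    have h2 : s * (u₂ y - u₁ y) * (s * fderiv ℝ f z v) =
        s ^ 2 * ((u₂ y - u₁ y) * fderiv ℝ f z v) := by ring
    rw [h2, ← hz'] at this
    nlinarith [sq_nonneg s]
  rcases hfv.lt_or_gt with h | h
  · refine Or.inl ((main (-1) (by linarith)).mono fun y hy hyD => ?_)
    linarith [hy hyD]
  · refine Or.inr ((main 1 (by linarith)).mono fun y hy hyD => ?_)
    linarith [hy hyD]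

end LocalCoincidence

/-! ### Graph representation near interior and boundary points. -/

section LocalTangency

set_option maxSynthPendingDepth 3

variable {n : ℕ}

theorem mem_tangentSpaceAt_iff {M : Set (Ambient n)} {ν : Ambient n → Ambient n}
    {p : Ambient n} {l : Fin n → ℝ} (hl : IsPrincipalCurvatures M ν p l) (hp : p ∈ M)
    {f : Ambient n → ℝ} (hf : DifferentiableAt ℝ f p) (hf0 : fderiv ℝ f p ≠ 0)
    (hM : ∀ᶠ x in 𝓝 p, x ∈ M → f x = 0) (w : Ambient n) :
    w ∈ tangentSpaceAt M p ↔ fderiv ℝ f p w = 0 := by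
  have hs : innerSL ℝ (sharp (Ambient n) (fderiv ℝ f p)) = fderiv ℝ f p :=
    ContinuousLinearMap.ext fun w => inner_sharp (fderiv ℝ f p) w
  have hg : sharp (Ambient n) (fderiv ℝ f p) ≠ 0 := fun h => hf0 (by rw [← hs, h, map_zero])
  rw [tangentSpaceAt_eq_orthogonal hl hg (by rw [hs]; exact hf.hasFDerivAt) hp hM,
    Submodule.mem_orthogonal_singleton_iff_inner_right, inner_sharp]

theorem IsInteriorPoint.mem {M : Set (Ambient n)} {p : Ambient n} (h : IsInteriorPoint M p) :
    p ∈ M := by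
  obtain ⟨U, f, -, hpU, -, hfp, -, hMU⟩ := h
  exact (hMU.symm.subset ⟨hpU, hfp⟩ : p ∈ M ∩ U).1

theorem IsBoundaryPoint.mem {M : Set (Ambient n)} {p : Ambient n} (h : IsBoundaryPoint M p) :
    p ∈ M := by
  obtain ⟨U, f, g, -, hpU, -, -, hfp, hgp, -, hMU⟩ := h
  exact (hMU.symm.subset ⟨hpU, hfp, hgp.ge⟩ : p ∈ M ∩ U).1

theorem IsInteriorPoint.exists_isGraphNear {M : Set (Ambient n)} {ν : Ambient n → Ambient n}
    {p v : Ambient n} {l : Fin n → ℝ} (h : IsInteriorPoint M p)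
    (hl : IsPrincipalCurvatures M ν p l) (hv : ‖v‖ = 1) (hvT : v ∉ tangentSpaceAt M p) :
    ∃ u, IsGraphNear M p v u Set.univ := by
  have hp := h.mem
  obtain ⟨U, f, hU, hpU, hf, hfp, hf0, hMU⟩ := h
  have hfp2 : ContDiffAt ℝ 2 f p := (hf.contDiffAt (hU.mem_nhds hpU)).of_le (by decide)
  have hM : ∀ᶠ x in 𝓝 p, x ∈ M ↔ f x = 0 := by
    filter_upwards [hU.mem_nhds hpU] with x hx
    have : x ∈ M ∩ U ↔ x ∈ {x ∈ U | f x = 0} := by rw [hMU]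
    simpa [hx] using this
  have hfv : fderiv ℝ f p v ≠ 0 := fun h0 => hvT ((mem_tangentSpaceAt_iff hl hp
    (hfp2.differentiableAt (by simp)) hf0 (hM.mono fun x hx => hx.mp) v).mpr h0)
  obtain ⟨u, hu, hu0, hev⟩ := exists_graph_of_regular hv hfp2 hfp hfv
  refine ⟨u, hu, hu0, ?_⟩
  filter_upwards [hM, hev] with x hx1 hx2
  simp [hx1, hx2, graphFun, sub_eq_zero]

theorem hasFDerivAt_graphPoint {p v : Ambient n} {u : graphBase v → ℝ}
    (hu : DifferentiableAt ℝ u 0) :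
    HasFDerivAt (graphPoint p v u)
      ((graphBase v).subtypeL + (fderiv ℝ u 0).smulRight v) 0 := by
  have h1 : HasFDerivAt (fun y => u y • v) ((fderiv ℝ u 0).smulRight v) 0 :=
    hu.hasFDerivAt.smul_const v
  exact (((graphBase v).subtypeL.hasFDerivAt).add h1).const_add p

theorem closure_setOf_inner_pos {V : Type*} [NormedAddCommGroup V] [InnerProductSpace ℝ V] {a : V}
    (ha : a ≠ 0) : closure {y : V | 0 < inner ℝ a y} = {y | 0 ≤ inner ℝ a y} := by
  apply subset_antisymm
  · exact closure_minimal (fun y (hy : 0 < inner ℝ a y) => hy.le)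
      (isClosed_le continuous_const (by fun_prop))
  · intro y hy
    have h1 : Filter.Tendsto (fun t : ℝ => y + t • a) (𝓝[>] 0) (𝓝 y) := by
      have : ContinuousAt (fun t : ℝ => y + t • a) 0 := by fun_prop
      simpa [ContinuousAt] using this.tendsto.mono_left nhdsWithin_le_nhds
    refine mem_closure_of_tendsto h1 ?_
    filter_upwards [self_mem_nhdsWithin] with t ht
    have ht' : (0 : ℝ) < t := ht
    have hy' : 0 ≤ inner ℝ a y := hy
    have : 0 < ‖a‖ := norm_pos_iff.mpr ha
    change 0 < inner ℝ a (y + t • a)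
    rw [inner_add_right, inner_smul_right, real_inner_self_eq_norm_sq]
    positivity

/-- A function positive somewhere and vanishing nowhere on a half ball is nonnegative on its
closure. -/
theorem nonneg_of_ne_zero_on_halfBall {V : Type*} [NormedAddCommGroup V] [InnerProductSpace ℝ V]
    {a : V} (ha : a ≠ 0) {ρ : ℝ} {G : V → ℝ} (hG : ContinuousOn G (Metric.ball 0 ρ))
    (hne : ∀ y ∈ Metric.ball (0 : V) ρ, 0 < inner ℝ a y → G y ≠ 0) {y₁ : V}
    (hy₁ : y₁ ∈ Metric.ball (0 : V) ρ) (hy₁a : 0 < inner ℝ a y₁) (hy₁G : 0 < G y₁)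
    {y : V} (hy : y ∈ Metric.ball (0 : V) ρ) (hya : 0 ≤ inner ℝ a y) : 0 ≤ G y := by
  set S := Metric.ball (0 : V) ρ ∩ {y | 0 < inner ℝ a y} with hS
  have hSc : IsPreconnected S := ((convex_ball 0 ρ).inter
    (convex_halfSpace_gt (f := fun y => inner ℝ a y) (innerₗ V a).isLinear 0)).isPreconnected
  have hpos : ∀ z ∈ S, 0 < G z := by
    intro z hz
    by_contra! hcon
    obtain ⟨x, hx, hx0⟩ := hSc.intermediate_value hz ⟨hy₁, hy₁a⟩
      (hG.mono Set.inter_subset_left) ⟨hcon, hy₁G.le⟩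
    exact hne x hx.1 hx.2 hx0
  have hyS : y ∈ closure S :=
    Metric.isOpen_ball.inter_closure ⟨hy, by rw [closure_setOf_inner_pos ha]; exact hya⟩
  have := mem_closure_iff_nhdsWithin_neBot.mp hyS
  refine ge_of_tendsto ((hG.continuousAt (Metric.isOpen_ball.mem_nhds hy)).continuousWithinAt
    (s := S)) ?_
  filter_upwards [self_mem_nhdsWithin] with z hz
  exact (hpos z hz).le

/-- The vector `a`, orthogonal to `v`, as an element of the graph base. -/
def graphBaseOf {a v : Ambient n} (hav : inner ℝ v a = 0) : graphBase v :=
  ⟨a, Submodule.mem_orthogonal_singleton_iff_inner_right.mpr hav⟩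

theorem inner_graphBaseOf {a v : Ambient n} (hav : inner ℝ v a = 0) (w : Ambient n) :
    inner ℝ (graphBaseOf hav) (graphProj v w) = inner ℝ a w :=
  Submodule.inner_orthogonalProjectionOnto_eq_of_mem_left _ _

/-- The domain of the graph is `{G ≥ 0}`, where `G` is `g` composed with the graph map, and it has
to be identified with a half-space. Since `v` is orthogonal to `a`, the height of a graph point over
the hyperplane is linear in `y`. Zeros of `G` near the origin give boundary points, hence lie on the
hyperplane, and `{G ≥ 0}` lies in the half-space. So `G` has no zero in the open half ball, which is
connected, and it is positive somewhere there because its derivative at the origin is nonzero. -/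
theorem IsBoundaryPoint.exists_isGraphNear {M : Set (Ambient n)} {ν : Ambient n → Ambient n}
    {p v a : Ambient n} {b : ℝ} {l : Fin n → ℝ} (h : IsBoundaryPoint M p)
    (hl : IsPrincipalCurvatures M ν p l) (hv : ‖v‖ = 1) (hvT : v ∉ tangentSpaceAt M p)
    (ha : a ≠ 0) (hav : inner ℝ v a = 0) (hbd : hypBoundary M ⊆ affineHyperplane a b)
    (hhalf : ∀ᶠ x in 𝓝 p, x ∈ M → b ≤ inner ℝ a x) :
    ∃ u, IsGraphNear M p v u {y | 0 < inner ℝ (graphBaseOf hav) y} := by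
  have hp := h.mem
  have hpb : inner ℝ a p = b := hbd h
  obtain ⟨U, f, g, hU, hpU, hf, hg, hfp, hgp, hli, hMU⟩ := h
  have hfp2 : ContDiffAt ℝ 2 f p := (hf.contDiffAt (hU.mem_nhds hpU)).of_le (by decide)
  have hgp2 : ContDiffAt ℝ 2 g p := (hg.contDiffAt (hU.mem_nhds hpU)).of_le (by decide)
  have hM : ∀ x ∈ U, x ∈ M ↔ f x = 0 ∧ 0 ≤ g x := by
    intro x hx
    have : x ∈ M ∩ U ↔ x ∈ {x ∈ U | f x = 0 ∧ 0 ≤ g x} := by rw [hMU]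
    simpa [hx] using this
  have hf0 : fderiv ℝ f p ≠ 0 := hli.ne_zero 0
  have hMf : ∀ᶠ x in 𝓝 p, x ∈ M → f x = 0 := by
    filter_upwards [hU.mem_nhds hpU] with x hx hxM
    exact ((hM x hx).mp hxM).1
  have hfv : fderiv ℝ f p v ≠ 0 := fun h0 => hvT ((mem_tangentSpaceAt_iff hl hp
    (hfp2.differentiableAt (by simp)) hf0 hMf v).mpr h0)
  obtain ⟨u, hu, hu0, hev⟩ := exists_graph_of_regular hv hfp2 hfp hfv
  have hev' : ∀ᶠ x in 𝓝 p, f x = 0 ↔ graphFun p v u x = 0 := by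
    simpa only [graphFun, sub_eq_zero] using hev
  have hX := tendsto_graphPoint (p := p) hu.continuousAt hu0
  have hX0 : graphPoint p v u 0 = p := by simp [graphPoint, hu0]
  set a' := graphBaseOf hav with ha'
  have ha'0 : a' ≠ 0 := fun h0 => ha (congrArg Subtype.val h0)
  have hinner : ∀ y, inner ℝ a' y = inner ℝ a (graphPoint p v u y) - b := by
    intro y
    rw [← graphProj_graphPoint p v u y, inner_graphBaseOf, graphProj_graphPoint, inner_sub_right,
      hpb]
  set G : graphBase v → ℝ := fun y => g (graphPoint p v u y) with hG
  have hXf : ∀ᶠ y in 𝓝 0, f (graphPoint p v u y) = 0 := by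
    filter_upwards [hX.eventually hev'] with y hy
    exact hy.mpr (graphFun_graphPoint hv p u y)
  have hXd := hasFDerivAt_graphPoint (p := p) (hu.differentiableAt (by simp))
  set X' := (graphBase v).subtypeL + (fderiv ℝ u 0).smulRight v with hX'
  have hGd : HasFDerivAt G ((fderiv ℝ g p).comp X') 0 := by
    refine HasFDerivAt.comp (g := g) (0 : graphBase v) ?_ hXd
    rw [hX0]
    exact (hgp2.differentiableAt (by simp)).hasFDerivAt
  have hFd : (fderiv ℝ f p).comp X' = 0 := by
    have h1 : HasFDerivAt (fun y => f (graphPoint p v u y)) ((fderiv ℝ f p).comp X') 0 := by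
      refine HasFDerivAt.comp (g := f) (0 : graphBase v) ?_ hXd
      rw [hX0]
      exact (hfp2.differentiableAt (by simp)).hasFDerivAt
    have h2 : HasFDerivAt (fun y => f (graphPoint p v u y)) (0 : graphBase v →L[ℝ] ℝ) 0 :=
      (hasFDerivAt_const (0 : ℝ) 0).congr_of_eventuallyEq hXf
    exact h1.unique h2
  -- The graph map's derivative and `v` together span the ambient space. If `dg` vanished on tangent
  -- vectors, as `df` does, the two would be linearly dependent.
  have hGne : (fderiv ℝ g p).comp X' ≠ 0 := by
    intro h0
    have hrel : fderiv ℝ g p v • fderiv ℝ f p + (-fderiv ℝ f p v) • fderiv ℝ g p = 0 := by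
      ext w
      have hw : w = X' (graphProj v w) + (inner ℝ v w - fderiv ℝ u 0 (graphProj v w)) • v := by
        have h1 := graphProj_add_smul hv w
        have h2 : X' (graphProj v w) =
            (graphProj v w : Ambient n) + fderiv ℝ u 0 (graphProj v w) • v := rfl
        rw [h2]
        conv_lhs => rw [← h1]
        module
      have e1 : fderiv ℝ f p (X' (graphProj v w)) = 0 := congrArg (fun L => L (graphProj v w)) hFd
      have e2 : fderiv ℝ g p (X' (graphProj v w)) = 0 := congrArg (fun L => L (graphProj v w)) h0
      rw [hw]
      simp only [add_apply, smul_apply, map_add, map_smul, smul_eq_mul, e1, e2, zero_apply]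
      ring
    have := (LinearIndependent.pair_iff.mp hli) _ _ hrel
    exact hfv (by simpa using this.2)
  have hlin : ∀ᶠ x in 𝓝 p, LinearIndependent ℝ ![fderiv ℝ f x, fderiv ℝ g x] := by
    have hc : ContinuousAt (fun x => ![fderiv ℝ f x, fderiv ℝ g x]) p := by
      refine continuousAt_pi.mpr fun i => ?_
      fin_cases i
      · exact (hfp2.fderiv_right (m := 0) (by norm_num)).continuousAt
      · exact (hgp2.fderiv_right (m := 0) (by norm_num)).continuousAt
    exact hc.eventually (isOpen_setOfPred_linearIndependent.mem_nhds hli)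
  obtain ⟨ρ, hρ, hball⟩ := Metric.eventually_nhds_iff_ball.mp
    (hXf.and ((hX.eventually (hhalf.and (hlin.and (hU.mem_nhds hpU)))).and
      (hu.eventually (by simp))))
  have hG0 : ∀ y ∈ Metric.ball (0 : graphBase v) ρ, G y = 0 → inner ℝ a' y = 0 := by
    intro y hy hGy
    obtain ⟨hyf, ⟨-, hyl, hyU⟩, -⟩ := hball y hy
    have : graphPoint p v u y ∈ hypBoundary M :=
      ⟨U, f, g, hU, hyU, hf, hg, hyf, hGy, hyl, hMU⟩
    rw [hinner, sub_eq_zero]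
    exact hbd this
  have hGnn : ∀ y ∈ Metric.ball (0 : graphBase v) ρ, 0 ≤ G y → 0 ≤ inner ℝ a' y := by
    intro y hy hGy
    obtain ⟨hyf, ⟨hyh, -, hyU⟩, -⟩ := hball y hy
    rw [hinner, sub_nonneg]
    exact hyh ((hM _ hyU).mpr ⟨hyf, hGy⟩)
  have hGcont : ContinuousOn G (Metric.ball 0 ρ) := by
    intro y hy
    obtain ⟨-, ⟨-, -, hyU⟩, hyu⟩ := hball y hy
    have h1 : ContinuousAt (graphPoint p v u) y :=
      continuousAt_const.add (continuous_subtype_val.continuousAt.add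
        (hyu.continuousAt.smul continuousAt_const))
    exact (ContinuousAt.comp (g := g) ((hg.contDiffAt (hU.mem_nhds hyU)).continuousAt)
      h1).continuousWithinAt
  have hGp0 : G 0 = 0 := by simp only [hG, hX0, hgp]
  have hray : ∀ w, 0 < (fderiv ℝ g p).comp X' w → ∃ t > (0 : ℝ),
      t • w ∈ Metric.ball (0 : graphBase v) ρ ∧ 0 < G (t • w) := by
    intro w hw
    have hline : HasDerivAt (fun t : ℝ => t • w) w 0 := by
      simpa using (hasDerivAt_id (0 : ℝ)).smul_const w
    have hGl : HasDerivAt (fun t : ℝ => G (t • w)) ((fderiv ℝ g p).comp X' w) 0 := by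
      refine HasFDerivAt.comp_hasDerivAt (0 : ℝ) (l := G) ?_ hline
      simpa using hGd
    have h1 : ∀ᶠ t in 𝓝[>] (0 : ℝ), 0 < slope (fun t : ℝ => G (t • w)) 0 t := by
      have hs := hGl.hasDerivWithinAt (s := Set.Ioi 0)
      rw [hasDerivWithinAt_iff_tendsto_slope' (by simp)] at hs
      exact hs.eventually (lt_mem_nhds hw)
    have h2 : ∀ᶠ t in 𝓝[>] (0 : ℝ), t • w ∈ Metric.ball (0 : graphBase v) ρ := by
      have := hline.continuousAt.tendsto
      simp only [zero_smul] at this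
      exact nhdsWithin_le_nhds (this.eventually (Metric.ball_mem_nhds _ hρ))
    obtain ⟨t, ht1, ht2, ht3⟩ := (h1.and (h2.and self_mem_nhdsWithin)).exists
    refine ⟨t, ht3, ht2, ?_⟩
    have ht0 : (0 : ℝ) < t := ht3
    simp only [slope_def_field, zero_smul, hGp0, sub_zero] at ht1
    exact (div_pos_iff_of_pos_right ht0).mp ht1
  obtain ⟨w, hw⟩ : ∃ w, 0 < (fderiv ℝ g p).comp X' w := by
    obtain ⟨w, hw⟩ : ∃ w, (fderiv ℝ g p).comp X' w ≠ 0 := by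
      by_contra! hcon
      exact hGne (ContinuousLinearMap.ext hcon)
    rcases hw.lt_or_gt with h | h
    · exact ⟨-w, by rw [map_neg]; linarith⟩
    · exact ⟨w, h⟩
  -- Otherwise tilting `w` slightly by `-a'` gives a direction leaving the half-space in which `G`
  -- still becomes positive.
  have hwa : 0 < inner ℝ a' w := by
    by_contra! hcon
    obtain ⟨η, hη, hηw⟩ : ∃ η > (0 : ℝ), 0 < (fderiv ℝ g p).comp X' (w - η • a') := by
      have hc : ContinuousAt (fun η : ℝ => (fderiv ℝ g p).comp X' (w - η • a')) 0 := by fun_prop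
      have h1 : ∀ᶠ η in 𝓝[>] (0 : ℝ), 0 < (fderiv ℝ g p).comp X' (w - η • a') :=
        nhdsWithin_le_nhds (hc.eventually (lt_mem_nhds (by simpa using hw)))
      obtain ⟨η, h2, h3⟩ := (h1.and self_mem_nhdsWithin).exists
      exact ⟨η, h3, h2⟩
    obtain ⟨t, ht, htb, htG⟩ := hray _ hηw
    have h1 := hGnn _ htb htG.le
    rw [inner_smul_right, inner_sub_right, inner_smul_right, real_inner_self_eq_norm_sq] at h1
    have h2 : 0 < ‖a'‖ := norm_pos_iff.mpr ha'0
    have h3 : 0 < η * ‖a'‖ ^ 2 := by positivity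
    have h4 := nonneg_of_mul_nonneg_right h1 ht
    linarith
  obtain ⟨t, ht, htb, htG⟩ := hray w hw
  have hfinal : ∀ y ∈ Metric.ball (0 : graphBase v) ρ, 0 ≤ inner ℝ a' y → 0 ≤ G y := by
    intro y hy hya
    refine nonneg_of_ne_zero_on_halfBall ha'0 hGcont (fun z hz hza hz0 => ?_) htb ?_ htG hy hya
    · exact hza.ne' (hG0 z hz hz0)
    · rw [inner_smul_right]; exact mul_pos ht hwa
  refine ⟨u, hu, hu0, ?_⟩
  filter_upwards [hU.mem_nhds hpU, hev', (tendsto_graphProj p v).eventually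
    (Metric.ball_mem_nhds _ hρ)] with x hxU hx1 hx2
  rw [hM x hxU, closure_setOf_inner_pos ha'0, and_comm, hx1]
  refine and_congr_left fun hx0 => ?_
  have hGx : G (graphProj v (x - p)) = g x := by
    simp only [hG, graphPoint_of_graphFun_eq_zero hv hx0]
  rw [← hGx]
  exact ⟨hGnn _ hx2, hfinal _ hx2⟩

end LocalTangency

/-! ### The local tangency principles. -/

section TangencyPrinciples

set_option maxSynthPendingDepth 3

variable {n : ℕ}

/-- The graph gradient is normal to the hypersurface and has `v`-component 1. The tangent space
therefore determines it, and with it the slope. -/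
theorem fderiv_eq_of_tangentSpaceAt_eq {M₁ M₂ : Set (Ambient n)} {ν₁ ν₂ : Ambient n → Ambient n}
    {p v : Ambient n} {l₁ l₂ : Fin n → ℝ} (hv : ‖v‖ = 1) {u₁ u₂ : graphBase v → ℝ}
    {D : Set (graphBase v)} (hg₁ : IsGraphNear M₁ p v u₁ D) (hg₂ : IsGraphNear M₂ p v u₂ D)
    (hl₁ : IsPrincipalCurvatures M₁ ν₁ p l₁) (hl₂ : IsPrincipalCurvatures M₂ ν₂ p l₂)
    (hp₁ : p ∈ M₁) (hp₂ : p ∈ M₂) (hνT : ν₁ p ∈ (tangentSpaceAt M₁ p)ᗮ)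
    (hT : tangentSpaceAt M₁ p = tangentSpaceAt M₂ p) (hνv : 0 < inner ℝ (ν₁ p) v) :
    fderiv ℝ u₁ 0 = fderiv ℝ u₂ 0 ∧ ∃ c > (0 : ℝ), graphGrad v (fderiv ℝ u₁ 0) = c • ν₁ p := by
  have key : ∀ {M : Set (Ambient n)} {ν : Ambient n → Ambient n} {l : Fin n → ℝ}
      {u : graphBase v → ℝ}, IsGraphNear M p v u D → IsPrincipalCurvatures M ν p l → p ∈ M →
      tangentSpaceAt M p = tangentSpaceAt M₁ p →
      graphGrad v (fderiv ℝ u 0) = (inner ℝ (ν₁ p) v)⁻¹ • ν₁ p := by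
    intro M ν l u hg hl hp hTM
    have h0 : graphProj v (p - p) = 0 := by simp
    have hd := hasFDerivAt_graphFun (p := p) (v := v) (x := p) (u := u)
      (by rw [h0]; exact hg.contDiffAt.differentiableAt (by simp))
    have hTg := tangentSpaceAt_eq_orthogonal hl (graphGrad_ne_zero hv _) hd hp
      (hg.mem_iff.mono fun x hx hxM => (hx.mp hxM).2)
    rw [h0] at hTg
    have hν' := hνT
    rw [← hTM, hTg, Submodule.orthogonal_orthogonal, Submodule.mem_span_singleton] at hν'
    obtain ⟨c, hc⟩ := hν'
    have hcv : inner ℝ (ν₁ p) v = c := by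
      rw [← hc, real_inner_smul_left, inner_graphGrad_self hv, mul_one]
    rw [hcv] at hνv ⊢
    rw [← hc, smul_smul, inv_mul_cancel₀ hνv.ne', one_smul]
  refine ⟨graphGrad_injective v ?_, _, inv_pos.mpr hνv, key hg₁ hl₁ hp₁ rfl⟩
  rw [key hg₁ hl₁ hp₁ rfl, key hg₂ hl₂ hp₂ hT.symm]

/-- Local form of the tangency principles, for hypersurfaces written as graphs over a common
domain. -/
theorem eventually_mem_iff_of_tangent {Γ : Set (Fin n → ℝ)} {γ : (Fin n → ℝ) → ℝ} {α : ℝ}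
    (hγ : IsSpeedFunction Γ γ α) {M₁ M₂ : Set (Ambient n)} {ν₁ ν₂ : Ambient n → Ambient n}
    (h₁ : IsTranslator Γ γ M₁ ν₁) (h₂ : IsTranslator Γ γ M₂ ν₂)
    (hconv₁ : IsStrictlyConvexHyp M₁ ν₁) (hconv₂ : IsConvexHyp M₂ ν₂)
    (hside : LiesAtOneSide M₁ M₂) {p v : Ambient n} (hp₁ : p ∈ M₁) (hp₂ : p ∈ M₂)
    (hT : tangentSpaceAt M₁ p = tangentSpaceAt M₂ p) (hv : ‖v‖ = 1)
    (hνv : 0 < inner ℝ (ν₁ p) v) {u₁ u₂ : graphBase v → ℝ} {D : Set (graphBase v)}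
    (hg₁ : IsGraphNear M₁ p v u₁ D) (hg₂ : IsGraphNear M₂ p v u₂ D)
    (hD : D = Set.univ ∨ ∃ a : graphBase v, a ≠ 0 ∧ D = {y | 0 < inner ℝ a y}) :
    ∀ᶠ x in 𝓝 p, x ∈ M₁ ↔ x ∈ M₂ := by
  obtain ⟨l₁, -, hl₁, hleq₁⟩ := h₁.equation p hp₁
  obtain ⟨l₂, -, hl₂, -⟩ := h₂.equation p hp₂
  obtain ⟨hν, hνT⟩ := h₁.normal.2 p hp₁
  obtain ⟨hder, c, hc, hgrad⟩ := fderiv_eq_of_tangentSpaceAt_eq hv hg₁ hg₂ hl₁ hl₂ hp₁ hp₂ hνT hT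
    hνv
  have hνe : 0 < inner ℝ (ν₁ p) (upward n) := by
    rw [← hleq₁]
    exact hγ.pos l₁ (hγ.positiveCone_subset (hconv₁ p hp₁ l₁ hl₁))
  have hup : 0 < inner ℝ (graphGrad v (fderiv ℝ u₁ 0)) (upward n) := by
    rw [hgrad, real_inner_smul_left]
    exact mul_pos hc hνe
  have h0 : (0 : graphBase v) ∈ closure D := by
    simpa using (hg₁.mem_iff.self_of_nhds.mp hp₁).1
  obtain ⟨U, f, hU, hpU, hf, hf0, hf₂, hf₁⟩ := hside p ⟨hp₁, hp₂⟩
  have hfp : ContDiffAt ℝ 1 f p := (hf.contDiffAt (hU.mem_nhds hpU)).of_le (by decide)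
  have hfM₂ : ∀ᶠ x in 𝓝 p, x ∈ M₂ → f x = 0 := by
    filter_upwards [hU.mem_nhds hpU] with x hx hxM using hf₂ x ⟨hxM, hx⟩
  have hfM₁ : ∀ᶠ x in 𝓝 p, x ∈ M₁ → 0 ≤ f x := by
    filter_upwards [hU.mem_nhds hpU] with x hx hxM using hf₁ x ⟨hxM, hx⟩
  -- The kernel of `df` at `p` is the common tangent space, to which `v` is transversal.
  have hfv : fderiv ℝ f p v ≠ 0 := by
    intro h
    have hvT := (mem_tangentSpaceAt_iff hl₂ hp₂ (hfp.differentiableAt (by simp)) hf0 hfM₂ v).mpr h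
    rw [← hT] at hvT
    have := Submodule.inner_left_of_mem_orthogonal hvT hνT
    exact hνv.ne' this
  exact eventually_mem_iff_of_isGraphNear hγ h₁ h₂ hconv₁ hconv₂ hv hg₁ hg₂ hup hder hD h0
    (hg₁.ordered hv hg₂ hfp hfv hfM₂ hfM₁)

/-- At a common interior point, a hypersurface at one side of another is tangent to it. -/
theorem tangentSpaceAt_eq_of_liesAtOneSide {M₁ M₂ : Set (Ambient n)}
    {ν₁ ν₂ : Ambient n → Ambient n} {p : Ambient n} {l₁ l₂ : Fin n → ℝ}
    (hl₁ : IsPrincipalCurvatures M₁ ν₁ p l₁) (hl₂ : IsPrincipalCurvatures M₂ ν₂ p l₂)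
    (hp₁ : IsInteriorPoint M₁ p) (hp₂ : p ∈ M₂) (hside : LiesAtOneSide M₁ M₂) :
    tangentSpaceAt M₁ p = tangentSpaceAt M₂ p := by
  have hpM := hp₁.mem
  obtain ⟨U, f, hU, hpU, hf, hf0, hf₂, hf₁⟩ := hside p ⟨hpM, hp₂⟩
  obtain ⟨U', g, hU', hpU', hg, hgp, hg0, hMU⟩ := hp₁
  have hfp : ContDiffAt ℝ 1 f p := (hf.contDiffAt (hU.mem_nhds hpU)).of_le (by decide)
  have hgp1 : ContDiffAt ℝ 1 g p := (hg.contDiffAt (hU'.mem_nhds hpU')).of_le (by decide)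
  have hM : ∀ᶠ x in 𝓝 p, x ∈ M₁ ↔ g x = 0 := by
    filter_upwards [hU'.mem_nhds hpU'] with x hx
    have : x ∈ M₁ ∩ U' ↔ x ∈ {x ∈ U' | g x = 0} := by rw [hMU]
    simpa [hx] using this
  have hfM₂ : ∀ᶠ x in 𝓝 p, x ∈ M₂ → f x = 0 := by
    filter_upwards [hU.mem_nhds hpU] with x hx hxM using hf₂ x ⟨hxM, hx⟩
  have hfp0 : f p = 0 := hfM₂.self_of_nhds hp₂
  have hmin : IsLocalMinOn f {x | g x = g p} p := by
    refine eventually_nhdsWithin_iff.mpr ?_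
    filter_upwards [hM, hU.mem_nhds hpU] with x hx hxU hxg
    rw [hfp0]
    exact hf₁ x ⟨hx.mpr (hxg.trans hgp), hxU⟩
  -- Lagrange multipliers: `f` restricted to the level set `M₁` has a minimum at `p`, so `df` and
  -- `dg` are proportional there. Both are nonzero, hence their kernels agree.
  obtain ⟨s, t, hst, hrel⟩ := IsLocalExtrOn.exists_multipliers_of_hasStrictFDerivAt_1d
    (Or.inl hmin) (hgp1.hasStrictFDerivAt (by simp)) (hfp.hasStrictFDerivAt (by simp))
  have hs : s ≠ 0 := by
    rintro rfl
    have ht : t ≠ 0 := fun h => hst (by rw [h]; rfl)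
    rw [zero_smul, zero_add, smul_eq_zero] at hrel
    exact hrel.elim ht hf0
  have ht : t ≠ 0 := by
    rintro rfl
    rw [zero_smul, add_zero, smul_eq_zero] at hrel
    exact hrel.elim hs hg0
  ext w
  rw [mem_tangentSpaceAt_iff hl₁ hpM (hgp1.differentiableAt (by simp)) hg0
      (hM.mono fun x hx => hx.mp),
    mem_tangentSpaceAt_iff hl₂ hp₂ (hfp.differentiableAt (by simp)) hf0 hfM₂]
  have hw : s * fderiv ℝ g p w + t * fderiv ℝ f p w = 0 := congrArg (fun L => L w) hrel
  constructor
  · intro h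
    rw [h, mul_zero, zero_add] at hw
    exact (mul_eq_zero.mp hw).resolve_left ht
  · intro h
    rw [h, mul_zero, add_zero] at hw
    exact (mul_eq_zero.mp hw).resolve_left hs

theorem notMem_of_mem_orthogonal {E : Type*} [NormedAddCommGroup E] [InnerProductSpace ℝ E]
    {T : Submodule ℝ E} {ν v : E} (hν : ν ∈ Tᗮ) (h : 0 < inner ℝ ν v) : v ∉ T := fun hv =>
  h.ne' (Submodule.inner_left_of_mem_orthogonal hv hν)

/-- Local interior tangency principle. -/
theorem eventually_mem_iff_of_mem_hypInterior {Γ : Set (Fin n → ℝ)} {γ : (Fin n → ℝ) → ℝ}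
    {α : ℝ} (hγ : IsSpeedFunction Γ γ α) {M₁ M₂ : Set (Ambient n)}
    {ν₁ ν₂ : Ambient n → Ambient n}
    (h₁ : IsTranslator Γ γ M₁ ν₁) (h₂ : IsTranslator Γ γ M₂ ν₂)
    (hconv₁ : IsStrictlyConvexHyp M₁ ν₁) (hconv₂ : IsConvexHyp M₂ ν₂)
    (hside : LiesAtOneSide M₁ M₂) {p : Ambient n} (hp₁ : p ∈ hypInterior M₁)
    (hp₂ : p ∈ hypInterior M₂) : ∀ᶠ x in 𝓝 p, x ∈ M₁ ↔ x ∈ M₂ := by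
  have hpM₁ : p ∈ M₁ := IsInteriorPoint.mem hp₁
  have hpM₂ : p ∈ M₂ := IsInteriorPoint.mem hp₂
  obtain ⟨l₁, -, hl₁, -⟩ := h₁.equation p hpM₁
  obtain ⟨l₂, -, hl₂, -⟩ := h₂.equation p hpM₂
  obtain ⟨hν, hνT⟩ := h₁.normal.2 p hpM₁
  have hT := tangentSpaceAt_eq_of_liesAtOneSide hl₁ hl₂ hp₁ hpM₂ hside
  have hνv : 0 < inner ℝ (ν₁ p) (ν₁ p) := by
    rw [real_inner_self_eq_norm_sq, hν]; norm_num
  have hvT := notMem_of_mem_orthogonal hνT hνv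
  obtain ⟨u₁, hg₁⟩ := IsInteriorPoint.exists_isGraphNear hp₁ hl₁ hν hvT
  obtain ⟨u₂, hg₂⟩ := IsInteriorPoint.exists_isGraphNear hp₂ hl₂ hν (by rwa [← hT])
  exact eventually_mem_iff_of_tangent hγ h₁ h₂ hconv₁ hconv₂ hside hpM₁ hpM₂ hT hν hνv hg₁ hg₂
    (Or.inl rfl)

/-- Project `ν` to the orthogonal complement of `a` and normalize. The projection could vanish only
for `ν` parallel to `a`, which transversality excludes. -/
theorem exists_unit_orthogonal {E : Type*} [NormedAddCommGroup E] [InnerProductSpace ℝ E]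
    {T : Submodule ℝ E} {ν a : E} (ha : a ≠ 0) (hν : ‖ν‖ = 1) (hνT : ν ∈ Tᗮ)
    (hT : ∃ w ∈ T, inner ℝ a w ≠ 0) :
    ∃ v : E, ‖v‖ = 1 ∧ inner ℝ v a = 0 ∧ 0 < inner ℝ ν v := by
  obtain ⟨w, hw, haw⟩ := hT
  set v := ν - (inner ℝ a ν / ‖a‖ ^ 2) • a with hv
  have ha0 : 0 < ‖a‖ := norm_pos_iff.mpr ha
  have hva : inner ℝ v a = 0 := by
    rw [hv, inner_sub_left, real_inner_smul_left, real_inner_self_eq_norm_sq, real_inner_comm a ν]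
    field_simp
    ring
  have hv0 : v ≠ 0 := by
    intro h0
    have hνa : ν = (inner ℝ a ν / ‖a‖ ^ 2) • a := sub_eq_zero.mp h0
    have h1 : inner ℝ ν w = 0 := Submodule.inner_left_of_mem_orthogonal hw hνT
    rw [hνa, real_inner_smul_left] at h1
    rw [(mul_eq_zero.mp h1).resolve_right haw, zero_smul] at hνa
    rw [hνa, norm_zero] at hν
    exact zero_ne_one hν
  have hvn : 0 < ‖v‖ := norm_pos_iff.mpr hv0
  have hνv : inner ℝ ν v = ‖v‖ ^ 2 := by
    have : ν = v + (inner ℝ a ν / ‖a‖ ^ 2) • a := by rw [hv]; abel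
    conv_lhs => rw [this]
    rw [inner_add_left, real_inner_smul_left, real_inner_comm v a, hva, real_inner_self_eq_norm_sq]
    ring
  refine ⟨‖v‖⁻¹ • v, ?_, ?_, ?_⟩
  · rw [norm_smul, norm_inv, norm_norm, inv_mul_cancel₀ hvn.ne']
  · rw [real_inner_smul_left, hva, mul_zero]
  · rw [real_inner_smul_right, hνv]
    positivity

/-- Local boundary tangency principle. -/
theorem eventually_mem_iff_of_mem_hypBoundary {Γ : Set (Fin n → ℝ)} {γ : (Fin n → ℝ) → ℝ}
    {α : ℝ} (hγ : IsSpeedFunction Γ γ α) {M₁ M₂ : Set (Ambient n)}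
    {ν₁ ν₂ : Ambient n → Ambient n}
    (h₁ : IsTranslator Γ γ M₁ ν₁) (h₂ : IsTranslator Γ γ M₂ ν₂)
    (hconv₁ : IsStrictlyConvexHyp M₁ ν₁) (hconv₂ : IsConvexHyp M₂ ν₂)
    (hside : LiesAtOneSide M₁ M₂) {a : Ambient n} {b : ℝ} (ha : a ≠ 0)
    (hbd₁ : hypBoundary M₁ ⊆ affineHyperplane a b) (hbd₂ : hypBoundary M₂ ⊆ affineHyperplane a b)
    (htr : IsTransversalTo M₁ a b) {p : Ambient n} (hp₁ : p ∈ hypBoundary M₁)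
    (hp₂ : p ∈ hypBoundary M₂) (hhalf : ∀ᶠ x in 𝓝 p, x ∈ M₁ ∪ M₂ → b ≤ inner ℝ a x)
    (hT : tangentSpaceAt M₁ p = tangentSpaceAt M₂ p) : ∀ᶠ x in 𝓝 p, x ∈ M₁ ↔ x ∈ M₂ := by
  have hpM₁ : p ∈ M₁ := IsBoundaryPoint.mem hp₁
  have hpM₂ : p ∈ M₂ := IsBoundaryPoint.mem hp₂
  obtain ⟨l₁, -, hl₁, -⟩ := h₁.equation p hpM₁
  obtain ⟨l₂, -, hl₂, -⟩ := h₂.equation p hpM₂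
  obtain ⟨hν, hνT⟩ := h₁.normal.2 p hpM₁
  obtain ⟨v, hv, hva, hνv⟩ := exists_unit_orthogonal ha hν hνT (htr p ⟨hpM₁, hbd₁ hp₁⟩)
  have hvT := notMem_of_mem_orthogonal hνT hνv
  obtain ⟨u₁, hg₁⟩ := IsBoundaryPoint.exists_isGraphNear hp₁ hl₁ hv hvT ha hva hbd₁
    (hhalf.mono fun x hx hxM => hx (Or.inl hxM))
  obtain ⟨u₂, hg₂⟩ := IsBoundaryPoint.exists_isGraphNear hp₂ hl₂ hv (by rwa [← hT]) ha hva hbd₂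
    (hhalf.mono fun x hx hxM => hx (Or.inr hxM))
  exact eventually_mem_iff_of_tangent hγ h₁ h₂ hconv₁ hconv₂ hside hpM₁ hpM₂ hT hv hνv hg₁ hg₂
    (Or.inr ⟨graphBaseOf hva, fun h0 => ha (congrArg Subtype.val h0), rfl⟩)

end TangencyPrinciples

/-! ### Local structure of hypersurfaces with boundary. -/

section LocalStructure

set_option maxSynthPendingDepth 3

variable {n : ℕ}

/-- `Φ` straightens `M` near `q`: it maps `M` to the closed convex set `C`, and its inverse maps
the convex set `C'` to interior points. -/
structure IsStraightening (M : Set (Ambient n)) (q : Ambient n) (Φ : Ambient n → Ambient n)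
    (C C' : Set (Ambient n)) : Prop where
  hasStrictFDerivAt : HasStrictFDerivAt Φ
    ((ContinuousLinearEquiv.refl ℝ (Ambient n) : Ambient n ≃L[ℝ] Ambient n) :
      Ambient n →L[ℝ] Ambient n) q
  map_self : Φ q = 0
  isClosed : IsClosed C
  convex : Convex ℝ C
  convex' : Convex ℝ C'
  zero_mem : (0 : Ambient n) ∈ C
  subset_closure : C ⊆ closure C'
  mem_iff : ∀ᶠ x in 𝓝 q, x ∈ M ↔ Φ x ∈ C
  mem_interior : ∀ᶠ x in 𝓝 q, Φ x ∈ C' → x ∈ hypInterior M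

/-- Correcting `x - q` along a vector `w` with `L w = 1` gives a map with identity derivative at `q`
and with `L ∘ Φ = f`, so the level set becomes the kernel of `L`. -/
theorem IsInteriorPoint.exists_isStraightening {M : Set (Ambient n)} {q : Ambient n}
    (h : IsInteriorPoint M q) : ∃ Φ C C', IsStraightening M q Φ C C' := by
  obtain ⟨U, f, hU, hqU, hf, hfq, hf0, hMU⟩ := h
  have hfq1 : ContDiffAt ℝ 1 f q := (hf.contDiffAt (hU.mem_nhds hqU)).of_le (by decide)
  set L := fderiv ℝ f q with hL
  obtain ⟨w, hw⟩ : ∃ w, L w = 1 := by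
    obtain ⟨w, hw⟩ : ∃ w, L w ≠ 0 := by
      by_contra! hcon
      exact hf0 (ContinuousLinearMap.ext hcon)
    exact ⟨(L w)⁻¹ • w, by rw [map_smul, smul_eq_mul, inv_mul_cancel₀ hw]⟩
  have hM : ∀ x ∈ U, x ∈ M ↔ f x = 0 := by
    intro x hx
    have : x ∈ M ∩ U ↔ x ∈ {x ∈ U | f x = 0} := by rw [hMU]
    simpa [hx] using this
  set Φ : Ambient n → Ambient n := fun x => (x - q) + (f x - L (x - q)) • w with hΦ
  have hLΦ : ∀ x, L (Φ x) = f x := fun x => by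
    simp only [hΦ, map_add, map_smul, hw, smul_eq_mul]; ring
  refine ⟨Φ, {z | L z = 0}, {z | L z = 0}, ?_, ?_, ?_, ?_, ?_, ?_, subset_closure, ?_, ?_⟩
  · have h0 : HasStrictFDerivAt (fun x => x - q) (ContinuousLinearMap.id ℝ (Ambient n)) q :=
      (hasStrictFDerivAt_id q).sub_const q
    have h1 : HasStrictFDerivAt f L q := hfq1.hasStrictFDerivAt (by simp)
    have h2 := (h1.sub (L.hasStrictFDerivAt.comp q h0)).smul_const w
    refine (h0.add h2).congr_fderiv ?_
    ext x
    simp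
  · simp [hΦ, hfq]
  · exact isClosed_eq L.continuous continuous_const
  · exact convex_hyperplane L.toLinearMap.isLinear 0
  · exact convex_hyperplane L.toLinearMap.isLinear 0
  · simp
  · filter_upwards [hU.mem_nhds hqU] with x hx
    rw [hM x hx, ← hLΦ]
  · filter_upwards [hU.mem_nhds hqU,
      (hfq1.fderiv_right (m := 0) (by norm_num)).continuousAt.eventually_ne hf0]
      with x hx hx0 hxC
    exact ⟨U, f, hU, hx, hf, (hLΦ x).symm.trans hxC, hx0, hMU⟩

/-- The same correction along vectors dual to `df` and `dg` turns `f` and `g` into linear functions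
at once; `C'` is the open half of the half-space `C` of a linear hyperplane. -/
theorem IsBoundaryPoint.exists_isStraightening {M : Set (Ambient n)} {q : Ambient n}
    (h : IsBoundaryPoint M q) : ∃ Φ C C', IsStraightening M q Φ C C' := by
  obtain ⟨U, f, g, hU, hqU, hf, hg, hfq, hgq, hli, hMU⟩ := h
  have hfq1 : ContDiffAt ℝ 1 f q := (hf.contDiffAt (hU.mem_nhds hqU)).of_le (by decide)
  have hgq1 : ContDiffAt ℝ 1 g q := (hg.contDiffAt (hU.mem_nhds hqU)).of_le (by decide)
  have hf0 : fderiv ℝ f q ≠ 0 := hli.ne_zero 0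
  set L := fderiv ℝ f q with hL
  set L' := fderiv ℝ g q with hL'
  have hsurj : Function.Surjective (L.prod L') := by
    have h1 : (LinearMap.range (L.prod L' : Ambient n →ₗ[ℝ] ℝ × ℝ)) = ⊤ := by
      by_contra hne
      obtain ⟨ψ, hψ, hker⟩ := Submodule.exists_le_ker_of_lt_top _ (lt_top_iff_ne_top.mpr hne)
      have hψ' : ∀ s t : ℝ, ψ (s, t) = s * ψ (1, 0) + t * ψ (0, 1) := fun s t => by
        have : ((s, t) : ℝ × ℝ) = s • (1, 0) + t • (0, 1) := by simp
        rw [this, map_add, map_smul, map_smul, smul_eq_mul, smul_eq_mul]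
      have hrel : ψ (1, 0) • L + ψ (0, 1) • L' = 0 := by
        ext x
        have hx : ψ (L x, L' x) = 0 := hker ⟨x, rfl⟩
        rw [hψ'] at hx
        simp only [add_apply, smul_apply, smul_eq_mul, zero_apply]
        linarith
      obtain ⟨h1, h2⟩ := LinearIndependent.pair_iff.mp hli _ _ hrel
      exact hψ (LinearMap.ext fun z => by rw [hψ' z.1 z.2, h1, h2]; simp)
    exact LinearMap.range_eq_top.mp h1
  obtain ⟨w, hw⟩ := hsurj (1, 0)
  obtain ⟨w', hw'⟩ := hsurj (0, 1)
  simp only [ContinuousLinearMap.prod_apply, Prod.mk.injEq] at hw hw'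
  have hM : ∀ x ∈ U, x ∈ M ↔ f x = 0 ∧ 0 ≤ g x := by
    intro x hx
    have : x ∈ M ∩ U ↔ x ∈ {x ∈ U | f x = 0 ∧ 0 ≤ g x} := by rw [hMU]
    simpa [hx] using this
  set Φ : Ambient n → Ambient n := fun x =>
    (x - q) + ((f x - L (x - q)) • w + (g x - L' (x - q)) • w') with hΦ
  have hLΦ : ∀ x, L (Φ x) = f x := fun x => by
    simp only [hΦ, map_add, map_smul, hw.1, hw'.1, smul_eq_mul]; ring
  have hLΦ' : ∀ x, L' (Φ x) = g x := fun x => by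
    simp only [hΦ, map_add, map_smul, hw.2, hw'.2, smul_eq_mul]; ring
  have hcL : Convex ℝ {z : Ambient n | L z = 0} := convex_hyperplane L.toLinearMap.isLinear 0
  refine ⟨Φ, {z | L z = 0} ∩ {z | 0 ≤ L' z}, {z | L z = 0} ∩ {z | 0 < L' z}, ?_, ?_, ?_, ?_, ?_,
    ?_, ?_, ?_, ?_⟩
  · have h0 : HasStrictFDerivAt (fun x => x - q) (ContinuousLinearMap.id ℝ (Ambient n)) q :=
      (hasStrictFDerivAt_id q).sub_const q
    have h1 : HasStrictFDerivAt f L q := hfq1.hasStrictFDerivAt (by simp)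
    have h1' : HasStrictFDerivAt g L' q := hgq1.hasStrictFDerivAt (by simp)
    have h2 := (h1.sub (L.hasStrictFDerivAt.comp q h0)).smul_const w
    have h2' := (h1'.sub (L'.hasStrictFDerivAt.comp q h0)).smul_const w'
    refine (h0.add (h2.add h2')).congr_fderiv ?_
    ext x
    simp
  · simp [hΦ, hfq, hgq]
  · exact (isClosed_eq L.continuous continuous_const).inter
      (isClosed_le continuous_const L'.continuous)
  · exact hcL.inter (convex_halfSpace_ge L'.toLinearMap.isLinear 0)
  · exact hcL.inter (convex_halfSpace_gt L'.toLinearMap.isLinear 0)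
  · simp
  · rintro z ⟨hz, hz'⟩
    have h1 : Filter.Tendsto (fun t : ℝ => z + t • w') (𝓝[>] 0) (𝓝 z) := by
      have : ContinuousAt (fun t : ℝ => z + t • w') 0 := by fun_prop
      simpa [ContinuousAt] using this.tendsto.mono_left nhdsWithin_le_nhds
    refine mem_closure_of_tendsto h1 ?_
    filter_upwards [self_mem_nhdsWithin] with t ht
    have ht' : (0 : ℝ) < t := ht
    have hz0 : L z = 0 := hz
    have hz0' : 0 ≤ L' z := hz'
    refine ⟨?_, ?_⟩
    · change L (z + t • w') = 0
      rw [map_add, map_smul, hz0, hw'.1, smul_zero, add_zero]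
    · change 0 < L' (z + t • w')
      rw [map_add, map_smul, hw'.2, smul_eq_mul, mul_one]
      linarith
  · filter_upwards [hU.mem_nhds hqU] with x hx
    rw [hM x hx, ← hLΦ, ← hLΦ']
    rfl
  · filter_upwards [hU.mem_nhds hqU,
      (hfq1.fderiv_right (m := 0) (by norm_num)).continuousAt.eventually_ne hf0]
      with x hx hx0 hxC
    have hgx : 0 < g x := (hLΦ' x) ▸ hxC.2
    -- Where `g > 0` the boundary condition is automatic, and `M` is a plain level set.
    refine ⟨U ∩ g ⁻¹' Set.Ioi 0, f, hg.continuousOn.isOpen_inter_preimage hU isOpen_Ioi, ⟨hx, hgx⟩,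
      hf.mono Set.inter_subset_left, (hLΦ x).symm.trans hxC.1, hx0, ?_⟩
    ext z
    constructor
    · rintro ⟨hzM, hzU⟩
      exact ⟨hzU, ((hM z hzU.1).mp hzM).1⟩
    · rintro ⟨hzU, hz0⟩
      have hzg : 0 < g z := hzU.2
      exact ⟨(hM z hzU.1).mpr ⟨hz0, hzg.le⟩, hzU⟩

theorem IsEmbeddedHypersurface.exists_isStraightening {M : Set (Ambient n)}
    (hM : IsEmbeddedHypersurface M) {q : Ambient n} (hq : q ∈ M) :
    ∃ Φ C C', IsStraightening M q Φ C C' := by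
  rcases hM q hq with h | h
  · exact IsInteriorPoint.exists_isStraightening h
  · exact IsBoundaryPoint.exists_isStraightening h

/-- Embedded hypersurfaces are locally closed: near `q`, `M` is the preimage of a closed set under a
continuous map. -/
theorem IsEmbeddedHypersurface.eventually_mem_of_mem_closure {M : Set (Ambient n)}
    (hM : IsEmbeddedHypersurface M) {q : Ambient n} (hq : q ∈ M) :
    ∀ᶠ x in 𝓝 q, x ∈ closure M → x ∈ M := by
  obtain ⟨Φ, C, C', h⟩ := hM.exists_isStraightening hq
  obtain ⟨K, s, hs, hK⟩ := h.hasStrictFDerivAt.exists_lipschitzOnWith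
  filter_upwards [h.mem_iff.eventually_nhds, eventually_eventually_nhds.mpr hs] with x hx hxs hxM
  refine hx.self_of_nhds.mpr (h.isClosed.closure_subset ?_)
  have := mem_closure_iff_nhdsWithin_neBot.mp hxM
  have hc : ContinuousAt Φ x := hK.continuousOn.continuousAt hxs
  refine mem_closure_of_tendsto (hc.continuousWithinAt (s := M)) ?_
  exact eventually_nhdsWithin_iff.mpr (hx.mono fun y hy => hy.mp)

/-- Local structure of a hypersurface with boundary: near each point the interior part is
connected and dense, and points are joined to the base point by Lipschitz paths. -/
theorem IsEmbeddedHypersurface.exists_local_structure {M : Set (Ambient n)}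
    (hM : IsEmbeddedHypersurface M) {q : Ambient n} (hq : q ∈ M) {W : Set (Ambient n)}
    (hW : W ∈ 𝓝 q) :
    ∃ V ∈ 𝓝 q, ∃ D, D ⊆ hypInterior M ∩ W ∧ IsPreconnected D ∧ M ∩ V ⊆ closure D ∧
      ∀ s ∈ M ∩ V, ∃ (c : ℝ → Ambient n) (K : NNReal), LipschitzOnWith K c (Set.Icc 0 1) ∧
        Set.MapsTo c (Set.Icc 0 1) M ∧ c 0 = s ∧ c 1 = q := by
  obtain ⟨Φ, C, C', h⟩ := hM.exists_isStraightening hq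
  set Ψ := h.hasStrictFDerivAt.localInverse Φ _ q with hΨ
  have hΨd := h.hasStrictFDerivAt.to_localInverse
  have hleft := h.hasStrictFDerivAt.eventually_left_inverse
  have hright := h.hasStrictFDerivAt.eventually_right_inverse
  rw [← hΨ] at hΨd hleft hright
  rw [h.map_self] at hΨd hright
  have hΨ0 : Ψ 0 = q := by
    have := hleft.self_of_nhds
    rwa [h.map_self] at this
  obtain ⟨K, s, hs, hK⟩ := hΨd.exists_lipschitzOnWith
  have hΨc : Filter.Tendsto Ψ (𝓝 0) (𝓝 q) := by
    simpa [ContinuousAt, hΨ0] using hΨd.continuousAt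
  obtain ⟨r, hr, hball⟩ := Metric.eventually_nhds_iff_ball.mp
    ((hΨc.eventually ((h.mem_iff.and h.mem_interior).and hW)).and
      (hright.and (Filter.eventually_mem_set.mpr hs)))
  have hΦc : Filter.Tendsto Φ (𝓝 q) (𝓝 0) := by
    simpa [ContinuousAt, h.map_self] using h.hasStrictFDerivAt.continuousAt
  have hLip : LipschitzOnWith K Ψ (Metric.ball 0 r) := hK.mono fun y hy => (hball y hy).2.2
  -- In straightened coordinates convexity gives both claims: `C'` in a ball is connected, and
  -- segments to the origin stay in `C`. The local inverse is Lipschitz and carries them back to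
  -- `M`.
  refine ⟨{x | (x ∈ M ↔ Φ x ∈ C) ∧ Φ x ∈ Metric.ball 0 r ∧ Ψ (Φ x) = x},
    h.mem_iff.and ((hΦc.eventually (Metric.ball_mem_nhds 0 hr)).and hleft),
    Ψ '' (C' ∩ Metric.ball 0 r), ?_, ?_, ?_, ?_⟩
  · rintro _ ⟨y, ⟨hyC, hy⟩, rfl⟩
    obtain ⟨⟨⟨-, h1⟩, h2⟩, h3, -⟩ := hball y hy
    exact ⟨h1 (by rwa [h3]), h2⟩
  · exact ((h.convex'.inter (convex_ball 0 r)).isPreconnected).image _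
      (hLip.continuousOn.mono Set.inter_subset_right)
  · rintro x ⟨hxM, hx1, hx2, hx3⟩
    have hxC : Φ x ∈ closure (C' ∩ Metric.ball 0 r) := by
      rw [Set.inter_comm]
      exact Metric.isOpen_ball.inter_closure ⟨hx2, h.subset_closure (hx1.mp hxM)⟩
    rw [← hx3]
    have hc : ContinuousAt Ψ (Φ x) := hLip.continuousOn.continuousAt
      (Metric.isOpen_ball.mem_nhds hx2)
    exact mem_closure_image hc hxC
  · rintro x ⟨hxM, hx1, hx2, hx3⟩
    have hmem : ∀ t ∈ Set.Icc (0 : ℝ) 1, (1 - t) • Φ x ∈ C ∩ Metric.ball 0 r := by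
      intro t ht
      have hconv : Convex ℝ (C ∩ Metric.ball 0 r) := h.convex.inter (convex_ball 0 r)
      have := hconv ⟨h.zero_mem, Metric.mem_ball_self hr⟩ ⟨hx1.mp hxM, hx2⟩ ht.1
        (sub_nonneg.mpr ht.2) (by ring)
      simpa using this
    have hline : LipschitzWith ‖Φ x‖₊ fun t : ℝ => (1 - t) • Φ x := by
      refine LipschitzWith.of_dist_le_mul fun s t => ?_
      rw [dist_eq_norm, ← sub_smul, norm_smul, coe_nnnorm, mul_comm, dist_comm, dist_eq_norm]
      simp
    refine ⟨fun t => Ψ ((1 - t) • Φ x), K * ‖Φ x‖₊, ?_, ?_, ?_, ?_⟩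
    · exact hLip.comp hline.lipschitzOnWith fun t ht => (hmem t ht).2
    · intro t ht
      obtain ⟨⟨⟨h1, -⟩, -⟩, h3, -⟩ := hball _ (hmem t ht).2
      exact h1.mpr (by rw [h3]; exact (hmem t ht).1)
    · simpa using hx3
    · simpa using hΨ0

end LocalStructure

/-! ### From local to global coincidence. -/

section GlobalCoincidence

variable {n : ℕ}

/-- The points near which `M₁` and `M₂` coincide. -/
def coincidenceSet (M₁ M₂ : Set (Ambient n)) : Set (Ambient n) :=
  {x | ∀ᶠ y in 𝓝 x, y ∈ M₁ ↔ y ∈ M₂}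

theorem isOpen_coincidenceSet (M₁ M₂ : Set (Ambient n)) : IsOpen (coincidenceSet M₁ M₂) :=
  isOpen_setOfPred_eventually_nhds

theorem coincidenceSet_comm (M₁ M₂ : Set (Ambient n)) :
    coincidenceSet M₁ M₂ = coincidenceSet M₂ M₁ := by
  ext x
  exact Filter.eventually_congr (Filter.Eventually.of_forall fun y => iff_comm)

theorem mem_iff_of_mem_coincidenceSet {M₁ M₂ : Set (Ambient n)} {x : Ambient n}
    (h : x ∈ coincidenceSet M₁ M₂) : x ∈ M₁ ↔ x ∈ M₂ :=
  Filter.Eventually.self_of_nhds (p := fun y => y ∈ M₁ ↔ y ∈ M₂) h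

theorem inter_coincidenceSet (M₁ M₂ : Set (Ambient n)) :
    M₁ ∩ coincidenceSet M₁ M₂ = M₂ ∩ coincidenceSet M₁ M₂ :=
  Set.ext fun _ => and_congr_left mem_iff_of_mem_coincidenceSet

theorem IsPreconnected.subset_of_inter_closure_subset {X : Type*} [TopologicalSpace X]
    {s O : Set X} (hs : IsPreconnected s) (hO : IsOpen O) (hne : (s ∩ O).Nonempty)
    (h : s ∩ closure (s ∩ O) ⊆ O) : s ⊆ O := by
  by_contra hcon
  obtain ⟨x, hx, hxO⟩ := Set.not_subset.mp hcon
  obtain ⟨y, hy, hyO, hyc⟩ := hs O (closure (s ∩ O))ᶜ hO isClosed_closure.isOpen_compl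
    (fun z hz => by
      by_cases hzc : z ∈ closure (s ∩ O)
      · exact Or.inl (h ⟨hz, hzc⟩)
      · exact Or.inr hzc) hne ⟨x, hx, fun hxc => hxO (h ⟨hx, hxc⟩)⟩
  exact hyc (subset_closure ⟨hy, hyO⟩)

/-- Let `D` be the connected dense interior part of `M₁` near `q`. A point of `D` that is a limit of
agreement points in `D` lies in `M₂`, which is locally closed, and is interior to `M₂` by
compatibility of the boundaries; so agreement holds there by `hint`. By connectedness agreement
holds on all of `D`, and local closedness of `M₂` extends the inclusion to the closure. -/
theorem eventually_mem_of_mem_closure_coincidenceSet {M₁ M₂ : Set (Ambient n)}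
    (hM₁ : IsEmbeddedHypersurface M₁) (hM₂ : IsEmbeddedHypersurface M₂)
    (hint : hypInterior M₁ ∩ hypInterior M₂ ⊆ coincidenceSet M₁ M₂)
    (hcompat : Disjoint (hypBoundary M₂) (hypInterior M₁)) {q : Ambient n} (hq₁ : q ∈ M₁)
    (hq₂ : q ∈ M₂) (hq : q ∈ closure (M₁ ∩ coincidenceSet M₁ M₂)) :
    ∀ᶠ x in 𝓝 q, x ∈ M₁ → x ∈ M₂ := by
  have hW := hM₂.eventually_mem_of_mem_closure hq₂
  obtain ⟨V, hV, D, hD, hDc, hVD, -⟩ := hM₁.exists_local_structure hq₁ hW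
  have hDM₁ : D ⊆ M₁ := fun x hx => IsInteriorPoint.mem (hD hx).1
  have hDO : D ∩ coincidenceSet M₁ M₂ ⊆ M₂ := fun x hx =>
    (mem_iff_of_mem_coincidenceSet hx.2).mp (hDM₁ hx.1)
  have hne : (D ∩ coincidenceSet M₁ M₂).Nonempty := by
    obtain ⟨s, hsV, hsM, hsO⟩ := mem_closure_iff_nhds.mp hq V hV
    obtain ⟨x, hxO, hxD⟩ := mem_closure_iff_nhds.mp (hVD ⟨hsM, hsV⟩) _
      ((isOpen_coincidenceSet M₁ M₂).mem_nhds hsO)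
    exact ⟨x, hxD, hxO⟩
  have hsub : D ⊆ coincidenceSet M₁ M₂ := by
    refine hDc.subset_of_inter_closure_subset (isOpen_coincidenceSet M₁ M₂) hne ?_
    rintro y ⟨hyD, hyc⟩
    have hy₂ : y ∈ M₂ := (hD hyD).2 (closure_mono hDO hyc)
    refine hint ⟨(hD hyD).1, (hM₂ y hy₂).resolve_right fun hb => ?_⟩
    exact Set.disjoint_left.mp hcompat hb (hD hyD).1
  filter_upwards [hV, hW] with x hxV hxW hxM
  exact hxW (closure_mono (fun z hz => hDO ⟨hz, hsub hz⟩) (hVD ⟨hxM, hxV⟩))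

/-- Completeness propagates coincidence along Lipschitz paths. -/
theorem mem_coincidenceSet_of_path {M₁ M₂ : Set (Ambient n)} (hcomp : IsCompleteHyp M₂)
    (hclosed : ∀ x ∈ M₁, x ∈ M₂ → x ∈ closure (M₁ ∩ coincidenceSet M₁ M₂) →
      x ∈ coincidenceSet M₁ M₂) {c : ℝ → Ambient n} {K : NNReal}
    (hc : LipschitzOnWith K c (Set.Icc 0 1)) (hcM : Set.MapsTo c (Set.Icc 0 1) M₁)
    (h0 : c 0 ∈ coincidenceSet M₁ M₂) : c 1 ∈ coincidenceSet M₁ M₂ := by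
  set O := coincidenceSet M₁ M₂ with hO
  by_contra h1
  have hB : IsCompact (Set.Icc (0 : ℝ) 1 ∩ c ⁻¹' Oᶜ) :=
    isCompact_Icc.of_isClosed_subset (hc.continuousOn.preimage_isClosed_of_isClosed isClosed_Icc
      (isOpen_coincidenceSet M₁ M₂).isClosed_compl) Set.inter_subset_left
  -- The first parameter outside the set of agreement. Before it the path runs in `M₂` too, so
  -- completeness of `M₂` puts `c t` in `M₂`, and `hclosed` applies.
  obtain ⟨t, ⟨ht, htO⟩, htmin⟩ := hB.exists_isLeast ⟨1, by simp, h1⟩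
  have ht0 : 0 < t := by
    rcases ht.1.eq_or_lt with h | h
    · rw [← h] at htO
      exact (htO h0).elim
    · exact h
  have hlt : ∀ s ∈ Set.Ico 0 t, c s ∈ O := by
    intro s hs
    by_contra hsO
    exact (htmin ⟨⟨hs.1, hs.2.le.trans ht.2⟩, hsO⟩).not_gt hs.2
  have hscale : ∀ s ∈ Set.Ico (0 : ℝ) 1, t * s ∈ Set.Ico 0 t := fun s hs =>
    ⟨mul_nonneg ht0.le hs.1, mul_lt_of_lt_one_right ht0 hs.2⟩
  have hscale' : ∀ s ∈ Set.Ico (0 : ℝ) 1, t * s ∈ Set.Icc (0 : ℝ) 1 := fun s hs =>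
    ⟨(hscale s hs).1, (hscale s hs).2.le.trans ht.2⟩
  have hLip : LipschitzOnWith (K * ‖t‖₊) (fun s => c (t * s)) (Set.Ico 0 1) := by
    have hmul : LipschitzWith ‖t‖₊ fun s : ℝ => t * s := by
      refine LipschitzWith.of_dist_le_mul fun a b => ?_
      rw [dist_eq_norm, ← mul_sub, norm_mul, coe_nnnorm, dist_eq_norm]
    exact hc.comp hmul.lipschitzOnWith hscale'
  obtain ⟨q, hq, hlim⟩ := hcomp _ _ hLip fun s hs =>
    (mem_iff_of_mem_coincidenceSet (hlt _ (hscale s hs))).mp (hcM (hscale' s hs))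
  have hev : ∀ᶠ s in 𝓝[<] (1 : ℝ), s ∈ Set.Ico (0 : ℝ) 1 := Ico_mem_nhdsLT one_pos
  have hlim' : Filter.Tendsto (fun s => c (t * s)) (𝓝[<] 1) (𝓝 (c t)) := by
    refine (hc.continuousOn t ht).tendsto.comp (tendsto_nhdsWithin_iff.mpr ⟨?_, ?_⟩)
    · have : ContinuousAt (fun s : ℝ => t * s) 1 := by fun_prop
      simpa [ContinuousAt] using this.tendsto.mono_left nhdsWithin_le_nhds
    · exact hev.mono hscale'
  have hqt : q = c t := tendsto_nhds_unique hlim hlim'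
  refine htO (hclosed (c t) (hcM ht) (hqt ▸ hq) (mem_closure_of_tendsto hlim' ?_))
  exact hev.mono fun s hs => ⟨hcM (hscale' s hs), hlt _ (hscale s hs)⟩

/-- Agreement must be shown to be relatively closed in `M₁`. The difficulty is that a limit point
might not belong to `M₂`, which is not assumed closed in the ambient space. Joining a nearby
agreement point to the limit by a Lipschitz path in `M₁` lets completeness of `M₂` settle this. -/
theorem subset_of_mem_coincidenceSet {M₁ M₂ : Set (Ambient n)}
    (hM₁ : IsEmbeddedHypersurface M₁) (hM₂ : IsEmbeddedHypersurface M₂)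
    (hconn : IsPreconnected M₁) (hcomp : IsCompleteHyp M₂)
    (hint : hypInterior M₁ ∩ hypInterior M₂ ⊆ coincidenceSet M₁ M₂)
    (hcompat : BoundariesCompatible M₁ M₂) {p : Ambient n} (hp₁ : p ∈ M₁)
    (hp : p ∈ coincidenceSet M₁ M₂) : M₁ ⊆ M₂ := by
  have hclosed : ∀ x ∈ M₁, x ∈ M₂ → x ∈ closure (M₁ ∩ coincidenceSet M₁ M₂) →
      x ∈ coincidenceSet M₁ M₂ := by
    intro x hx₁ hx₂ hx
    have e₁ := eventually_mem_of_mem_closure_coincidenceSet hM₁ hM₂ hint hcompat.2 hx₁ hx₂ hx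
    have e₂ := eventually_mem_of_mem_closure_coincidenceSet hM₂ hM₁
      (by rwa [Set.inter_comm, coincidenceSet_comm]) hcompat.1 hx₂ hx₁
      (by rwa [coincidenceSet_comm, ← inter_coincidenceSet])
    filter_upwards [e₁, e₂] with y hy₁ hy₂ using ⟨hy₁, hy₂⟩
  have hsub : M₁ ⊆ coincidenceSet M₁ M₂ := by
    refine hconn.subset_of_inter_closure_subset (isOpen_coincidenceSet M₁ M₂) ⟨p, hp₁, hp⟩ ?_
    rintro q ⟨hq₁, hq⟩
    obtain ⟨V, hV, -, -, -, -, hpath⟩ := hM₁.exists_local_structure hq₁ Filter.univ_mem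
    obtain ⟨s, hsV, hsM, hsO⟩ := mem_closure_iff_nhds.mp hq V hV
    obtain ⟨c, K, hc, hcM, hc0, hc1⟩ := hpath s ⟨hsM, hsV⟩
    rw [← hc1]
    exact mem_coincidenceSet_of_path hcomp hclosed hc hcM (by rwa [hc0])
  exact fun x hx => (mem_iff_of_mem_coincidenceSet (hsub hx)).mp hx

theorem eq_of_mem_coincidenceSet {M₁ M₂ : Set (Ambient n)}
    (hM₁ : IsEmbeddedHypersurface M₁) (hM₂ : IsEmbeddedHypersurface M₂)
    (hconn₁ : IsPreconnected M₁) (hconn₂ : IsPreconnected M₂)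
    (hcomp₁ : IsCompleteHyp M₁) (hcomp₂ : IsCompleteHyp M₂)
    (hint : hypInterior M₁ ∩ hypInterior M₂ ⊆ coincidenceSet M₁ M₂)
    (hcompat : BoundariesCompatible M₁ M₂) {p : Ambient n} (hp₁ : p ∈ M₁)
    (hp : p ∈ coincidenceSet M₁ M₂) : M₁ = M₂ := by
  refine (subset_of_mem_coincidenceSet hM₁ hM₂ hconn₁ hcomp₂ hint hcompat hp₁ hp).antisymm
    (subset_of_mem_coincidenceSet hM₂ hM₁ hconn₂ hcomp₁ ?_ hcompat.symm
      ((mem_iff_of_mem_coincidenceSet hp).mp hp₁) (by rwa [coincidenceSet_comm]))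
  rwa [Set.inter_comm, coincidenceSet_comm]

end GlobalCoincidence

theorem theorem1p2 {n : ℕ} (Γ : Set (Fin n → ℝ)) (γ : (Fin n → ℝ) → ℝ) (α : ℝ)
    (hγ : IsSpeedFunction Γ γ α)
    (M₁ M₂ : Set (Ambient n)) (ν₁ ν₂ : Ambient n → Ambient n)
    (h₁ : IsTranslator Γ γ M₁ ν₁) (h₂ : IsTranslator Γ γ M₂ ν₂)
    (hconv₁ : IsStrictlyConvexHyp M₁ ν₁) (hconv₂ : IsConvexHyp M₂ ν₂)
    (hside : LiesAtOneSide M₁ M₂) :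
    -- interior tangency principle: the hypersurfaces coincide near `p`, and they are equal
    -- if moreover both are complete and no boundary point of one is interior to the other
    (∀ p ∈ hypInterior M₁ ∩ hypInterior M₂,
      tangentSpaceAt M₁ p = tangentSpaceAt M₂ p →
        (∀ᶠ x in 𝓝 p, x ∈ M₁ ↔ x ∈ M₂) ∧
        (IsCompleteHyp M₁ → IsCompleteHyp M₂ → BoundariesCompatible M₁ M₂ → M₁ = M₂)) ∧
    -- boundary tangency principle
    (∀ (a : Ambient n) (b : ℝ), a ≠ 0 →
      hypBoundary M₁ ⊆ affineHyperplane a b → hypBoundary M₂ ⊆ affineHyperplane a b →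
      IsTransversalTo M₁ a b → IsTransversalTo M₂ a b →
      ∀ p ∈ hypBoundary M₁ ∩ hypBoundary M₂,
        -- near `p` both hypersurfaces lie in the same closed half-space
        (∀ᶠ x in 𝓝 p, x ∈ M₁ ∪ M₂ → b ≤ inner ℝ a x) →
        tangentSpaceAt M₁ p = tangentSpaceAt M₂ p →
        tangentSpaceAt (hypBoundary M₁) p = tangentSpaceAt (hypBoundary M₂) p →
          (∀ᶠ x in 𝓝 p, x ∈ M₁ ↔ x ∈ M₂) ∧
          (IsCompleteHyp M₁ → IsCompleteHyp M₂ → BoundariesCompatible M₁ M₂ → M₁ = M₂)) := by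
  -- Local agreement at every common interior point, with tangency supplied by one-sidedness; the
  -- global argument needs it away from `p`.
  have hint : hypInterior M₁ ∩ hypInterior M₂ ⊆ coincidenceSet M₁ M₂ := fun q hq =>
    eventually_mem_iff_of_mem_hypInterior hγ h₁ h₂ hconv₁ hconv₂ hside hq.1 hq.2
  have hglobal : ∀ p ∈ M₁, p ∈ coincidenceSet M₁ M₂ → IsCompleteHyp M₁ → IsCompleteHyp M₂ →
      BoundariesCompatible M₁ M₂ → M₁ = M₂ := fun p hp₁ hp hc₁ hc₂ hcompat =>
    eq_of_mem_coincidenceSet h₁.hypersurface h₂.hypersurface h₁.connected.isPreconnected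
      h₂.connected.isPreconnected hc₁ hc₂ hint hcompat hp₁ hp
  refine ⟨fun p hp _ => ⟨hint hp, hglobal p (IsInteriorPoint.mem hp.1) (hint hp)⟩, ?_⟩
  intro a b ha hbd₁ hbd₂ htr₁ _ p hp hhalf hT _
  have hpO : p ∈ coincidenceSet M₁ M₂ := eventually_mem_iff_of_mem_hypBoundary hγ h₁ h₂ hconv₁
    hconv₂ hside ha hbd₁ hbd₂ htr₁ hp.1 hp.2 hhalf hT
  exact ⟨hpO, hglobal p (IsBoundaryPoint.mem hp.1) hpO⟩
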